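/- Let $f\colon\mathbb R^2\to\mathbb R$ be twice continuously differentiable with bounded level sets and everywhere positive definite Hessian. **Algorithm.** The restricted Nelder–Mead (RNM) algorithm in dimension two produces triangles $\Delta_0,\Delta_1,\dots$ from a nondegenerate triangle $\Delta_0$. In iteration $k$ the vertices of $\Delta_k$ are ordered so that $f(\mathbf p_1)\le f(\mathbf p_2)\le f(\mathbf p_3)$ (ties broken arbitrarily). Put $\bar{\mathbf p}=\frac12(\mathbf p_1+\mathbf p_2)$ and $\mathbf p_r=2\bar{\mathbf p}-\mathbf p_3$. - If $f(\mathbf p_r)<f(\mathbf p_2)$, replace $\mathbf p_3$ by $\mathbf p_r$ (reflection). - If $f(\mathbf p_2)\le f(\mathbf p_r)<f(\mathbf p_3)$, put $\mathbf p_{out}=\frac12(\bar{\mathbf p}+\mathbf p_r)$ and, if $f(\mathbf p_{out})\le f(\mathbf p_r)$, replace $\mathbf p_3$ by $\mathbf p_{out}$; otherwise shrink. - If $f(\mathbf p_r)\ge f(\mathbf p_3)$, put $\mathbf p_{in}=\frac12(\bar{\mathbf p}+\mathbf p_3)$ and, if $f(\mathbf p_{in})<f(\mathbf p_3)$, replace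 $\mathbf p_3$ by $\mathbf p_{in}$; otherwise shrink. A shrink replaces $\mathbf p_2,\mathbf p_3$ by $\frac12(\mathbf p_1+\mathbf p_2),\frac12(\mathbf p_1+\mathbf p_3)$ (this never happens for the functions considered here). Iteration $k$ is a *contraction* if the reflection point is not accepted. The algorithm *converges to* $\mathbf z$ if every vertex sequence tends to $\mathbf z$. **Local frame.** For a point $\mathbf b$ that is not the minimizer of $f$, the local coordinate frame $\mathfrak F(\mathbf b)$ is given by $(\tilde x,\tilde y)^T=M^{-1}(\mathbf p-\mathbf b)$, where $M$ is the unique $2\times2$ matrix with $\det M>0$ such that, for some $\alpha>0$, $$f(\mathbf p)=f(\mathbf b)+\tilde y+\tfrac12\tilde x^2+\tfrac12\alpha\tilde y^2+o(\max(|\tilde x|^2,|\tilde y|^2))\quad\text{as }\mathbf p\to\mathbf b.$$ The *flatness* of a triangle in $\mathfrak F(\mathbf b)$ is $\tilde A/\tilde w^3$, where $\tilde A$ is its area in the coordinates $(\tilde x,\tilde y)$ and $\tilde w$ is the largest difference of the $\tilde x$-coordinates of two of its vertices. **Proposition.** Assume that the RNM algorithm, applied to $f$ and a nondegenerate initial triangle,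 does not converge to the minimizer of $f$. Then there is $K$ such that the following holds for every $k_0\ge K$ for which iteration $k_0$ is a contraction. Let $\mathfrak F_1$ be the frame based at the worst vertex of $\Delta_{k_0}$, let $\mathbf p_{left}$ and $\mathbf p_{right}$ be vertices of $\Delta_{k_0}$ with smallest and largest $\tilde x$-coordinate in $\mathfrak F_1$, let $\mathfrak F_2$ be the frame based at $\frac12(\mathbf p_{left}+\mathbf p_{right})$, and let $\Gamma^{(2)}_k$ be the flatness of $\Delta_k$ in $\mathfrak F_2$. Then there exists $\ell$ with $1\le\ell\le14$ such that $$\Gamma^{(2)}_{k_0+\ell}>1.01\,\Gamma^{(2)}_{k_0}.$$ -/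

import Mathlib

open Filter Topology

namespace RNM

/-- The plane `ℝ²`. Only its affine, topological and differentiable structure is used below, so the
choice of norm is immaterial. -/
abbrev Plane := Fin 2 → ℝ

/-- A labelled triangle. In a run of the algorithm the vertices `0, 1, 2` are the best, the
second-worst and the worst one. -/
abbrev Triangle := Fin 3 → Plane

/-- The class of twice continuously differentiable functions on the plane with bounded level sets
and everywhere positive definite Hessian. -/
structure ClassF (f : Plane → ℝ) : Prop where
  contDiff : ContDiff ℝ 2 f
  bounded_level : ∀ c : ℝ, Bornology.IsBounded {q : Plane | f q = c}
  hessian_pos : ∀ q v : Plane, v ≠ 0 → 0 < fderiv ℝ (fderiv ℝ f) q v v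

/-! ### The restricted Nelder-Mead algorithm in dimension two -/

/-- The average of the two best vertices. -/
noncomputable def centroidBest (T : Triangle) : Plane := (1 / 2 : ℝ) • (T 0 + T 1)

/-- The reflection point. -/
noncomputable def reflectPt (T : Triangle) : Plane := (2 : ℝ) • centroidBest T - T 2

/-- The outside contraction point. -/
noncomputable def outsidePt (T : Triangle) : Plane := (1 / 2 : ℝ) • (centroidBest T + reflectPt T)

/-- The inside contraction point. -/
noncomputable def insidePt (T : Triangle) : Plane := (1 / 2 : ℝ) • (centroidBest T + T 2)

/-- The moves of the restricted algorithm (there is no expansion). -/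
inductive Move
  | reflect
  | outside
  | inside
  | shrink

/-- The move chosen for a triangle whose vertices are ordered by increasing value of `f`. -/
noncomputable def chooseMove (f : Plane → ℝ) (T : Triangle) : Move :=
  if f (reflectPt T) < f (T 1) then Move.reflect
  else if f (reflectPt T) < f (T 2) then
    if f (outsidePt T) ≤ f (reflectPt T) then Move.outside else Move.shrink
  else
    if f (insidePt T) < f (T 2) then Move.inside else Move.shrink

/-- The vertices, not yet reordered, that result from a move. -/
noncomputable def applyMove (T : Triangle) : Move → Triangle
  | Move.reflect => ![T 0, T 1, reflectPt T]
  | Move.outside => ![T 0, T 1, outsidePt T]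
  | Move.inside => ![T 0, T 1, insidePt T]
  | Move.shrink => ![T 0, (1 / 2 : ℝ) • (T 0 + T 1), (1 / 2 : ℝ) • (T 0 + T 2)]

/-- `p k` is the triangle at the start of iteration `k` of a run on `f` from a nondegenerate
triangle. Ties in the ordering of the vertices may be broken in any way, so a run under any
particular tie-breaking rule is a run in this sense. -/
structure IsRun (f : Plane → ℝ) (p : ℕ → Triangle) : Prop where
  nondegenerate : AffineIndependent ℝ (p 0)
  ordered : ∀ k, f (p k 0) ≤ f (p k 1) ∧ f (p k 1) ≤ f (p k 2)
  step : ∀ k, ∃ σ : Equiv.Perm (Fin 3), p (k + 1) = applyMove (p k) (chooseMove f (p k)) ∘ σ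

/-- The algorithm converges to `z`: every vertex sequence tends to `z`. -/
def ConvergesTo (p : ℕ → Triangle) (z : Plane) : Prop :=
  ∀ i : Fin 3, Tendsto (fun k => p k i) atTop (𝓝 z)

/-- A contraction step is taken at `T`, meaning that the reflection point is not accepted. (Shrink
steps do not occur for strictly convex functions.) -/
def IsContraction (f : Plane → ℝ) (T : Triangle) : Prop := chooseMove f T ≠ Move.reflect

/-! ### Local coordinate frames -/

/-- `M` is the matrix of the local coordinate frame of `f` with base point `b`: it has positive
determinant and, in the coordinates `q = M⁻¹ (p - b)`,
`f p = f b + q 1 + (q 0)² / 2 + α (q 1)² / 2 + o (max (|q 0|², |q 1|²))` for some `α > 0`. -/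
def IsFrameMatrix (f : Plane → ℝ) (b : Plane) (M : Matrix (Fin 2) (Fin 2) ℝ) : Prop :=
  0 < M.det ∧ ∃ α : ℝ, 0 < α ∧
    (fun q : Plane => f (M.mulVec q + b)
        - (f b + q 1 + 1 / 2 * (q 0) ^ 2 + 1 / 2 * α * (q 1) ^ 2))
      =o[𝓝 0] (fun q : Plane => max (|q 0| ^ 2) (|q 1| ^ 2))

/-- Second order Taylor expansion. -/
theorem taylor_two {f : Plane → ℝ} (hf : ContDiff ℝ 2 f) (b : Plane) :
    (fun v : Plane => f (v + b) - (f b + fderiv ℝ f b v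
        + 1 / 2 * fderiv ℝ (fderiv ℝ f) b v v)) =o[𝓝 0] (fun v : Plane => ‖v‖ ^ 2) := by
  have hd : Differentiable ℝ f := hf.differentiable (by norm_num)
  have hd' : Differentiable ℝ (fderiv ℝ f) :=
    (hf.fderiv_right (m := 1) (by norm_num)).differentiable (by norm_num)
  set G := fderiv ℝ f b with hG
  set H := fderiv ℝ (fderiv ℝ f) b with hH
  have hsymm : ∀ v w, H v w = H w v :=
    second_derivative_symmetric (fun y => (hd y).hasFDerivAt) (hd' b).hasFDerivAt
  have hder : ∀ v : Plane, HasFDerivAt (fun v : Plane => f (v + b) - (f b + G v + 1 / 2 * H v v))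
      (fderiv ℝ f (v + b) - (G + H v)) v := by
    intro v
    have h1 : HasFDerivAt (fun v : Plane => f (v + b)) (fderiv ℝ f (v + b)) v := 
      (hasFDerivAt_comp_add_right b).2 (hd (v + b)).hasFDerivAt
    have h2 : HasFDerivAt (fun v : Plane => H v v)
        (H v + H.flip v) v := by
      have := (H.hasFDerivAt (x := v)).clm_apply (hasFDerivAt_id v)
      refine this.congr_fderiv ?_
      ext w; simp
    have h3 := h1.sub (((hasFDerivAt_const (f b) v).add (G.hasFDerivAt (x := v))).add
      (h2.const_mul (1 / 2 : ℝ)))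
    refine h3.congr_fderiv ?_
    ext w
    simp [hsymm w v]
    ring
  have ho := (hd' b).hasFDerivAt.isLittleO
  rw [Asymptotics.isLittleO_iff] at ho ⊢
  intro ε hε
  have h1 := ho hε
  rw [Metric.eventually_nhds_iff_ball] at h1 ⊢
  obtain ⟨δ, hδ, h1⟩ := h1
  refine ⟨δ, hδ, fun v hv => ?_⟩
  have hbd : ∀ w ∈ Metric.closedBall (0 : Plane) ‖v‖,
      ‖fderiv ℝ f (w + b) - (G + H w)‖ ≤ ε * ‖v‖ := by
    intro w hw
    have hw' : ‖w‖ ≤ ‖v‖ := by simpa using hw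
    have hvδ : ‖v‖ < δ := by simpa using hv
    have := h1 (w + b) (by simpa using lt_of_le_of_lt hw' hvδ)
    simp only [add_sub_cancel_right] at this
    rw [← sub_sub]
    exact this.trans (by gcongr)
  have hmv := (convex_closedBall (0 : Plane) ‖v‖).norm_image_sub_le_of_norm_hasFDerivWithin_le
    (fun w _ => (hder w).hasFDerivWithinAt) hbd
    (x := 0) (y := v) (by simp) (by simp)
  simpa [pow_two, mul_assoc] using hmv

/-- The error scale of the frame is the square of the maximum norm. -/
theorem frame_norm (q : Plane) : max (|q 0| ^ 2) (|q 1| ^ 2) = ‖q‖ ^ 2 := by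
  have h : ‖q‖ = max |q 0| |q 1| := by
    apply le_antisymm
    · rw [pi_norm_le_iff_of_nonneg (by positivity)]
      intro i
      fin_cases i <;> simp
    · exact max_le (norm_le_pi_norm q 0) (norm_le_pi_norm q 1)
  rw [h]
  rcases le_total |q 0| |q 1| with h | h
  · rw [max_eq_right h, max_eq_right (by gcongr)]
  · rw [max_eq_left h, max_eq_left (by gcongr)]

/-- A polynomial `t L + t² Q` that is `o (t²)` vanishes. -/
theorem linear_quadratic_zero {L Q : ℝ}
    (h : (fun t : ℝ => t * L + t ^ 2 * Q) =o[𝓝 0] (fun t : ℝ => t ^ 2)) : L = 0 ∧ Q = 0 := by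
  have hL : L = 0 := by
    have h1 : (fun t : ℝ => t * L) =o[𝓝 0] (fun t : ℝ => t) := by
      have h2 : (fun t : ℝ => t ^ 2) =o[𝓝 0] (fun t : ℝ => t) := by
        simpa using Asymptotics.isLittleO_pow_pow (𝕜 := ℝ) (m := 1) (n := 2) (by norm_num)
      have h3 : (fun t : ℝ => t ^ 2 * Q) =o[𝓝 0] (fun t : ℝ => t) := by
        simpa [mul_comm] using h2.const_mul_left Q
      simpa using (h.trans h2).sub h3
    by_contra hne
    have h4 : (fun t : ℝ => t) =o[𝓝 0] (fun t : ℝ => t) := by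
      have := h1.const_mul_left L⁻¹
      refine this.congr_left ?_
      intro t; field_simp
    have h5 := h4.mono (nhdsWithin_le_nhds (s := {0}ᶜ))
    have := Asymptotics.isLittleO_irrefl
      (l := 𝓝[≠] (0 : ℝ)) (f'' := fun t : ℝ => t)
      (Filter.Eventually.frequently (by
        filter_upwards [self_mem_nhdsWithin] with t ht using ht))
    exact this h5
  refine ⟨hL, ?_⟩
  subst hL
  by_contra hne
  have h4 : (fun t : ℝ => t ^ 2) =o[𝓝 0] (fun t : ℝ => t ^ 2) := by
    have := h.const_mul_left Q⁻¹
    refine this.congr_left ?_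
    intro t; field_simp; ring
  have h5 := h4.mono (nhdsWithin_le_nhds (s := {0}ᶜ))
  have := Asymptotics.isLittleO_irrefl
    (l := 𝓝[≠] (0 : ℝ)) (f'' := fun t : ℝ => t ^ 2)
    (Filter.Eventually.frequently (by
      filter_upwards [self_mem_nhdsWithin] with t ht using pow_ne_zero 2 ht))
  exact this h5

/-- The frame condition in terms of first and second derivatives. -/
theorem isFrameMatrix_iff {f : Plane → ℝ} (hf : ContDiff ℝ 2 f) (b : Plane)
    (M : Matrix (Fin 2) (Fin 2) ℝ) :
    IsFrameMatrix f b M ↔ 0 < M.det ∧ ∃ α : ℝ, 0 < α ∧ ∀ q : Plane,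
      fderiv ℝ f b (M.mulVec q) = q 1 ∧
      fderiv ℝ (fderiv ℝ f) b (M.mulVec q) (M.mulVec q) = (q 0) ^ 2 + α * (q 1) ^ 2 := by
  unfold IsFrameMatrix
  refine and_congr_right fun _ => exists_congr fun α => and_congr_right fun _ => ?_
  set A : Plane →L[ℝ] Plane := LinearMap.toContinuousLinearMap M.mulVecLin with hA
  have hAq : ∀ q, A q = M.mulVec q := fun q => rfl
  have hT : (fun q : Plane => f (M.mulVec q + b) - (f b + fderiv ℝ f b (M.mulVec q)
        + 1 / 2 * fderiv ℝ (fderiv ℝ f) b (M.mulVec q) (M.mulVec q)))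
      =o[𝓝 0] (fun q : Plane => ‖q‖ ^ 2) := by
    have h0 : Tendsto A (𝓝 0) (𝓝 0) := by simpa using A.continuous.tendsto 0
    have h1 := (taylor_two hf b).comp_tendsto h0
    refine h1.trans_isBigO ?_
    exact (A.isBigO_id (𝓝 0)).norm_norm.pow 2
  simp only [frame_norm]
  constructor
  · intro h q
    have h1 := hT.sub h
    have h2 : Tendsto (fun t : ℝ => t • q) (𝓝 0) (𝓝 0) := by
      have : Continuous (fun t : ℝ => t • q) := by fun_prop
      simpa using this.tendsto 0
    have h3 := h1.comp_tendsto h2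
    have h4 : (fun t : ℝ => t * (q 1 - fderiv ℝ f b (M.mulVec q)) + t ^ 2 *
        (1 / 2 * (q 0) ^ 2 + 1 / 2 * α * (q 1) ^ 2
          - 1 / 2 * fderiv ℝ (fderiv ℝ f) b (M.mulVec q) (M.mulVec q)))
        =o[𝓝 0] (fun t : ℝ => t ^ 2) := by
      have h5 : (fun t : ℝ => ‖t • q‖ ^ 2) =O[𝓝 0] (fun t : ℝ => t ^ 2) := by
        apply Asymptotics.IsBigO.of_bound (‖q‖ ^ 2)
        refine Filter.Eventually.of_forall fun t => ?_
        simp [norm_smul, mul_pow, mul_comm]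
      refine (h3.trans_isBigO h5).congr_left fun t => ?_
      simp only [Function.comp, Matrix.mulVec_smul, map_smul, Pi.smul_apply, smul_eq_mul,
        _root_.smul_apply]
      ring
    obtain ⟨hL, hQ⟩ := linear_quadratic_zero h4
    exact ⟨by linarith, by linarith⟩
  · intro h
    refine hT.congr_left fun q => ?_
    rw [(h q).1, (h q).2]
    ring

/-- At every noncritical point there is exactly one frame matrix. -/
theorem existsUnique_isFrameMatrix {f : Plane → ℝ} (hf : ClassF f) {b : Plane}
    (hb : fderiv ℝ f b ≠ 0) : ∃! M, IsFrameMatrix f b M := by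
  have hd : Differentiable ℝ f := hf.contDiff.differentiable (by norm_num)
  have hd' : Differentiable ℝ (fderiv ℝ f) :=
    (hf.contDiff.fderiv_right (m := 1) (by norm_num)).differentiable (by norm_num)
  have hsymm : ∀ v w, fderiv ℝ (fderiv ℝ f) b v w = fderiv ℝ (fderiv ℝ f) b w v :=
    second_derivative_symmetric (fun y => (hd y).hasFDerivAt) (hd' b).hasFDerivAt
  have hpos := hf.hessian_pos b
  simp only [isFrameMatrix_iff hf.contDiff]
  set G := fderiv ℝ f b with hG
  set H := fderiv ℝ (fderiv ℝ f) b with hH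
  have hvec : ∀ v : Plane, v = v 0 • (Pi.single 0 1 : Plane) + v 1 • (Pi.single 1 1 : Plane) := by
    intro v; ext i; fin_cases i <;> simp
  obtain ⟨g0, hg0⟩ : ∃ x, G (Pi.single 0 1) = x := ⟨_, rfl⟩
  obtain ⟨g1, hg1⟩ : ∃ x, G (Pi.single 1 1) = x := ⟨_, rfl⟩
  obtain ⟨h00, hh00⟩ : ∃ x, H (Pi.single 0 1) (Pi.single 0 1) = x := ⟨_, rfl⟩
  obtain ⟨h01, hh01⟩ : ∃ x, H (Pi.single 0 1) (Pi.single 1 1) = x := ⟨_, rfl⟩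
  obtain ⟨h11, hh11⟩ : ∃ x, H (Pi.single 1 1) (Pi.single 1 1) = x := ⟨_, rfl⟩
  have hGv : ∀ v, G v = g0 * v 0 + g1 * v 1 := by
    intro v
    conv_lhs => rw [hvec v]
    simp only [map_add, map_smul, hg0, hg1, smul_eq_mul]
    ring
  have hHv : ∀ v, H v v = h00 * v 0 ^ 2 + 2 * h01 * v 0 * v 1 + h11 * v 1 ^ 2 := by
    intro v
    conv_lhs => rw [hvec v]
    simp only [map_add, map_smul, _root_.add_apply, _root_.smul_apply,
      hh00, hh01, hsymm (Pi.single 1 1) (Pi.single 0 1), hh11, smul_eq_mul]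
    ring
  have hg : g0 ≠ 0 ∨ g1 ≠ 0 := by
    by_contra! hcon
    apply hb
    ext v
    rw [hGv]
    simp [hcon.1, hcon.2]
  have hD : 0 < h00 * g1 ^ 2 - 2 * h01 * g0 * g1 + h11 * g0 ^ 2 := by
    have hne : (![g1, -g0] : Plane) ≠ 0 := by
      intro h0
      have h1 := congrFun h0 0
      have h2 := congrFun h0 1
      simp at h1 h2
      tauto
    have := hpos _ hne
    rw [hHv] at this
    simp at this
    linarith
  set D := h00 * g1 ^ 2 - 2 * h01 * g0 * g1 + h11 * g0 ^ 2 with hDdef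
  simp only [hGv, hHv, Matrix.mulVec, dotProduct, Fin.sum_univ_two, Matrix.det_fin_two]
  have hs : 0 < √D := Real.sqrt_pos.2 hD
  have hss : √D ^ 2 = D := Real.sq_sqrt hD.le
  obtain ⟨ξ, hξ⟩ : ∃ ξ, ξ = (√D)⁻¹ := ⟨_, rfl⟩
  have hξ0 : 0 < ξ := by rw [hξ]; positivity
  have hξD : ξ ^ 2 * D = 1 := by rw [hξ, inv_pow, hss]; field_simp
  obtain ⟨w0, hw0⟩ : ∃ x, x * D = -(h01 * g1 - h11 * g0) := ⟨_, div_mul_cancel₀ _ hD.ne'⟩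
  obtain ⟨w1, hw1⟩ : ∃ x, x * D = h00 * g1 - h01 * g0 := ⟨_, div_mul_cancel₀ _ hD.ne'⟩
  have hgw : g0 * w0 + g1 * w1 = 1 := by
    apply mul_right_cancel₀ hD.ne'
    linear_combination g0 * hw0 + g1 * hw1 - hDdef
  have hkw : (h00 * g1 - h01 * g0) * w0 + (h01 * g1 - h11 * g0) * w1 = 0 := by
    apply mul_right_cancel₀ hD.ne'
    linear_combination (h00 * g1 - h01 * g0) * hw0 + (h01 * g1 - h11 * g0) * hw1
  refine ⟨!![ξ * g1, w0; -(ξ * g0), w1], ⟨?_, ?_⟩, ?_⟩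
  · simp
    nlinarith
  · refine ⟨h00 * w0 ^ 2 + 2 * h01 * w0 * w1 + h11 * w1 ^ 2, ?_, ?_⟩
    · have hne : (![w0, w1] : Plane) ≠ 0 := by
        intro h0
        have h1 := congrFun h0 0
        have h2 := congrFun h0 1
        simp at h1 h2
        simp [h1, h2] at hgw
      have := hpos _ hne
      rw [hHv] at this
      simpa using this
    · intro q
      simp
      refine ⟨by linear_combination (q 1) * hgw, ?_⟩
      linear_combination (q 0) ^ 2 * hξD + 2 * ξ * q 0 * q 1 * hkw + (q 0) ^ 2 * ξ ^ 2 * hDdef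
  · rintro N ⟨hdet, α, hα, hN⟩
    have e0 := hN ![1, 0]
    have e1 := hN ![0, 1]
    have e2 := hN ![1, 1]
    simp at e0 e1 e2
    obtain ⟨e0, e0'⟩ := e0
    obtain ⟨e1, e1'⟩ := e1
    obtain ⟨e2, e2'⟩ := e2
    obtain ⟨a, ha⟩ : ∃ x, N 0 0 = x := ⟨_, rfl⟩
    obtain ⟨c, hc⟩ : ∃ x, N 0 1 = x := ⟨_, rfl⟩
    obtain ⟨b', hb'⟩ : ∃ x, N 1 0 = x := ⟨_, rfl⟩
    obtain ⟨d, hd⟩ : ∃ x, N 1 1 = x := ⟨_, rfl⟩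
    simp only [ha, hb', hc, hd] at hdet e0 e0' e1 e1' e2 e2'
    obtain ⟨δ, hδ⟩ : ∃ x, x = a * d - c * b' := ⟨_, rfl⟩
    have ea : a = δ * g1 := by rw [hδ]; linear_combination (-a) * e1 + c * e0
    have eb : b' = -(δ * g0) := by rw [hδ]; linear_combination (-b') * e1 + d * e0
    have eD : δ ^ 2 * D = 1 := by
      rw [hDdef, ← e0', ea, eb]; ring
    have eδ : δ = ξ := by
      have : δ ^ 2 = ξ ^ 2 := mul_right_cancel₀ hD.ne' (eD.trans hξD.symm)
      exact (pow_left_inj₀ (by rw [hδ]; linarith) hξ0.le (by norm_num)).1 this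
    have hk : (h00 * g1 - h01 * g0) * c + (h01 * g1 - h11 * g0) * d = 0 := by
      have : δ * ((h00 * g1 - h01 * g0) * c + (h01 * g1 - h11 * g0) * d) = 0 := by
        rw [ea, eb] at e2' e0'
        linear_combination (1 / 2) * (e2' - e0' - e1')
      exact (mul_eq_zero.1 this).resolve_left (by rw [eδ]; exact hξ0.ne')
    have ec : c = w0 := by
      apply mul_right_cancel₀ hD.ne'
      rw [hw0, hDdef]
      linear_combination g1 * hk - (h01 * g1 - h11 * g0) * e1
    have ed : d = w1 := by
      apply mul_right_cancel₀ hD.ne'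
      rw [hw1, hDdef]
      linear_combination -g0 * hk + (h00 * g1 - h01 * g0) * e1
    ext i j
    fin_cases i <;> fin_cases j <;> simp [ha, hb', hc, hd, ea, eb, ec, ed, eδ]


/-- The matrix of the local coordinate frame of `f` with base point `b`. By
`existsUnique_isFrameMatrix` it is determined by `IsFrameMatrix` at every noncritical `b`. -/
noncomputable def frameMatrix (f : Plane → ℝ) (b : Plane) : Matrix (Fin 2) (Fin 2) ℝ :=
  Classical.epsilon (IsFrameMatrix f b)

/-- The triangle `T` in the local coordinate frame of `f` with base point `b`. -/
noncomputable def inFrame (f : Plane → ℝ) (b : Plane) (T : Triangle) : Triangle :=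
  fun i => (frameMatrix f b)⁻¹.mulVec (T i - b)

/-- The largest difference of the first coordinates of two vertices. -/
noncomputable def width (T : Triangle) : ℝ :=
  max (max |T 0 0 - T 1 0| |T 1 0 - T 2 0|) |T 2 0 - T 0 0|

/-- The (positive) area of a triangle. -/
noncomputable def area (T : Triangle) : ℝ :=
  |(T 1 0 - T 0 0) * (T 2 1 - T 0 1) - (T 2 0 - T 0 0) * (T 1 1 - T 0 1)| / 2

/-- The flatness `area / width³` of `T`, measured in the local coordinate frame of `f` with base
point `b`. -/
noncomputable def flatness (f : Plane → ℝ) (b : Plane) (T : Triangle) : ℝ :=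
  area (inFrame f b T) / width (inFrame f b T) ^ 3

/-- `c` is a base point of the second coordinate frame of `T`: it is the midpoint of the vertices
of `T` with leftmost and rightmost first coordinate in the first coordinate frame, the one based at
the worst vertex `T 2`. (A choice is possible only if several vertices are leftmost or
rightmost.) -/
def IsSecondBase (f : Plane → ℝ) (T : Triangle) (c : Plane) : Prop :=
  ∃ l r : Fin 3,
    (∀ i, inFrame f (T 2) T l 0 ≤ inFrame f (T 2) T i 0) ∧
    (∀ i, inFrame f (T 2) T i 0 ≤ inFrame f (T 2) T r 0) ∧
    c = midpoint ℝ (T l) (T r)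

end RNM

/-!
The proof is by contradiction, through a blow-up limit in which the run becomes a run on the single
function `y + x² / 2`, where the claim is a finite computation.

By strict convexity no move is a shrink, and a contraction decreases the sum of the three function
values by an amount that controls the diameter of the triangle and the range of the values on it
(`valueSum_contraction_le`). The sum converges, so contractions far along the run are made at small
triangles with almost equal values. If the run does not converge to the minimizer, then the limit of
the sum is greater than three times the minimum (`IsRun.lt_limit`). Hence the triangles at which
contractions are made accumulate only at noncritical points of `f`, where the local frames are
defined, with estimates that are uniform in the base point (`frame_expansion`).

Suppose that the flatness fails to increase after infinitely many contractions, and let `U` be an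
ultrafilter of such times `k`. Let `w k` be the width of the triangle in its second frame. A
contraction forces its heights to be of order `w ^ 2` (`height_le`). So the triangles converge along
`U`, after rescaling first coordinates by `w` and second coordinates by `w ^ 2`. Under the same
rescaling the function converges to `y + x² / 2` (`LimitAt.value`), and therefore every comparison
of function values in the next moves passes to the limit as a weak inequality. Each contraction
halves the area and a reflection keeps it, so a flatness that is at most `1.01` times the initial
one means that the limiting width after `c` contractions is at least `(1.01 * 2 ^ c) ^ (-1 / 3)`.
The limits therefore form a run of the limiting dynamics, where ties may be broken either way, that
satisfies these lower bounds on the width; this is the predicate `Persists`, and `Follows.persists`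
makes the transition.

It remains to see that the limiting dynamics has no such run that starts with a contraction
(`not_persists_contraction`). The affine maps of the plane that preserve `y + x² / 2` up to a
constant, and the fact that an outside contraction is an inside contraction of the reflected
triangle, reduce this to triangles with three real parameters, of which one, `s`, lies in
`[0, 0.209]`. All function values are then affine in the two other parameters, in `s` and in
`s ^ 2`. There are few possible sequences of moves, and each ends after at most twelve moves with
contradictory comparisons or too small a width (`not_persists_normalized`).
-/

namespace RNM

/-! ### The limiting dynamics -/

/-- A vertex of a triangle in the rescaled limit, given by its first coordinate and its function
value. The limiting objective is `y + x² / 2`, so the value at an affine combination of vertices is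
the same combination of their values plus a quadratic form in the differences of their first
coordinates, and second coordinates need not be recorded. -/
abbrev Vertex := ℝ × ℝ

namespace Vertex

/-- The reflection of `C` in the midpoint of `A` and `B`. -/
def reflect (A B C : Vertex) : Vertex :=
  (A.1 + B.1 - C.1, A.2 + B.2 - C.2 + (C.1 - A.1) * (C.1 - B.1))

/-- The inside contraction of `C` towards the midpoint of `A` and `B`. -/
noncomputable def inside (A B C : Vertex) : Vertex :=
  ((A.1 + B.1) / 4 + C.1 / 2, (A.2 + B.2) / 4 + C.2 / 2
    - ((A.1 - B.1) ^ 2 / 32 + (A.1 - C.1) ^ 2 / 16 + (B.1 - C.1) ^ 2 / 16))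

/-- The outside contraction of `C`. It is the inside contraction of the reflection of `C`. -/
noncomputable def outside (A B C : Vertex) : Vertex := inside A B (reflect A B C)

end Vertex

/-- The largest difference of the first coordinates of two vertices. -/
noncomputable def spread (A B C : Vertex) : ℝ :=
  max (max |A.1 - B.1| |B.1 - C.1|) |C.1 - A.1|

/-- A move of the algorithm on `y + x² / 2` with worst vertex `C`, after which `Q` holds. The
arguments of `Q` are the number of contractions so far, whether the last move was a reflection, and
the new triangle, whose third vertex is the new one. All comparisons are weak, as they arise from
passing to a limit. -/
def Step (Q : ℕ → Bool → Vertex → Vertex → Vertex → Prop) (c : ℕ) (A B C : Vertex) : Prop :=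
  A.2 ≤ C.2 ∧ B.2 ≤ C.2 ∧
    (((A.reflect B C).2 ≤ max A.2 B.2 ∧ Q c true A B (A.reflect B C)) ∨
      (max A.2 B.2 ≤ (A.reflect B C).2 ∧ (A.reflect B C).2 ≤ C.2 ∧
        Q (c + 1) false A B (A.outside B C)) ∨
      (max A.2 B.2 ≤ (A.reflect B C).2 ∧ C.2 ≤ (A.reflect B C).2 ∧
        Q (c + 1) false A B (A.inside B C)))

/-- There is a run of `n` moves on `y + x² / 2` from the triangle `A B C`, reached after `c`
contractions from a triangle of width `1`, along which the flatness never exceeds `1.01` times that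
of the triangle of width `1`. The flag `r` says that the last move was a reflection; its result `C`
is then not the worst vertex. -/
def Persists : ℕ → ℕ → Bool → Vertex → Vertex → Vertex → Prop
  | 0, c, _, A, B, C => 1 ≤ 1.01 * 2 ^ c * spread A B C ^ 3
  | n + 1, c, r, A, B, C => 1 ≤ 1.01 * 2 ^ c * spread A B C ^ 3 ∧
      ((r = false ∧ Step (Persists n) c A B C) ∨ Step (Persists n) c B C A ∨
        Step (Persists n) c C A B)

theorem Persists.one_le {n c : ℕ} {r : Bool} {A B C : Vertex} (h : Persists n c r A B C) :
    1 ≤ 1.01 * 2 ^ c * spread A B C ^ 3 := by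
  cases n with
  | zero => exact h
  | succ n => exact h.1

/-- A bound `κ` that the width has to exceed, as a disjunction of linear inequalities. It is used
with decimal numbers `κ` slightly below `(1.01 * 2 ^ c) ^ (-1 / 3)`. -/
theorem Persists.lt_spread {n c : ℕ} {r : Bool} {xa ga xb gb xc gc : ℝ}
    (h : Persists n c r (xa, ga) (xb, gb) (xc, gc)) (κ : ℝ)
    (hκ : 1.01 * 2 ^ c * κ ^ 3 < 1) :
    κ < xa - xb ∨ κ < xb - xa ∨ κ < xb - xc ∨ κ < xc - xb ∨ κ < xc - xa ∨ κ < xa - xc := by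
  have h1 : κ < spread (xa, ga) (xb, gb) (xc, gc) := by
    by_contra! h2
    have h3 : 0 ≤ spread (xa, ga) (xb, gb) (xc, gc) := le_max_of_le_right (abs_nonneg _)
    have h4 : (1.01 : ℝ) * 2 ^ c * spread (xa, ga) (xb, gb) (xc, gc) ^ 3
        ≤ 1.01 * 2 ^ c * κ ^ 3 := by gcongr
    linarith [h.one_le]
  simp only [spread, lt_max_iff, lt_abs, neg_sub] at h1
  tauto

/-- A move written out in coordinates. -/
def CoordStep (n c : ℕ) (xa ga xb gb xc gc : ℝ) : Prop :=
  ga ≤ gc ∧ gb ≤ gc ∧ ∃ gr, gr = ga + gb - gc + (xc - xa) * (xc - xb) ∧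
    (((gr ≤ ga ∨ gr ≤ gb) ∧ ∃ x, x = xa + xb - xc ∧ Persists n c true (xa, ga) (xb, gb) (x, gr)) ∨
      (ga ≤ gr ∧ gb ≤ gr ∧ gr ≤ gc ∧ ∃ x g, x = 3 / 4 * (xa + xb) - xc / 2 ∧
        g = (ga + gb) / 4 + gr / 2
          - ((xa - xb) ^ 2 / 32 + (xb - xc) ^ 2 / 16 + (xa - xc) ^ 2 / 16) ∧
        Persists n (c + 1) false (xa, ga) (xb, gb) (x, g)) ∨
      (ga ≤ gr ∧ gb ≤ gr ∧ gc ≤ gr ∧ ∃ x g, x = (xa + xb) / 4 + xc / 2 ∧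
        g = (ga + gb) / 4 + gc / 2
          - ((xa - xb) ^ 2 / 32 + (xa - xc) ^ 2 / 16 + (xb - xc) ^ 2 / 16) ∧
        Persists n (c + 1) false (xa, ga) (xb, gb) (x, g)))

theorem Step.coord {n c : ℕ} {xa ga xb gb xc gc : ℝ}
    (h : Step (Persists n) c (xa, ga) (xb, gb) (xc, gc)) : CoordStep n c xa ga xb gb xc gc := by
  simp only [Step, Vertex.reflect, Vertex.outside, Vertex.inside, le_max_iff, max_le_iff] at h
  obtain ⟨h1, h2, h⟩ := h
  refine ⟨h1, h2, _, rfl, ?_⟩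
  rcases h with ⟨h3, h⟩ | ⟨⟨h3, h4⟩, h5, h⟩ | ⟨⟨h3, h4⟩, h5, h⟩
  · exact Or.inl ⟨h3, _, rfl, h⟩
  · refine Or.inr (Or.inl ⟨h3, h4, h5, _, _, rfl, rfl, ?_⟩)
    convert h using 2 <;> ring
  · exact Or.inr (Or.inr ⟨h3, h4, h5, _, _, rfl, rfl, h⟩)

theorem Persists.coord {n c : ℕ} {r : Bool} {xa ga xb gb xc gc : ℝ}
    (h : Persists (n + 1) c r (xa, ga) (xb, gb) (xc, gc)) :
    (r = false ∧ CoordStep n c xa ga xb gb xc gc) ∨ CoordStep n c xb gb xc gc xa ga ∨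
      CoordStep n c xc gc xa ga xb gb := by
  rcases h.2 with ⟨hr, h⟩ | h | h
  · exact Or.inl ⟨hr, h.coord⟩
  · exact Or.inr (Or.inl h.coord)
  · exact Or.inr (Or.inr h.coord)

/-! ### The tree of runs after a contraction -/

set_option maxHeartbeats 4000000 in
/-- Impossibility of a persistent run, for a triangle normalized by the symmetries of the dynamics:
the contracted vertex is `(0, 0)`, and the other two are `(s, u)` and `(1, v)`. The bound on `s`
says that the width after the contraction is not too small, and `hq` that the reflection point is no
better than the contracted vertex.

The proof follows all runs. Every first coordinate is affine in `s`, and every value is affine in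
`u`, `v`, `s` and `t = s ^ 2`. So the comparisons made along a branch are linear inequalities in
these four variables. A branch ends when they contradict each other and the tangent bounds `ht2`, …,
`ht6` or the chord bound `ht1` on the parabola `t = s ^ 2`, or when the width becomes too small. The
last branches end with the twelfth move. In the names, `hA` and `hB` say that the vertex to be
replaced is the worst, `hR` and `hS` compare the reflection point with the other two vertices, and
`hT` compares it with the worst one; the number is the depth in the tree. -/
theorem not_persists_normalized {s t u v : ℝ} (hs : 0 ≤ s) (hs1 : s ≤ 0.209) (ht : t = s ^ 2)
    (hu : u ≤ 0) (hv : v ≤ 0) (hq : 0 ≤ u + v + s)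
    (h : Persists 11 1 false (s, u) (1, v)
      (1 / 4 * s + 1 / 4, 1 / 4 * u + 1 / 4 * v - 3 / 32 * t + 1 / 16 * s - 3 / 32)) : False := by
  have ht0 : 0 ≤ t := by rw [ht]; positivity
  have ht1 : t ≤ 0.209 * s := by nlinarith
  have ht2 : 1/10 * s - (1/20) ^ 2 ≤ t := by nlinarith [sq_nonneg (s - 1/20)]
  have ht3 : 1/5 * s - (1/10) ^ 2 ≤ t := by nlinarith [sq_nonneg (s - 1/10)]
  have ht4 : 3/10 * s - (3/20) ^ 2 ≤ t := by nlinarith [sq_nonneg (s - 3/20)]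
  have ht5 : 7/20 * s - (7/40) ^ 2 ≤ t := by nlinarith [sq_nonneg (s - 7/40)]
  have ht6 : 2/5 * s - (1/5) ^ 2 ≤ t := by nlinarith [sq_nonneg (s - 1/5)]
  rcases h.coord with ⟨-, h⟩ | h | h
  · obtain ⟨hA1, hB1, -⟩ := h; linarith only [ht3, hA1, hB1, hq, hs1]
  · obtain ⟨hA1, hB1, r, hr, h⟩ := h
    obtain rfl : r = -(3 / 4 * u) + 5 / 4 * v + 21 / 32 * t - 15 / 16 * s + 5 / 32 := by
      rw [hr, ht]; ring
    rcases h with ⟨hR1, x, hx, h⟩ | ⟨hR1, hS1, hT1, x, g, hx, hg, h⟩ |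
      ⟨hR1, hS1, hT1, x, g, hx, hg, h⟩
    · obtain rfl : x = -(3 / 4 * s) + 5 / 4 := by rw [hx]; ring
      rcases h.coord with ⟨⟨⟩, -⟩ | h | h
      · obtain ⟨hA2, hB2, r, hr, h⟩ := h
        obtain rfl : r = -(1 / 2 * u) + 1 / 2 * v + 3 / 8 * t - 1 / 4 * s - 1 / 8 := by
          rw [hr, ht]; ring
        rcases h with ⟨hR2, x, hx, h⟩ | ⟨hR2, hS2, hT2, x, g, hx, hg, h⟩ |
          ⟨hR2, hS2, hT2, x, g, hx, hg, h⟩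
        · obtain rfl : x = -(1 / 2 * s) + 1 / 2 := by rw [hx]; ring
          rcases h.coord with ⟨⟨⟩, -⟩ | h | h
          · obtain ⟨hA3, hB3, r, hr, h⟩ := h
            obtain rfl : r = -(3 / 2 * u) + 3 / 2 * v + 15 / 8 * t - 9 / 4 * s + 3 / 8 := by
              rw [hr, ht]; ring
            rcases h with ⟨hR3, x, hx, h⟩ | ⟨hR3, hS3, hT3, x, g, hx, hg, h⟩ |
              ⟨hR3, hS3, hT3, x, g, hx, hg, h⟩
            · obtain rfl : x = -(3 / 2 * s) + 3 / 2 := by rw [hx]; ring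
              replace hR3 := hR3.resolve_right fun hR3 => by linarith only [hR3, hA2, hs1, ht5, hu]
              rcases h.coord with ⟨⟨⟩, -⟩ | h | h
              · obtain ⟨hA4, hB4, r, hr, h⟩ := h
                obtain rfl : r = -(5 / 4 * u) + 3 / 4 * v + 45 / 32 * t - 15 / 16 * s - 3 / 32 := by
                  rw [hr, ht]; ring
                rcases h with ⟨hR4, x, hx, h⟩ | ⟨hR4, hS4, hT4, x, g, hx, hg, h⟩ |
                  ⟨hR4, hS4, hT4, x, g, hx, hg, h⟩
                · obtain rfl : x = -(5 / 4 * s) + 3 / 4 := by rw [hx]; ring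
                  rcases h.coord with ⟨⟨⟩, -⟩ | h | h
                  · obtain ⟨hA5, -⟩ := h; linarith only [hs1, hA2, ht6, hA5, hu]
                  · obtain ⟨hA5, hB5, r, hr, h⟩ := h
                    obtain rfl : r = -(1 / 4 * u) - 1 / 4 * v + 5 / 32 * t + 1 / 16 * s
                        + 5 / 32 := by
                      rw [hr, ht]; ring
                    rcases h with ⟨hR5, x, hx, h⟩ | ⟨hR5, hS5, hT5, x, g, hx, hg, h⟩ |
                      ⟨hR5, hS5, hT5, x, g, hx, hg, h⟩
                    · rcases hR5 with hR5 | hR5 <;> linarith only [hR3, hs1, ht6, hR5, hu, hv, hq]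
                    · linarith only [hR3, hv, hT5, hs, hq]
                    · obtain rfl : x = -(19 / 16 * s) + 17 / 16 := by rw [hx]; ring
                      rcases h.lt_spread 0.627 (by norm_num) with h | h | h | h | h | h <;>
                        linarith only [h, hs, hs1]
                · linarith only [hR3, ht6, hR4, hs1]
                · linarith only [hR3, ht6, hR4, hs1]
              · obtain ⟨hA4, -⟩ := h; linarith only [hs1, hA2, ht6, hA4, hu]
            · obtain rfl : x = -(17 / 16 * s) + 19 / 16 := by rw [hx]; ring
              obtain rfl : g = -(17 / 16 * u) + 19 / 16 * v + 561 / 512 * t - 323 / 256 * s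
                  + 57 / 512 := by
                rw [hg, ht]; ring
              rcases h.coord with ⟨-, h⟩ | h | h
              · obtain ⟨hA4, -⟩ := h; linarith only [hT3, hA2, ht6, hA4, hs1]
              · obtain ⟨hA4, hB4, r, hr, h⟩ := h
                obtain rfl : r = -(13 / 16 * u) + 7 / 16 * v + 377 / 512 * t - 91 / 256 * s
                    - 63 / 512 := by
                  rw [hr, ht]; ring
                rcases h with ⟨hR4, x, hx, h⟩ | ⟨hR4, hS4, hT4, x, g, hx, hg, h⟩ |
                  ⟨hR4, hS4, hT4, x, g, hx, hg, h⟩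
                · obtain rfl : x = -(13 / 16 * s) + 7 / 16 := by rw [hx]; ring
                  replace hR4 := hR4.resolve_left fun hR4 => by
                    linarith only [hA3, hu, hR4, ht6, hs1]
                  rcases h.coord with ⟨⟨⟩, -⟩ | h | h
                  · obtain ⟨hA5, -⟩ := h; linarith only [hA5, hu, hR4, ht5, hs1]
                  · obtain ⟨hA5, hB5, r, hr, h⟩ := h
                    obtain rfl : r = -(1 / 4 * u) - 1 / 4 * v + 5 / 32 * t + 1 / 16 * s
                        + 5 / 32 := by
                      rw [hr, ht]; ring
                    rcases h with ⟨hR5, x, hx, h⟩ | ⟨hR5, hS5, hT5, x, g, hx, hg, h⟩ |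
                      ⟨hR5, hS5, hT5, x, g, hx, hg, h⟩
                    · rcases hR5 with hR5 | hR5 <;> linarith only [hT3, hv, hR4, hR5, hs]
                    · linarith only [hT3, hv, hs, hT5, hu]
                    · obtain rfl : x = -(55 / 64 * s) + 53 / 64 := by rw [hx]; ring
                      rcases h.lt_spread 0.498 (by norm_num) with h | h | h | h | h | h <;>
                        linarith only [h, hs, hs1]
                · obtain rfl : x = -(51 / 64 * s) + 41 / 64 := by rw [hx]; ring
                  obtain rfl : g = -(51 / 64 * u) + 41 / 64 * v + 5865 / 8192 * t - 2091 / 4096 * s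
                      - 943 / 8192 := by
                    rw [hg, ht]; ring
                  rcases h.coord with ⟨-, h⟩ | h | h
                  · obtain ⟨hA5, -⟩ := h; linarith only [hT3, hA2, ht6, hA5, hs1]
                  · obtain ⟨hA5, hB5, r, hr, h⟩ := h
                    obtain rfl : r = -(87 / 64 * u) + 85 / 64 * v + 13137 / 8192 * t
                        - 7395 / 4096 * s + 1785 / 8192 := by
                      rw [hr, ht]; ring
                    rcases h with ⟨hR5, x, hx, h⟩ | ⟨hR5, hS5, hT5, x, g, hx, hg, h⟩ |
                      ⟨hR5, hS5, hT5, x, g, hx, hg, h⟩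
                    · rcases hR5 with hR5 | hR5 <;> linarith only [hR3, hR5, hs1, hq, hu, hA2, ht6]
                    · linarith only [hR3, hT5, ht6, hA2, hs1]
                    · obtain rfl : x = -(183 / 256 * s) + 181 / 256 := by rw [hx]; ring
                      obtain rfl : g = -(183 / 256 * u) + 181 / 256 * v + 80337 / 131072 * t
                          - 33123 / 65536 * s - 13575 / 131072 := by
                        rw [hg, ht]; ring
                      rcases h.coord with ⟨-, h⟩ | h | h
                      · obtain ⟨hA6, -⟩ := h; linarith only [hA2, hu, hA6, hs1, ht0]
                      · obtain ⟨hA6, hB6, r, hr, h⟩ := h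
                        obtain rfl : r = -(115 / 256 * u) + 41 / 256 * v + 42665 / 131072 * t
                            - 4715 / 65536 * s - 8815 / 131072 := by
                          rw [hr, ht]; ring
                        rcases h with ⟨hR6, x, hx, h⟩ | ⟨hR6, hS6, hT6, x, g, hx, hg, h⟩ |
                          ⟨hR6, hS6, hT6, x, g, hx, hg, h⟩
                        · rcases hR6 with hR6 | hR6 <;>
                            linarith only [hT3, hs1, hR6, hv, hq, ht6, hA5, hu]
                        · linarith only [hs1, hT6, ht6, hA5, hu]
                        · obtain rfl : x = -(931 / 1024 * s) + 953 / 1024 := by rw [hx]; ring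
                          rcases h.lt_spread 0.313 (by norm_num) with h | h | h | h | h | h <;>
                            linarith only [h, hs, hs1]
                      · obtain ⟨-, hB6, -⟩ := h; linarith only [ht0, hA2, hB6, hs1, hu]
                  · obtain ⟨hA5, hB5, r, hr, h⟩ := h
                    obtain rfl : r = -(15 / 64 * u) - 3 / 64 * v + 1185 / 8192 * t + 45 / 4096 * s
                        + 201 / 8192 := by
                      rw [hr, ht]; ring
                    rcases h with ⟨hR5, x, hx, h⟩ | ⟨hR5, hS5, hT5, x, g, hx, hg, h⟩ |
                      ⟨hR5, hS5, hT5, x, g, hx, hg, h⟩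
                    · rcases hR5 with hR5 | hR5 <;> linarith only [hT3, hv, hs1, hR5, hq]
                    · linarith only [hT3, hu, hT5, hs, hv]
                    · obtain rfl : x = -(219 / 256 * s) + 225 / 256 := by rw [hx]; ring
                      rcases h.lt_spread 0.395 (by norm_num) with h | h | h | h | h | h <;>
                        linarith only [h, hs, hs1]
                · linarith only [hT3, hA2, ht6, hT4, hs1]
              · obtain ⟨-, hB4, -⟩ := h; linarith only [hA2, hB4, hs1, ht0]
            · obtain rfl : x = -(3 / 16 * s) + 9 / 16 := by rw [hx]; ring
              obtain rfl : g = -(3 / 16 * u) + 9 / 16 * v + 57 / 512 * t - 27 / 256 * s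
                  - 63 / 512 := by
                rw [hg, ht]; ring
              rcases h.coord with ⟨-, h⟩ | h | h
              · obtain ⟨hA4, -⟩ := h; linarith only [hA4, hA2, hs1, ht5, hu]
              · obtain ⟨hA4, hB4, r, hr, h⟩ := h
                obtain rfl : r = 1 / 16 * u - 3 / 16 * v - 15 / 512 * t - 3 / 256 * s
                    + 57 / 512 := by
                  rw [hr, ht]; ring
                rcases h with ⟨hR4, x, hx, h⟩ | ⟨hR4, hS4, hT4, x, g, hx, hg, h⟩ |
                  ⟨hR4, hS4, hT4, x, g, hx, hg, h⟩
                · rcases hR4 with hR4 | hR4 <;> linarith only [hR4, hv, hB2, hs1, hq]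
                · linarith only [hv, hs1, hB2, hT4, hq]
                · obtain rfl : x = -(35 / 64 * s) + 57 / 64 := by rw [hx]; ring
                  rcases h.lt_spread 0.498 (by norm_num) with h | h | h | h | h | h <;>
                    linarith only [h, hs, hs1]
              · obtain ⟨-, hB4, -⟩ := h; linarith only [hA2, hB4, ht6, hs1]
          · obtain ⟨hA3, hB3, r, hr, h⟩ := h
            obtain rfl : r = 1 / 2 * u - 1 / 2 * v - 1 / 8 * t - 1 / 4 * s + 3 / 8 := by
              rw [hr, ht]; ring
            rcases h with ⟨hR3, x, hx, h⟩ | ⟨hR3, hS3, hT3, x, g, hx, hg, h⟩ |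
              ⟨hR3, hS3, hT3, x, g, hx, hg, h⟩
            · rcases hR3 with hR3 | hR3 <;> linarith only [hR3, hs1, hB2, ht5, hu]
            · linarith only [hT3, hs1, hB2, ht5, hu]
            · obtain rfl : x = -(7 / 16 * s) + 13 / 16 := by rw [hx]; ring
              rcases h.lt_spread 0.627 (by norm_num) with h | h | h | h | h | h <;>
                linarith only [h, hs, hs1]
        · linarith only [hR2, hB2, ht5, hs1]
        · linarith only [hR2, hB2, ht5, hs1]
      · obtain ⟨hA2, hB2, r, hr, h⟩ := h
        obtain rfl : r = -u + 2 * v + t - 2 * s + 1 := by rw [hr, ht]; ring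
        rcases h with ⟨hR2, x, hx, h⟩ | ⟨hR2, hS2, hT2, x, g, hx, hg, h⟩ |
          ⟨hR2, hS2, hT2, x, g, hx, hg, h⟩
        · rcases hR2 with hR2 | hR2 <;> linarith only [hs1, hR2, hu, hq, ht0, ht4]
        · linarith only [hs1, hT2, hu, hq, ht0]
        · obtain rfl : x = -(1 / 16 * s) + 11 / 16 := by rw [hx]; ring
          rcases h.lt_spread 0.627 (by norm_num) with h | h | h | h | h | h <;>
            linarith only [ht4, hu, hA2, hq, h, hs1]
    · obtain rfl : x = -(5 / 16 * s) + 15 / 16 := by rw [hx]; ring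
      obtain rfl : g = -(5 / 16 * u) + 15 / 16 * v + 105 / 512 * t - 75 / 256 * s - 15 / 512 := by
        rw [hg, ht]; ring
      rcases h.coord with ⟨-, h⟩ | h | h
      · obtain ⟨hA2, -⟩ := h; linarith only [hA2, hu, hT1, hq, ht1]
      · obtain ⟨hA2, hB2, r, hr, h⟩ := h
        obtain rfl : r = -(1 / 16 * u) + 3 / 16 * v + 17 / 512 * t - 3 / 256 * s - 39 / 512 := by
          rw [hr, ht]; ring
        rcases h with ⟨hR2, x, hx, h⟩ | ⟨hR2, hS2, hT2, x, g, hx, hg, h⟩ |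
          ⟨hR2, hS2, hT2, x, g, hx, hg, h⟩
        · rcases hR2 with hR2 | hR2 <;> linarith only [ht2, hu, hT1, hR2, hs1, hv]
        · obtain rfl : x = -(3 / 64 * s) + 25 / 64 := by rw [hx]; ring
          obtain rfl : g = -(3 / 64 * u) + 25 / 64 * v + 201 / 8192 * t - 75 / 4096 * s
              - 975 / 8192 := by
            rw [hg, ht]; ring
          rcases h.coord with ⟨-, h⟩ | h | h
          · obtain ⟨hA3, -⟩ := h; linarith only [hs1, hA3, hT1, hq, hu]
          · obtain ⟨hA3, hB3, r, hr, h⟩ := h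
            obtain rfl : r = -(39 / 64 * u) + 69 / 64 * v + 4017 / 8192 * t - 2691 / 4096 * s
                + 345 / 8192 := by
              rw [hr, ht]; ring
            rcases h with ⟨hR3, x, hx, h⟩ | ⟨hR3, hS3, hT3, x, g, hx, hg, h⟩ |
              ⟨hR3, hS3, hT3, x, g, hx, hg, h⟩
            · rcases hR3 with hR3 | hR3 <;> linarith only [hq, hR3, hu, ht4, hR1, ht5, hT2]
            · obtain rfl : x = -(101 / 256 * s) + 223 / 256 := by rw [hx]; ring
              obtain rfl : g = -(101 / 256 * u) + 223 / 256 * v + 36057 / 131072 * t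
                  - 22523 / 65536 * s - 7359 / 131072 := by
                rw [hg, ht]; ring
              rcases h.coord with ⟨-, h⟩ | h | h
              · obtain ⟨hA4, -⟩ := h; linarith only [hA4, hT3, hs1, hT2, hu]
              · obtain ⟨hA4, hB4, r, hr, h⟩ := h
                obtain rfl : r = -(33 / 256 * u) + 83 / 256 * v + 9537 / 131072 * t
                    - 2739 / 65536 * s - 14359 / 131072 := by
                  rw [hr, ht]; ring
                rcases h with ⟨hR4, x, hx, h⟩ | ⟨hR4, hS4, hT4, x, g, hx, hg, h⟩ |
                  ⟨hR4, hS4, hT4, x, g, hx, hg, h⟩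
                · rcases hR4 with hR4 | hR4 <;> linarith only [ht0, hT3, hR4, hu, hs1]
                · obtain rfl : x = -(179 / 1024 * s) + 489 / 1024 := by rw [hx]; ring
                  obtain rfl : g = -(179 / 1024 * u) + 489 / 1024 * v + 215337 / 2097152 * t
                      - 87531 / 1048576 * s - 261615 / 2097152 := by
                    rw [hg, ht]; ring
                  rcases h.coord with ⟨-, h⟩ | h | h
                  · obtain ⟨hA5, -⟩ := h; linarith only [hq, hT3, hT4, hA5, hs1]
                  · obtain ⟨hA5, hB5, r, hr, h⟩ := h
                    obtain rfl : r = -(535 / 1024 * u) + 981 / 1024 * v + 834065 / 2097152 * t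
                        - 524835 / 1048576 * s - 42183 / 2097152 := by
                      rw [hr, ht]; ring
                    rcases h with ⟨hR5, x, hx, h⟩ | ⟨hR5, hS5, hT5, x, g, hx, hg, h⟩ |
                      ⟨hR5, hS5, hT5, x, g, hx, hg, h⟩
                    · rcases hR5 with hR5 | hR5 <;> linarith only [hu, ht2, hT4, hR5, hs1, ht3]
                    · obtain rfl : x = -(1653 / 4096 * s) + 3343 / 4096 := by rw [hx]; ring
                      obtain rfl : g = -(1653 / 4096 * u) + 3343 / 4096 * v
                          + 9503097 / 33554432 * t - 5525979 / 16777216 * s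
                          - 2517279 / 33554432 := by
                        rw [hg, ht]; ring
                      rcases h.coord with ⟨-, h⟩ | h | h
                      · obtain ⟨hA6, -⟩ := h; linarith only [hA6, ht5, hT4, hT5, hs1]
                      · obtain ⟨hA6, hB6, r, hr, h⟩ := h
                        obtain rfl : r = -(753 / 4096 * u) + 1731 / 4096 * v
                            + 3651297 / 33554432 * t - 1303443 / 16777216 * s
                            - 4093815 / 33554432 := by
                          rw [hr, ht]; ring
                        rcases h with ⟨hR6, x, hx, h⟩ | ⟨hR6, hS6, hT6, x, g, hx, hg, h⟩ |
                          ⟨hR6, hS6, hT6, x, g, hx, hg, h⟩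
                        · rcases hR6 with hR6 | hR6 <;>
                            linarith only [hs, hR6, hu, hv, ht0, hT5, hs1]
                        · obtain rfl : x = -(3875 / 16384 * s) + 8761 / 16384 := by rw [hx]; ring
                          obtain rfl : g = -(3875 / 16384 * u) + 8761 / 16384 * v
                              + 78503625 / 536870912 * t - 33948875 / 268435456 * s
                              - 66785103 / 536870912 := by
                            rw [hg, ht]; ring
                          rcases h.coord with ⟨-, h⟩ | h | h
                          · obtain ⟨hA7, -⟩ := h; linarith only [ht4, hT6, hA7, hT5, hs1]
                          · obtain ⟨hA7, hB7, r, hr, h⟩ := h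
                            obtain rfl : r = -(7623 / 16384 * u) + 14309 / 16384 * v
                                + 183005361 / 536870912 * t - 109077507 / 268435456 * s
                                - 29691175 / 536870912 := by
                              rw [hr, ht]; ring
                            rcases h with ⟨hR7, x, hx, h⟩ | ⟨hR7, hS7, hT7, x, g, hx, hg, h⟩ |
                              ⟨hR7, hS7, hT7, x, g, hx, hg, h⟩
                            · rcases hR7 with hR7 | hR7 <;> linarith only [ht4, hT6, hR7, hs1, hu]
                            · obtain rfl : x = -(25733 / 65536 * s) + 50751 / 65536 := by
                                rw [hx]; ring
                              obtain rfl : g = -(25733 / 65536 * u) + 50751 / 65536 * v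
                                  + 2348625177 / 8589934592 * t - 1305975483 / 4294967296 * s
                                  - 750353535 / 8589934592 := by
                                rw [hg, ht]; ring
                              rcases h.coord with ⟨-, h⟩ | h | h
                              · obtain ⟨hA8, -⟩ := h; linarith only [hA8, hT6, hT7, ht5, hs1]
                              · obtain ⟨hA8, hB8, r, hr, h⟩ := h
                                obtain rfl : r = -(14785 / 65536 * u) + 32307 / 65536 * v
                                    + 1187545985 / 8589934592 * t - 477658995 / 4294967296 * s
                                    - 1073529303 / 8589934592 := by
                                  rw [hr, ht]; ring
                                rcases h with ⟨hR8, x, hx, h⟩ | ⟨hR8, hS8, hT8, x, g, hx, hg, h⟩ |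
                                  ⟨hR8, hS8, hT8, x, g, hx, hg, h⟩
                                · rcases hR8 with hR8 | hR8 <;> linarith only [hR8, hs, hT7, hv, hq]
                                · linarith only [ht5, hu, hT7, hT8, hR1]
                                · obtain rfl : x = -(94129 / 262144 * s) + 192771 / 262144 := by
                                    rw [hx]; ring
                                  obtain rfl : g = -(94129 / 262144 * u) + 192771 / 262144 * v
                                      + 33535621217 / 137438953472 * t
                                      - 18145341459 / 68719476736 * s
                                      - 13373102583 / 137438953472 := by
                                    rw [hg, ht]; ring
                                  rcases h.coord with ⟨-, h⟩ | h | h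
                                  · obtain ⟨hA9, -⟩ := h; linarith only [hA9, hs1, hT7, ht5, hu]
                                  · obtain ⟨hA9, hB9, r, hr, h⟩ := h
                                    obtain rfl : r = -(135061 / 262144 * u) + 255599 / 262144 * v
                                        + 53646904505 / 137438953472 * t
                                        - 34521456539 / 68719476736 * s
                                        - 1672895455 / 137438953472 := by
                                      rw [hr, ht]; ring
                                    rcases h with ⟨hR9, x, hx, h⟩ |
                                      ⟨hR9, hS9, hT9, x, g, hx, hg, h⟩ |
                                      ⟨hR9, hS9, hT9, x, g, hx, hg, h⟩
                                    · rcases hR9 with hR9 | hR9 <;>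
                                        linarith only [hR9, hT6, hs1, ht5, hu]
                                    · linarith only [hT9, hT6, hs1, ht5, hu]
                                    · obtain rfl : x =
                                          -(321061 / 1048576 * s) + 676127 / 1048576 := by
                                        rw [hx]; ring
                                      obtain rfl : g = -(321061 / 1048576 * u)
                                          + 676127 / 1048576 * v + 439737024857 / 2199023255552 * t
                                          - 217078010747 / 1099511627776 * s
                                          - 251822825023 / 2199023255552 := by
                                        rw [hg, ht]; ring
                                      rcases h.coord with ⟨-, h⟩ | h | h
                                      · obtain ⟨hA10, -⟩ := h
                                        linarith only [hA10, hT6, hs1, ht5, hu]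
                                      · obtain ⟨hA10, hB10, r, hr, h⟩ := h
                                        obtain rfl : r = -(285849 / 1048576 * u)
                                            + 635195 / 1048576 * v
                                            + 381444051825 / 2199023255552 * t
                                            - 181569855555 / 1099511627776 * s
                                            - 262577544295 / 2199023255552 := by
                                          rw [hr, ht]; ring
                                        rcases h with ⟨hR10, x, hx, h⟩ |
                                          ⟨hR10, hS10, hT10, x, g, hx, hg, h⟩ |
                                          ⟨hR10, hS10, hT10, x, g, hx, hg, h⟩
                                        · obtain rfl : x =
                                              -(285849 / 1048576 * s) + 635195 / 1048576 := by
                                            rw [hx]; ring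
                                          replace hR10 := hR10.resolve_right fun hR10 => by
                                            linarith only [hR10, hT6, hT7, ht5, hs1]
                                          rcases h.coord with ⟨⟨⟩, -⟩ | h | h
                                          · obtain ⟨hA11, hB11, r, hr, h⟩ := h
                                            obtain rfl : r = -(115197 / 524288 * u)
                                                + 270119 / 524288 * v
                                                + 73666753545 / 549755813888 * t
                                                - 31116898443 / 274877906944 * s
                                                - 68655876111 / 549755813888 := by
                                              rw [hr, ht]; ring
                                            rcases h with ⟨hR11, x, hx, h⟩ |
                                              ⟨hR11, hS11, hT11, x, g, hx, hg, h⟩ |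
                                              ⟨hR11, hS11, hT11, x, g, hx, hg, h⟩
                                            · rcases hR11 with hR11 | hR11 <;>
                                                linarith only [hR11, hs1, hT7, ht5, hu]
                                            · linarith only [hT11, hs1, hT7, ht5, hu]
                                            · obtain rfl : x =
                                                  -(679971 / 2097152 * s) + 1426745 / 2097152 := by
                                                rw [hx]; ring
                                              rcases h.lt_spread 0.0784 (by norm_num) with
                                                  h | h | h | h | h | h <;>
                                                linarith only [h, hs, hs1]
                                          · obtain ⟨hA11, -⟩ := h
                                            linarith only [hA11, hT6, hT7, ht5, hs1]
                                        · obtain rfl : x =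
                                              -(1269275 / 4194304 * s) + 2717601 / 4194304 := by
                                            rw [hx]; ring
                                          obtain rfl : g = -(1269275 / 4194304 * u)
                                              + 2717601 / 4194304 * v
                                              + 6934784235225 / 35184372088832 * t
                                              - 3449383009275 / 17592186044416 * s
                                              - 4013089549503 / 35184372088832 := by
                                            rw [hg, ht]; ring
                                          rcases h.coord with ⟨-, h⟩ | h | h
                                          · obtain ⟨hA11, -⟩ := h
                                            linarith only [hA11, hT6, hR1, ht5, hs]
                                          · obtain ⟨hA11, hB11, r, hr, h⟩ := h
                                            obtain rfl : r = -(1047455 / 4194304 * u)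
                                                + 2337773 / 4194304 * v
                                                + 5490506673345 / 35184372088832 * t
                                                - 2448712017715 / 17592186044416 * s
                                                - 4340148045463 / 35184372088832 := by
                                              rw [hr, ht]; ring
                                            rcases h with ⟨hR11, x, hx, h⟩ |
                                              ⟨hR11, hS11, hT11, x, g, hx, hg, h⟩ |
                                              ⟨hR11, hS11, hT11, x, g, hx, hg, h⟩
                                            · rcases hR11 with hR11 | hR11 <;>
                                                linarith only [hR10, hT6, hR1, ht5, hR11]
                                            · linarith only [hR10, hT11, hR1, ht5, hs]
                                            · obtain rfl : x =
                                                  -(5565647 / 16777216 * s)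
                                                  + 11590781 / 16777216 := by
                                                rw [hx]; ring
                                              rcases h.lt_spread 0.0622 (by norm_num) with
                                                  h | h | h | h | h | h <;>
                                                linarith only [h, hs, hs1]
                                          · obtain ⟨hA11, -⟩ := h
                                            linarith only [hR10, hT6, hR1, ht5, hA11]
                                        · linarith only [hT10, hT6, hR1, ht5, hu]
                                      · obtain ⟨-, hB10, -⟩ := h
                                        linarith only [hB10, hT2, hR1, ht5, hu]
                                  · obtain ⟨-, hB9, -⟩ := h; linarith only [hB9, hs, hT7, hv, hq]
                              · obtain ⟨-, hB8, -⟩ := h; linarith only [hB8, hT6, hs1, ht5, hu]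
                            · obtain rfl : x = -(16215 / 65536 * s) + 37781 / 65536 := by
                                rw [hx]; ring
                              obtain rfl : g = -(16215 / 65536 * u) + 37781 / 65536 * v
                                  + 1325592465 / 8589934592 * t - 612618915 / 4294967296 * s
                                  - 1048611655 / 8589934592 := by
                                rw [hg, ht]; ring
                              rcases h.coord with ⟨-, h⟩ | h | h
                              · obtain ⟨hA8, -⟩ := h; linarith only [ht4, hT6, hA8, hs1, hu]
                              · obtain ⟨hA8, hB8, r, hr, h⟩ := h
                                obtain rfl : r = -(5267 / 65536 * u) + 19337 / 65536 * v
                                    + 372919401 / 8589934592 * t - 101847979 / 4294967296 * s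
                                    - 893350063 / 8589934592 := by
                                  rw [hr, ht]; ring
                                rcases h with ⟨hR8, x, hx, h⟩ | ⟨hR8, hS8, hT8, x, g, hx, hg, h⟩ |
                                  ⟨hR8, hS8, hT8, x, g, hx, hg, h⟩
                                · rcases hR8 with hR8 | hR8 <;>
                                    linarith only [ht4, hs1, hR8, hT5, hu]
                                · linarith only [ht4, hs1, hT8, hT5, hu]
                                · obtain rfl : x = -(84611 / 262144 * s) + 179801 / 262144 := by
                                    rw [hx]; ring
                                  obtain rfl : g = -(84611 / 262144 * u) + 179801 / 262144 * v
                                      + 29339287305 / 137438953472 * t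
                                      - 15213142411 / 68719476736 * s
                                      - 14805353743 / 137438953472 := by
                                    rw [hg, ht]; ring
                                  rcases h.coord with ⟨-, h⟩ | h | h
                                  · obtain ⟨hA9, -⟩ := h; linarith only [ht4, hs1, hA9, hT5, hu]
                                  · obtain ⟨hA9, hB9, r, hr, h⟩ := h
                                    obtain rfl : r = -(87471 / 262144 * u) + 190749 / 262144 * v
                                        + 30581173665 / 137438953472 * t
                                        - 16685005779 / 68719476736 * s
                                        - 13618524855 / 137438953472 := by
                                      rw [hr, ht]; ring
                                    rcases h with ⟨hR9, x, hx, h⟩ |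
                                      ⟨hR9, hS9, hT9, x, g, hx, hg, h⟩ |
                                      ⟨hR9, hS9, hT9, x, g, hx, hg, h⟩
                                    · obtain rfl : x = -(87471 / 262144 * s) + 190749 / 262144 := by
                                        rw [hx]; ring
                                      replace hR9 := hR9.resolve_right fun hR9 => by
                                        linarith only [ht4, hT6, hR9, hT5, hs1]
                                      rcases h.coord with ⟨⟨⟩, -⟩ | h | h
                                      · obtain ⟨hA10, hB10, r, hr, h⟩ := h
                                        obtain rfl : r = -(53611 / 131072 * u)
                                            + 109713 / 131072 * v + 9901040313 / 34359738368 * t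
                                            - 5881823643 / 17179869184 * s
                                            - 2343359967 / 34359738368 := by
                                          rw [hr, ht]; ring
                                        rcases h with ⟨hR10, x, hx, h⟩ |
                                          ⟨hR10, hS10, hT10, x, g, hx, hg, h⟩ |
                                          ⟨hR10, hS10, hT10, x, g, hx, hg, h⟩
                                        · rcases hR10 with hR10 | hR10 <;>
                                            linarith only [ht4, hT6, hR10, hs1, hu]
                                        · linarith only [ht4, hT6, hT10, hs1, hu]
                                        · obtain rfl : x =
                                              -(150901 / 524288 * s) + 336399 / 524288 := by
                                            rw [hx]; ring
                                          rcases h.lt_spread 0.0988 (by norm_num) with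
                                              h | h | h | h | h | h <;>
                                            linarith only [h, hs1, hs]
                                      · obtain ⟨hA10, -⟩ := h
                                        linarith only [ht4, hT6, hA10, hT5, hs1]
                                    · obtain rfl : x =
                                          -(324413 / 1048576 * s) + 712423 / 1048576 := by
                                        rw [hx]; ring
                                      obtain rfl : g = -(324413 / 1048576 * u)
                                          + 712423 / 1048576 * v + 445415480457 / 2199023255552 * t
                                          - 231119282699 / 1099511627776 * s
                                          - 239483128719 / 2199023255552 := by
                                        rw [hg, ht]; ring
                                      rcases h.coord with ⟨-, h⟩ | h | h
                                      · obtain ⟨hA10, -⟩ := h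
                                        linarith only [ht0, hA10, hu, hT5, hs1]
                                      · obtain ⟨hA10, hB10, r, hr, h⟩ := h
                                        obtain rfl : r = -(403417 / 1048576 * u)
                                            + 827131 / 1048576 * v
                                            + 585758660081 / 2199023255552 * t
                                            - 333678706627 / 1099511627776 * s
                                            - 183164024295 / 2199023255552 := by
                                          rw [hr, ht]; ring
                                        rcases h with ⟨hR10, x, hx, h⟩ |
                                          ⟨hR10, hS10, hT10, x, g, hx, hg, h⟩ |
                                          ⟨hR10, hS10, hT10, x, g, hx, hg, h⟩
                                        · rcases hR10 with hR10 | hR10 <;>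
                                            linarith only [hs1, hR10, hR9, hq, hv]
                                        · linarith only [hs1, hT10, hR9, hq, hv]
                                        · obtain rfl : x =
                                              -(1181737 / 4194304 * s) + 2640619 / 4194304 := by
                                            rw [hx]; ring
                                          rcases h.lt_spread 0.0784 (by norm_num) with
                                              h | h | h | h | h | h <;>
                                            linarith only [h, hs, hs1]
                                      · obtain ⟨hA10, -⟩ := h
                                        linarith only [ht1, hu, hR9, hT5, hA10]
                                    · linarith only [ht4, hT9, hT5, hs1, hu]
                                  · obtain ⟨-, hB9, -⟩ := h; linarith only [ht4, hu, hB9, hv, hT1]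
                              · obtain ⟨-, hB8, -⟩ := h; linarith only [ht4, hT6, hB8, hs1, hu]
                          · obtain ⟨-, hB7, -⟩ := h; linarith only [hv, hu, hB7, hT5, ht0]
                        · obtain rfl : x = -(5601 / 16384 * s) + 12435 / 16384 := by rw [hx]; ring
                          obtain rfl : g = -(5601 / 16384 * u) + 12435 / 16384 * v
                              + 123137985 / 536870912 * t - 69648435 / 268435456 * s
                              - 49105815 / 536870912 := by
                            rw [hg, ht]; ring
                          rcases h.coord with ⟨-, h⟩ | h | h
                          · obtain ⟨hA7, -⟩ := h; linarith only [hA7, ht5, hs1, hT5, hu]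
                          · obtain ⟨hA7, hB7, r, hr, h⟩ := h
                            obtain rfl : r = -(9349 / 16384 * u) + 17983 / 16384 * v
                                + 240577817 / 536870912 * t - 168123067 / 268435456 * s
                                + 28754817 / 536870912 := by
                              rw [hr, ht]; ring
                            rcases h with ⟨hR7, x, hx, h⟩ | ⟨hR7, hS7, hT7, x, g, hx, hg, h⟩ |
                              ⟨hR7, hS7, hT7, x, g, hx, hg, h⟩
                            · rcases hR7 with hR7 | hR7 <;> linarith only [hR7, ht5, hT4, hs1, hu]
                            · linarith only [hT7, ht5, hT4, hs1, hu]
                            · obtain rfl : x = -(17941 / 65536 * s) + 41455 / 65536 := by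
                                rw [hx]; ring
                              obtain rfl : g = -(17941 / 65536 * u) + 41455 / 65536 * v
                                  + 1497660857 / 8589934592 * t - 743744155 / 4294967296 * s
                                  - 998277855 / 8589934592 := by
                                rw [hg, ht]; ring
                              rcases h.coord with ⟨-, h⟩ | h | h
                              · obtain ⟨hA8, -⟩ := h; linarith only [hA8, ht5, hT4, hs1, hu]
                              · obtain ⟨hA8, hB8, r, hr, h⟩ := h
                                obtain rfl : r = -(13897 / 65536 * u) + 37707 / 65536 * v
                                    + 1103880401 / 8589934592 * t - 524014179 / 4294967296 * s
                                    - 1049348103 / 8589934592 := by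
                                  rw [hr, ht]; ring
                                rcases h with ⟨hR8, x, hx, h⟩ | ⟨hR8, hS8, hT8, x, g, hx, hg, h⟩ |
                                  ⟨hR8, hS8, hT8, x, g, hx, hg, h⟩
                                · obtain rfl : x = -(13897 / 65536 * s) + 37707 / 65536 := by
                                    rw [hx]; ring
                                  replace hR8 := hR8.resolve_right fun hR8 => by
                                    linarith only [hR8, ht5, hT4, hT5, hs1]
                                  rcases h.coord with ⟨⟨⟩, -⟩ | h | h
                                  · obtain ⟨hA9, hB9, r, hr, h⟩ := h
                                    obtain rfl : r = -(4717 / 32768 * u) + 14711 / 32768 * v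
                                        + 176816745 / 2147483648 * t - 69391787 / 1073741824 * s
                                        - 265636527 / 2147483648 := by
                                      rw [hr, ht]; ring
                                    rcases h with ⟨hR9, x, hx, h⟩ |
                                      ⟨hR9, hS9, hT9, x, g, hx, hg, h⟩ |
                                      ⟨hR9, hS9, hT9, x, g, hx, hg, h⟩
                                    · rcases hR9 with hR9 | hR9 <;>
                                        linarith only [hR9, ht5, hs1, hT5, hu]
                                    · linarith only [hT9, ht5, hs1, hT5, hu]
                                    · obtain rfl : x = -(38323 / 131072 * s) + 89321 / 131072 := by
                                        rw [hx]; ring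
                                      rcases h.lt_spread 0.1245 (by norm_num) with
                                          h | h | h | h | h | h <;>
                                        linarith only [h, hs, hs1]
                                  · obtain ⟨hA9, -⟩ := h; linarith only [hA9, ht5, hT4, hT5, hs1]
                                · obtain rfl : x = -(68139 / 262144 * s) + 166609 / 262144 := by
                                    rw [hx]; ring
                                  rcases h.lt_spread 0.1245 (by norm_num) with
                                      h | h | h | h | h | h <;>
                                    linarith only [hR8, h, hq, hu, ht0, hs1, hs]
                                · linarith only [hu, ht5, hT4, hT8, hR1]
                              · obtain ⟨-, hB8, -⟩ := h; linarith only [hB8, hS1, ht6, hR1, hs1]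
                          · obtain ⟨-, hB7, -⟩ := h; linarith only [ht0, hB7, hu, hT5, hs1]
                      · obtain ⟨-, hB6, -⟩ := h; linarith only [hB6, ht5, hT4, hs1, hu]
                    · obtain rfl : x = -(679 / 4096 * s) + 2181 / 4096 := by rw [hx]; ring
                      obtain rfl : g = -(679 / 4096 * u) + 2181 / 4096 * v + 3242225 / 33554432 * t
                          - 1480899 / 16777216 * s - 4176615 / 33554432 := by
                        rw [hg, ht]; ring
                      rcases h.coord with ⟨-, h⟩ | h | h
                      · obtain ⟨hA6, -⟩ := h; linarith only [hu, ht2, hT4, hA6, hs1]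
                      · obtain ⟨hA6, hB6, r, hr, h⟩ := h
                        obtain rfl : r = 221 / 4096 * u + 569 / 4096 * v - 856375 / 33554432 * t
                            + 125749 / 16777216 * s - 2006863 / 33554432 := by
                          rw [hr, ht]; ring
                        rcases h with ⟨hR6, x, hx, h⟩ | ⟨hR6, hS6, hT6, x, g, hx, hg, h⟩ |
                          ⟨hR6, hS6, hT6, x, g, hx, hg, h⟩
                        · rcases hR6 with hR6 | hR6 <;> linarith only [hq, hT3, hs1, hR6, hv]
                        · linarith only [hq, hT3, hs1, hT6, hv]
                        · obtain rfl : x = -(4627 / 16384 * s) + 11273 / 16384 := by rw [hx]; ring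
                          obtain rfl : g = -(4627 / 16384 * u) + 11273 / 16384 * v
                              + 97217897 / 536870912 * t - 52160171 / 268435456 * s
                              - 57616303 / 536870912 := by
                            rw [hg, ht]; ring
                          rcases h.coord with ⟨-, h⟩ | h | h
                          · obtain ⟨hA7, -⟩ := h; linarith only [hA7, ht1, hT1, hA1, hu]
                          · obtain ⟨hA7, hB7, r, hr, h⟩ := h
                            obtain rfl : r = -(4479 / 16384 * u) + 12173 / 16384 * v
                                + 93445377 / 536870912 * t - 54522867 / 268435456 * s
                                - 51260503 / 536870912 := by
                              rw [hr, ht]; ring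
                            rcases h with ⟨hR7, x, hx, h⟩ | ⟨hR7, hS7, hT7, x, g, hx, hg, h⟩ |
                              ⟨hR7, hS7, hT7, x, g, hx, hg, h⟩
                            · obtain rfl : x = -(4479 / 16384 * s) + 12173 / 16384 := by
                                rw [hx]; ring
                              replace hR7 := hR7.resolve_right fun hR7 => by
                                linarith only [hR7, hT3, hT4, hu, hs1]
                              rcases h.coord with ⟨⟨⟩, -⟩ | h | h
                              · obtain ⟨hA8, hB8, r, hr, h⟩ := h
                                obtain rfl : r = -(3195 / 8192 * u) + 7361 / 8192 * v
                                    + 36381465 / 134217728 * t - 23518395 / 67108864 * s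
                                    - 6116991 / 134217728 := by
                                  rw [hr, ht]; ring
                                rcases h with ⟨hR8, x, hx, h⟩ | ⟨hR8, hS8, hT8, x, g, hx, hg, h⟩ |
                                  ⟨hR8, hS8, hT8, x, g, hx, hg, h⟩
                                · rcases hR8 with hR8 | hR8 <;>
                                    linarith only [hq, hs1, hT4, hR8, hv, ht0, hu]
                                · linarith only [hu, ht0, hT4, hT8, hs1]
                                · obtain rfl : x = -(7269 / 32768 * s) + 20447 / 32768 := by
                                    rw [hx]; ring
                                  rcases h.lt_spread 0.1569 (by norm_num) with
                                      h | h | h | h | h | h <;>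
                                    linarith only [h, hs, hs1]
                              · obtain ⟨hA8, -⟩ := h; linarith only [hA8, hT3, hT4, hu, hs1]
                            · obtain rfl : x = -(16301 / 65536 * s) + 44343 / 65536 := by
                                rw [hx]; ring
                              rcases h.lt_spread 0.1569 (by norm_num) with h | h | h | h | h | h <;>
                                linarith only [h, hs1, hs]
                            · obtain rfl : x = -(13071 / 65536 * s) + 35645 / 65536 := by
                                rw [hx]; ring
                              rcases h.lt_spread 0.1569 (by norm_num) with h | h | h | h | h | h <;>
                                linarith only [h, hs1, ht4, hu, hT3, hT7]
                          · obtain ⟨-, hB7, -⟩ := h; linarith only [ht2, hT1, hA1, hB7, hu]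
                      · obtain ⟨-, hB6, -⟩ := h; linarith only [hu, ht5, hT4, hB6, hs1]
                  · obtain ⟨-, hB5, -⟩ := h; linarith only [hB5, hT3, hs1, hu, ht4]
                · obtain rfl : x = -(273 / 1024 * s) + 803 / 1024 := by rw [hx]; ring
                  obtain rfl : g = -(273 / 1024 * u) + 803 / 1024 * v + 354081 / 2097152 * t
                      - 219219 / 1048576 * s - 177463 / 2097152 := by
                    rw [hg, ht]; ring
                  rcases h.coord with ⟨-, h⟩ | h | h
                  · obtain ⟨hA5, -⟩ := h; linarith only [ht6, hT3, hA5, hu, hs1]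
                  · obtain ⟨hA5, hB5, r, hr, h⟩ := h
                    obtain rfl : r = -(629 / 1024 * u) + 1295 / 1024 * v + 1039737 / 2097152 * t
                        - 814555 / 1048576 * s + 350945 / 2097152 := by
                      rw [hr, ht]; ring
                    rcases h with ⟨hR5, x, hx, h⟩ | ⟨hR5, hS5, hT5, x, g, hx, hg, h⟩ |
                      ⟨hR5, hS5, hT5, x, g, hx, hg, h⟩
                    · rcases hR5 with hR5 | hR5 <;> linarith only [hR5, hs1, ht0, hT2, hu]
                    · linarith only [hT5, hs1, ht0, hT2, hu]
                    · obtain rfl : x = -(773 / 4096 * s) + 2495 / 4096 := by rw [hx]; ring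
                      rcases h.lt_spread 0.249 (by norm_num) with h | h | h | h | h | h <;>
                        linarith only [h, hs, hs1, ht6, hT3, hT2, hu]
                  · obtain ⟨-, hB5, -⟩ := h; linarith only [ht4, hT3, hB5, hu, hs1]
              · obtain ⟨hA4, hB4, r, hr, h⟩ := h
                obtain rfl : r = -(169 / 256 * u) + 363 / 256 * v + 71825 / 131072 * t
                    - 61347 / 65536 * s + 38841 / 131072 := by
                  rw [hr, ht]; ring
                rcases h with ⟨hR4, x, hx, h⟩ | ⟨hR4, hS4, hT4, x, g, hx, hg, h⟩ |
                  ⟨hR4, hS4, hT4, x, g, hx, hg, h⟩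
                · rcases hR4 with hR4 | hR4 <;> linarith only [ht0, hR4, hs1, hq, hu]
                · linarith only [ht0, hT4, hs1, hq, hu]
                · obtain rfl : x = -(205 / 1024 * s) + 663 / 1024 := by rw [hx]; ring
                  rcases h.lt_spread 0.313 (by norm_num) with h | h | h | h | h | h <;>
                    linarith only [h, hs, hs1]
            · obtain rfl : x = 9 / 256 * s + 117 / 256 := by rw [hx]; ring
              obtain rfl : g = 9 / 256 * u + 117 / 256 * v - 2223 / 131072 * t + 1053 / 65536 * s
                  - 16263 / 131072 := by
                rw [hg, ht]; ring
              rcases h.coord with ⟨-, h⟩ | h | h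
              · obtain ⟨hA4, -⟩ := h; linarith only [hT2, hA4, hu, ht5, hR1]
              · obtain ⟨hA4, hB4, r, hr, h⟩ := h
                obtain rfl : r = 77 / 256 * u - 23 / 256 * v - 13783 / 131072 * t
                    - 1771 / 65536 * s + 6417 / 131072 := by
                  rw [hr, ht]; ring
                rcases h with ⟨hR4, x, hx, h⟩ | ⟨hR4, hS4, hT4, x, g, hx, hg, h⟩ |
                  ⟨hR4, hS4, hT4, x, g, hx, hg, h⟩
                · rcases hR4 with hR4 | hR4 <;> linarith only [ht2, hR4, hT1, hs1, hu]
                · linarith only [ht2, hu, hT1, hT4, hs1]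
                · obtain rfl : x = -(163 / 1024 * s) + 697 / 1024 := by rw [hx]; ring
                  rcases h.lt_spread 0.313 (by norm_num) with h | h | h | h | h | h <;>
                    linarith only [ht2, hu, hT1, hq, h, hs1]
              · obtain ⟨-, hB4, -⟩ := h; linarith only [hT3, hB4, hs1, hT2, hu]
          · obtain ⟨hA3, hB3, r, hr, h⟩ := h
            obtain rfl : r = 33 / 64 * u - 19 / 64 * v - 1023 / 8192 * t - 627 / 4096 * s
                + 1577 / 8192 := by
              rw [hr, ht]; ring
            rcases h with ⟨hR3, x, hx, h⟩ | ⟨hR3, hS3, hT3, x, g, hx, hg, h⟩ |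
              ⟨hR3, hS3, hT3, x, g, hx, hg, h⟩
            · rcases hR3 with hR3 | hR3 <;> linarith only [ht4, hR3, hT1, hs1, hu, hq, hv, ht1]
            · linarith only [hs1, hT3, hv, hq, ht1]
            · obtain rfl : x = -(27 / 256 * s) + 161 / 256 := by rw [hx]; ring
              rcases h.lt_spread 0.395 (by norm_num) with h | h | h | h | h | h <;>
                linarith only [ht4, hu, hT1, hB3, h, hs1]
        · obtain rfl : x = -(1 / 64 * s) + 51 / 64 := by rw [hx]; ring
          obtain rfl : g = -(1 / 64 * u) + 51 / 64 * v + 65 / 8192 * t - 51 / 4096 * s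
              - 663 / 8192 := by
            rw [hg, ht]; ring
          rcases h.coord with ⟨-, h⟩ | h | h
          · obtain ⟨hA3, -⟩ := h; linarith only [hs1, hT2, hT1, hA3, hu]
          · obtain ⟨hA3, hB3, r, hr, h⟩ := h
            obtain rfl : r = -(37 / 64 * u) + 95 / 64 * v + 3737 / 8192 * t - 3515 / 4096 * s
                + 2945 / 8192 := by
              rw [hr, ht]; ring
            rcases h with ⟨hR3, x, hx, h⟩ | ⟨hR3, hS3, hT3, x, g, hx, hg, h⟩ |
              ⟨hR3, hS3, hT3, x, g, hx, hg, h⟩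
            · rcases hR3 with hR3 | hR3 <;> linarith only [ht4, hu, hs1, hR3, hq]
            · linarith only [ht4, hu, hs1, hT3, hq]
            · obtain rfl : x = 11 / 256 * s + 143 / 256 := by rw [hx]; ring
              rcases h.lt_spread 0.395 (by norm_num) with h | h | h | h | h | h <;>
                linarith only [h, hs, hs1]
          · obtain ⟨-, hB3, -⟩ := h; linarith only [hB3, hT2, hT1, hu, hs1]
      · obtain ⟨hA2, hB2, r, hr, h⟩ := h
        obtain rfl : r = -(9 / 16 * u) + 27 / 16 * v + 225 / 512 * t - 243 / 256 * s
            + 297 / 512 := by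
          rw [hr, ht]; ring
        rcases h with ⟨hR2, x, hx, h⟩ | ⟨hR2, hS2, hT2, x, g, hx, hg, h⟩ |
          ⟨hR2, hS2, hT2, x, g, hx, hg, h⟩
        · rcases hR2 with hR2 | hR2 <;> linarith only [hs1, ht0, hR2, hq, hu]
        · linarith only [hs1, ht0, hu, hT2, hq]
        · obtain rfl : x = 3 / 64 * s + 39 / 64 := by rw [hx]; ring
          rcases h.lt_spread 0.498 (by norm_num) with h | h | h | h | h | h <;>
            linarith only [h, hs, hs1]
    · obtain rfl : x = 9 / 16 * s + 5 / 16 := by rw [hx]; ring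
      obtain rfl : g = 9 / 16 * u + 5 / 16 * v - 63 / 512 * t + 45 / 256 * s - 55 / 512 := by
        rw [hg, ht]; ring
      rcases h.coord with ⟨-, h⟩ | h | h
      · obtain ⟨hA2, -⟩ := h; linarith only [hT1, hu, hA2, hq, ht1]
      · obtain ⟨hA2, hB2, r, hr, h⟩ := h
        obtain rfl : r = 13 / 16 * u - 7 / 16 * v - 39 / 512 * t - 91 / 256 * s + 161 / 512 := by
          rw [hr, ht]; ring
        rcases h with ⟨hR2, x, hx, h⟩ | ⟨hR2, hS2, hT2, x, g, hx, hg, h⟩ |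
          ⟨hR2, hS2, hT2, x, g, hx, hg, h⟩
        · rcases hR2 with hR2 | hR2 <;> linarith only [ht2, hR2, hv, hq, hs1]
        · linarith only [hs1, hT2, hv, hq, ht1]
        · obtain rfl : x = 13 / 64 * s + 41 / 64 := by rw [hx]; ring
          rcases h.lt_spread 0.498 (by norm_num) with h | h | h | h | h | h <;>
            linarith only [h, hs, hs1]
      · obtain ⟨-, hB2, -⟩ := h; linarith only [hs1, hT1, hB2, hq, ht1]
  · obtain ⟨hA1, hB1, r, hr, h⟩ := h
    obtain rfl : r = 5 / 4 * u - 3 / 4 * v + 5 / 32 * t - 15 / 16 * s + 21 / 32 := by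
      rw [hr, ht]; ring
    rcases h with ⟨hR1, x, hx, h⟩ | ⟨hR1, hS1, hT1, x, g, hx, hg, h⟩ |
      ⟨hR1, hS1, hT1, x, g, hx, hg, h⟩
    · rcases hR1 with hR1 | hR1 <;> linarith only [ht2, hs1, hR1, hq, hv]
    · linarith only [ht2, hs1, hv, hT1, hq]
    · obtain rfl : x = 5 / 16 * s + 9 / 16 := by rw [hx]; ring
      rcases h.lt_spread 0.627 (by norm_num) with h | h | h | h | h | h <;>
        linarith only [h, hs, hs1]

/-! ### Symmetries of the limiting dynamics -/

theorem spread_swap (A B C : Vertex) : spread B A C = spread A B C := by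
  simp only [spread]
  rw [abs_sub_comm B.1 A.1, abs_sub_comm A.1 C.1, abs_sub_comm C.1 B.1]
  rw [max_assoc, max_assoc, max_comm |C.1 - A.1|]

theorem Step.swap {Q Q' : ℕ → Bool → Vertex → Vertex → Vertex → Prop} {c : ℕ} {A B C : Vertex}
    (hQ : ∀ c r N, Q c r A B N → Q' c r B A N) (h : Step Q c A B C) : Step Q' c B A C := by
  have h1 : Vertex.reflect B A C = Vertex.reflect A B C := by
    ext <;> simp only [Vertex.reflect] <;> ring
  have h2 : ∀ D, Vertex.inside B A D = Vertex.inside A B D := by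
    intro D; ext <;> simp only [Vertex.inside] <;> ring
  simp only [Step, Vertex.outside, h1, h2, max_comm B.2 A.2]
  obtain ⟨hA, hB, h⟩ := h
  refine ⟨hB, hA, ?_⟩
  rcases h with ⟨h, hp⟩ | ⟨h, h', hp⟩ | ⟨h, h', hp⟩
  · exact Or.inl ⟨h, hQ _ _ _ hp⟩
  · exact Or.inr (Or.inl ⟨h, h', hQ _ _ _ hp⟩)
  · exact Or.inr (Or.inr ⟨h, h', hQ _ _ _ hp⟩)

theorem Persists.swap {n c : ℕ} {r : Bool} {A B C : Vertex} (h : Persists n c r A B C) :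
    Persists n c r B A C := by
  induction n generalizing c r A B C with
  | zero => simpa only [Persists, spread_swap] using h
  | succ n ih =>
    simp only [Persists, spread_swap] at h ⊢
    refine ⟨h.1, ?_⟩
    rcases h.2 with ⟨hr, h⟩ | h | h
    · exact Or.inl ⟨hr, h.swap fun _ _ _ => ih⟩
    · exact Or.inr (Or.inr (h.swap fun _ _ _ => ih))
    · exact Or.inr (Or.inl (h.swap fun _ _ _ => ih))

/-- The symmetries of the limiting dynamics: the shears of the plane that preserve `y + x² / 2` up
to a constant act on a vertex by translating its first coordinate and its value; the first
coordinate can also be reversed. -/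
def Vertex.map (ε t k : ℝ) (A : Vertex) : Vertex := (ε * A.1 + t, A.2 + k)

theorem Step.map {Q Q' : ℕ → Bool → Vertex → Vertex → Vertex → Prop} {c : ℕ} {A B C : Vertex}
    {ε : ℝ} (hε : ε ^ 2 = 1) (t k : ℝ)
    (hQ : ∀ c r N, Q c r A B N → Q' c r (A.map ε t k) (B.map ε t k) (N.map ε t k))
    (h : Step Q c A B C) : Step Q' c (A.map ε t k) (B.map ε t k) (C.map ε t k) := by
  have h1 : (A.map ε t k).reflect (B.map ε t k) (C.map ε t k) = (A.reflect B C).map ε t k := by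
    ext <;> simp only [Vertex.reflect, Vertex.map]
    · ring
    · linear_combination ((C.1 - A.1) * (C.1 - B.1)) * hε
  have h2 : ∀ D : Vertex,
      (A.map ε t k).inside (B.map ε t k) (D.map ε t k) = (A.inside B D).map ε t k := by
    intro D
    ext <;> simp only [Vertex.inside, Vertex.map]
    · ring
    · linear_combination
        (-((A.1 - B.1) ^ 2 / 32 + (A.1 - D.1) ^ 2 / 16 + (B.1 - D.1) ^ 2 / 16)) * hε
  have h3 : max (A.map ε t k).2 (B.map ε t k).2 = max A.2 B.2 + k := max_add_add_right _ _ _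
  have h4 : ∀ D : Vertex, (D.map ε t k).2 = D.2 + k := fun _ => rfl
  simp only [Step, Vertex.outside, h1, h2, h3]
  simp only [h4, add_le_add_iff_right]
  obtain ⟨hA, hB, h⟩ := h
  refine ⟨hA, hB, ?_⟩
  rcases h with ⟨h, hp⟩ | ⟨h, h', hp⟩ | ⟨h, h', hp⟩
  · exact Or.inl ⟨h, hQ _ _ _ hp⟩
  · exact Or.inr (Or.inl ⟨h, h', hQ _ _ _ hp⟩)
  · exact Or.inr (Or.inr ⟨h, h', hQ _ _ _ hp⟩)

theorem abs_eq_one_of_sq {ε : ℝ} (hε : ε ^ 2 = 1) : |ε| = 1 := by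
  rw [← one_pow 2, sq_eq_sq_iff_abs_eq_abs] at hε
  simpa using hε

theorem spread_map {ε : ℝ} (hε : ε ^ 2 = 1) (t k : ℝ) (A B C : Vertex) :
    spread (A.map ε t k) (B.map ε t k) (C.map ε t k) = spread A B C := by
  have h : ∀ x y : ℝ, |ε * x + t - (ε * y + t)| = |x - y| := by
    intro x y
    rw [add_sub_add_right_eq_sub, ← mul_sub, abs_mul, abs_eq_one_of_sq hε, one_mul]
  simp only [spread, Vertex.map, h]

theorem Persists.map {n c : ℕ} {r : Bool} {A B C : Vertex} {ε : ℝ} (hε : ε ^ 2 = 1) (t k : ℝ)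
    (h : Persists n c r A B C) :
    Persists n c r (A.map ε t k) (B.map ε t k) (C.map ε t k) := by
  induction n generalizing c r A B C with
  | zero => simpa only [Persists, spread_map hε] using h
  | succ n ih =>
    simp only [Persists, spread_map hε] at h ⊢
    refine ⟨h.1, ?_⟩
    rcases h.2 with ⟨hr, h⟩ | h | h
    · exact Or.inl ⟨hr, h.map hε t k fun _ _ _ => ih⟩
    · exact Or.inr (Or.inl (h.map hε t k fun _ _ _ => ih))
    · exact Or.inr (Or.inr (h.map hε t k fun _ _ _ => ih))

/-- An inside contraction of the leftmost vertex `C`, with `A` to the left of `B`. -/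
theorem not_persists_inside_of_le {A B C : Vertex} (hsp : spread A B C = 1)
    (hA : A.2 ≤ C.2) (hB : B.2 ≤ C.2) (hR : C.2 ≤ (A.reflect B C).2)
    (hCA : C.1 ≤ A.1) (hAB : A.1 ≤ B.1) (h : Persists 11 1 false A B (A.inside B C)) : False := by
  have h1 : B.1 = C.1 + 1 := by
    have h3 : |A.1 - B.1| = B.1 - A.1 := by rw [abs_of_nonpos (by linarith)]; ring
    have h4 : |B.1 - C.1| = B.1 - C.1 := abs_of_nonneg (by linarith)
    have h5 : |C.1 - A.1| = A.1 - C.1 := by rw [abs_of_nonpos (by linarith)]; ring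
    rw [spread, h3, h4, h5, max_eq_right (a := B.1 - A.1) (by linarith),
      max_eq_left (a := B.1 - C.1) (by linarith)] at hsp
    linarith
  have h2 := h.map (ε := 1) (by norm_num) (-C.1) (-C.2)
  obtain ⟨s, hs⟩ : ∃ s, s = A.1 - C.1 := ⟨_, rfl⟩
  obtain ⟨u, hu⟩ : ∃ u, u = A.2 - C.2 := ⟨_, rfl⟩
  obtain ⟨v, hv⟩ : ∃ v, v = B.2 - C.2 := ⟨_, rfl⟩
  have eA : A.map 1 (-C.1) (-C.2) = (s, u) := by
    ext <;> simp only [Vertex.map] <;> linarith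
  have eB : B.map 1 (-C.1) (-C.2) = (1, v) := by
    ext <;> simp only [Vertex.map] <;> linarith
  have eN : (A.inside B C).map 1 (-C.1) (-C.2) = (1 / 4 * s + 1 / 4,
      1 / 4 * u + 1 / 4 * v - 3 / 32 * s ^ 2 + 1 / 16 * s - 3 / 32) := by
    ext <;> simp only [Vertex.map, Vertex.inside, h1, hs, hu, hv] <;> ring
  rw [eA, eB, eN] at h2
  have hR' : C.2 ≤ A.2 + B.2 - C.2 + (C.1 - A.1) * (C.1 - B.1) := hR
  refine not_persists_normalized (by linarith) ?_ rfl (by linarith) (by linarith) ?_ h2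
  -- The new vertex is at distance at most `3 / 4` from `(1, v)`, so `1 - s` has to exceed `0.791`.
  · rcases h2.lt_spread 0.791 (by norm_num) with h | h | h | h | h | h <;> linarith
  · rw [h1] at hR'
    linarith

theorem not_persists_inside {A B C : Vertex} (hsp : spread A B C = 1)
    (hA : A.2 ≤ C.2) (hB : B.2 ≤ C.2) (hR : C.2 ≤ (A.reflect B C).2)
    (h : Persists 11 1 false A B (A.inside B C)) : False := by
  wlog hAB : A.1 ≤ B.1 generalizing A B
  · refine this (by rw [spread_swap, hsp]) hB hA ?_ ?_ (le_of_not_ge hAB)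
    · convert hR using 1
      simp only [Vertex.reflect]; ring
    · convert h.swap using 1
      ext <;> simp only [Vertex.inside] <;> ring
  rcases le_or_gt C.1 A.1 with hCA | hCA
  · exact not_persists_inside_of_le hsp hA hB hR hCA hAB h
  rcases le_or_gt B.1 C.1 with hCB | hCB
  · have hε : (-1 : ℝ) ^ 2 = 1 := by norm_num
    refine not_persists_inside_of_le (A := B.map (-1) 0 0) (B := A.map (-1) 0 0)
      (C := C.map (-1) 0 0) ?_ ?_ ?_ ?_ ?_ ?_ ?_
    · rw [spread_swap, spread_map hε, hsp]
    · simpa [Vertex.map] using hB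
    · simpa [Vertex.map] using hA
    · simp only [Vertex.reflect, Vertex.map] at hR ⊢
      linarith
    · simpa [Vertex.map] using hCB
    · simpa [Vertex.map] using hAB
    · convert (h.map hε 0 0).swap using 1
      ext <;> simp only [Vertex.inside, Vertex.map] <;> ring
  -- The reflection of a vertex strictly between the others has too small a value.
  · have h1 : (C.1 - A.1) * (C.1 - B.1) < 0 :=
      mul_neg_of_pos_of_neg (by linarith) (by linarith)
    simp only [Vertex.reflect] at hR
    linarith

theorem spread_reflect (A B C : Vertex) : spread A B (A.reflect B C) = spread A B C := by
  simp only [spread, Vertex.reflect]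
  have h1 : B.1 - (A.1 + B.1 - C.1) = C.1 - A.1 := by ring
  have h2 : A.1 + B.1 - C.1 - A.1 = B.1 - C.1 := by ring
  rw [h1, h2, max_assoc, max_assoc, max_comm |B.1 - C.1|]

theorem reflect_reflect (A B C : Vertex) : A.reflect B (A.reflect B C) = C := by
  ext <;> simp only [Vertex.reflect] <;> ring

/-- Along a run on `y + x² / 2` that starts with a contraction, the flatness exceeds `1.01` times
its initial value within twelve moves. An outside contraction is an inside contraction of the
reflected triangle, which has the same width. -/
theorem not_persists_contraction {A B C : Vertex} (hsp : spread A B C = 1)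
    (hA : A.2 ≤ C.2) (hB : B.2 ≤ C.2) (hR : max A.2 B.2 ≤ (A.reflect B C).2)
    (h : ((A.reflect B C).2 ≤ C.2 ∧ Persists 11 1 false A B (A.outside B C)) ∨
      (C.2 ≤ (A.reflect B C).2 ∧ Persists 11 1 false A B (A.inside B C))) : False := by
  rcases h with ⟨h1, h⟩ | ⟨h1, h⟩
  · exact not_persists_inside (by rw [spread_reflect, hsp]) ((le_max_left _ _).trans hR)
      ((le_max_right _ _).trans hR) (by rwa [reflect_reflect]) h
  · exact not_persists_inside hsp hA hB h1 h

/-! ### Second order expansions in local frames -/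

section Taylor

theorem tendsto_fderiv_sub {E F : Type*} [NormedAddCommGroup E] [NormedSpace ℝ E]
    [NormedAddCommGroup F] [NormedSpace ℝ F] {g : E → F} (hg : ContDiff ℝ 1 g) (b : E) :
    Tendsto (fun c => ‖fderiv ℝ g c - fderiv ℝ g b‖) (𝓝 b) (𝓝 0) :=
  tendsto_iff_norm_sub_tendsto_zero.1 ((hg.continuous_fderiv (by norm_num)).tendsto b)

variable {E : Type*} [NormedAddCommGroup E] [NormedSpace ℝ E] {f : E → ℝ}

theorem differentiable_fderiv (hf : ContDiff ℝ 2 f) : Differentiable ℝ (fderiv ℝ f) :=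
  (hf.fderiv_right (m := 1) (by norm_num)).differentiable (by norm_num)

theorem continuous_hessian (hf : ContDiff ℝ 2 f) : Continuous (fderiv ℝ (fderiv ℝ f)) :=
  (hf.fderiv_right (m := 1) (by norm_num)).continuous_fderiv (by norm_num)

theorem continuous_hessian_apply (hf : ContDiff ℝ 2 f) :
    Continuous fun z : E × E => fderiv ℝ (fderiv ℝ f) z.1 z.2 z.2 :=
  (((continuous_hessian hf).comp continuous_fst).clm_apply continuous_snd).clm_apply continuous_snd

theorem eventually_derivatives_le (hf : ContDiff ℝ 2 f) (b : E) :
    ∃ N : ℝ, 1 ≤ N ∧ ∀ᶠ c in 𝓝 b, ∀ v, |fderiv ℝ f c v| ≤ N * ‖v‖ ∧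
      |fderiv ℝ (fderiv ℝ f) c v v| ≤ N * ‖v‖ ^ 2 := by
  have h1 := norm_nonneg (fderiv ℝ f b)
  have h2 := norm_nonneg (fderiv ℝ (fderiv ℝ f) b)
  refine ⟨‖fderiv ℝ f b‖ + ‖fderiv ℝ (fderiv ℝ f) b‖ + 1, by linarith, ?_⟩
  filter_upwards [((hf.continuous_fderiv (by norm_num)).norm.tendsto b).eventually_le_const
      (u := ‖fderiv ℝ f b‖ + ‖fderiv ℝ (fderiv ℝ f) b‖ + 1) (by linarith),
    (tendsto_fderiv_sub (hf.fderiv_right (m := 1) (by norm_num)) b).eventually_le_const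
      zero_lt_one] with c h3 h4 v
  have h5 : ‖fderiv ℝ (fderiv ℝ f) c‖ ≤ ‖fderiv ℝ f b‖ + ‖fderiv ℝ (fderiv ℝ f) b‖ + 1 := by
    linarith [norm_le_norm_add_norm_sub' (fderiv ℝ (fderiv ℝ f) c) (fderiv ℝ (fderiv ℝ f) b)]
  refine ⟨((fderiv ℝ f c).le_opNorm v).trans (by gcongr), ?_⟩
  refine ((fderiv ℝ (fderiv ℝ f) c).le_opNorm₂ v v).trans ?_
  rw [mul_assoc, ← pow_two]
  gcongr

/-- The Taylor expansion of `taylor_two`, uniformly in the base point. -/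
theorem taylor_two_uniform (hf : ContDiff ℝ 2 f) (b : E) {ε : ℝ} (hε : 0 < ε) :
    ∃ δ > 0, ∀ᶠ c in 𝓝 b, ∀ v : E, ‖v‖ < δ →
      |f (v + c) - (f c + fderiv ℝ f c v + 1 / 2 * fderiv ℝ (fderiv ℝ f) c v v)| ≤ ε * ‖v‖ ^ 2 := by
  have hnear : ∀ᶠ c in 𝓝 b, ‖fderiv ℝ (fderiv ℝ f) c - fderiv ℝ (fderiv ℝ f) b‖ < ε / 2 :=
    (tendsto_fderiv_sub (hf.fderiv_right (m := 1) (by norm_num)) b).eventually_lt_const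
      (half_pos hε)
  obtain ⟨δ, hδ, h⟩ := Metric.eventually_nhds_iff_ball.1 hnear
  refine ⟨δ / 2, half_pos hδ, ?_⟩
  filter_upwards [Metric.ball_mem_nhds b (half_pos hδ)] with c hc v hv
  rw [mem_ball_iff_norm] at hc
  have hd : Differentiable ℝ f := hf.differentiable (by norm_num)
  set G := fderiv ℝ f c
  set H := fderiv ℝ (fderiv ℝ f) c with hH
  have hnear : ∀ w ∈ Metric.closedBall (0 : E) ‖v‖,
      ‖fderiv ℝ (fderiv ℝ f) (w + c) - H‖ ≤ ε := by
    intro w hw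
    have hw' : ‖w‖ ≤ ‖v‖ := by simpa using hw
    have h1 := h (w + c) (by
      rw [mem_ball_iff_norm, add_sub_assoc]
      linarith [norm_add_le w (c - b)])
    have h2 := h c (by rw [mem_ball_iff_norm]; linarith)
    have h3 := norm_sub_le_norm_sub_add_norm_sub (fderiv ℝ (fderiv ℝ f) (w + c))
      (fderiv ℝ (fderiv ℝ f) b) H
    have h4 := norm_sub_rev (fderiv ℝ (fderiv ℝ f) b) H
    linarith
  have hG : ∀ w ∈ Metric.closedBall (0 : E) ‖v‖,
      ‖fderiv ℝ f (w + c) - (G + H w)‖ ≤ ε * ‖v‖ := by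
    intro w hw
    have hder : ∀ w : E, HasFDerivAt (fun w : E => fderiv ℝ f (w + c) - (G + H w))
        (fderiv ℝ (fderiv ℝ f) (w + c) - H) w := fun w =>
      ((hasFDerivAt_comp_add_right c).2 (differentiable_fderiv hf (w + c)).hasFDerivAt).sub
        (H.hasFDerivAt.const_add G)
    have h1 := (convex_closedBall (0 : E) ‖v‖).norm_image_sub_le_of_norm_hasFDerivWithin_le
      (fun w _ => (hder w).hasFDerivWithinAt) hnear (x := 0) (y := w) (by simp) hw
    have h2 : fderiv ℝ f (0 + c) - (G + H 0) = 0 := by simp [G]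
    rw [h2, sub_zero, sub_zero] at h1
    exact h1.trans (by gcongr; simpa using hw)
  have hsymm : ∀ v w, H v w = H w v :=
    second_derivative_symmetric (fun y => (hd y).hasFDerivAt)
      (differentiable_fderiv hf c).hasFDerivAt
  have hder : ∀ w : E, HasFDerivAt (fun w : E => f (w + c) - (f c + G w + 1 / 2 * H w w))
      (fderiv ℝ f (w + c) - (G + H w)) w := by
    intro w
    have h1 : HasFDerivAt (fun w : E => f (w + c)) (fderiv ℝ f (w + c)) w :=
      (hasFDerivAt_comp_add_right c).2 (hd (w + c)).hasFDerivAt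
    have h2 : HasFDerivAt (fun w : E => H w w) (H w + H.flip w) w := by
      refine ((H.hasFDerivAt (x := w)).clm_apply (hasFDerivAt_id w)).congr_fderiv ?_
      ext z; simp
    refine (h1.sub (((hasFDerivAt_const (f c) w).add (G.hasFDerivAt (x := w))).add
      (h2.const_mul (1 / 2 : ℝ)))).congr_fderiv ?_
    ext z
    simp [hsymm z w]
    ring
  have hmv := (convex_closedBall (0 : E) ‖v‖).norm_image_sub_le_of_norm_hasFDerivWithin_le
    (fun w _ => (hder w).hasFDerivWithinAt) hG (x := 0) (y := v) (by simp) (by simp)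
  simpa [pow_two, mul_assoc] using hmv

end Taylor

variable {f : Plane → ℝ}

/-- The Hessian is bounded below near every point. -/
theorem exists_hessian_lower_bound (hf : ClassF f) {s : Set Plane} (hs : IsCompact s) :
    ∃ m > 0, ∀ q ∈ s, ∀ v : Plane, m * ‖v‖ ^ 2 ≤ fderiv ℝ (fderiv ℝ f) q v v := by
  rcases s.eq_empty_or_nonempty with rfl | hne
  · exact ⟨1, one_pos, by simp⟩
  have hK : IsCompact (s ×ˢ Metric.sphere (0 : Plane) 1) := hs.prod (isCompact_sphere 0 1)
  have hc := continuous_hessian_apply hf.contDiff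
  obtain ⟨z, hz, hmin⟩ := hK.exists_isMinOn
    (hne.prod (NormedSpace.sphere_nonempty.2 zero_le_one)) hc.continuousOn
  have hz2 : z.2 ≠ 0 := by
    intro h0
    have := hz.2
    simp [h0] at this
  refine ⟨_, hf.hessian_pos z.1 z.2 hz2, fun q hq v => ?_⟩
  rcases eq_or_ne v 0 with rfl | hv
  · simp
  have hv' : 0 < ‖v‖ := norm_pos_iff.2 hv
  have h1 := hmin (a := (q, ‖v‖⁻¹ • v)) ⟨hq, by simp [norm_smul, hv'.ne']⟩
  simp only [map_smul, _root_.smul_apply, smul_eq_mul, Set.mem_ofPred_eq] at h1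
  calc _ ≤ (‖v‖⁻¹ * (‖v‖⁻¹ * fderiv ℝ (fderiv ℝ f) q v v)) * ‖v‖ ^ 2 := by gcongr
    _ = _ := by field_simp

/-- The coordinates of `p` in the local frame with base point `c`. -/
noncomputable def frameCoord (f : Plane → ℝ) (c p : Plane) : Plane :=
  (frameMatrix f c)⁻¹.mulVec (p - c)

theorem frameMatrix_spec (hf : ClassF f) {c : Plane} (hc : fderiv ℝ f c ≠ 0) :
    IsFrameMatrix f c (frameMatrix f c) :=
  Classical.epsilon_spec (existsUnique_isFrameMatrix hf hc).exists

/-- The local frames in terms of derivatives, for base points near a noncritical point, with a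
bound on `α`. -/
theorem exists_frame_bounds (hf : ClassF f) {b : Plane} (hb : fderiv ℝ f b ≠ 0) :
    ∃ N A : ℝ, 1 ≤ N ∧ 0 ≤ A ∧ ∀ᶠ c in 𝓝 b, (∀ v, |fderiv ℝ f c v| ≤ N * ‖v‖ ∧
      |fderiv ℝ (fderiv ℝ f) c v v| ≤ N * ‖v‖ ^ 2) ∧ 0 < (frameMatrix f c).det ∧
      ∃ α, 0 < α ∧ α ≤ A ∧ ∀ p,
        fderiv ℝ f c (p - c) = frameCoord f c p 1 ∧
        fderiv ℝ (fderiv ℝ f) c (p - c) (p - c)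
          = frameCoord f c p 0 ^ 2 + α * frameCoord f c p 1 ^ 2 := by
  obtain ⟨v₀, hv₀⟩ : ∃ v₀, fderiv ℝ f b v₀ = 1 := by
    obtain ⟨v, hv⟩ : ∃ v, fderiv ℝ f b v ≠ 0 := by
      by_contra! h
      exact hb (ContinuousLinearMap.ext h)
    exact ⟨(fderiv ℝ f b v)⁻¹ • v, by simp [hv]⟩
  obtain ⟨N, hN1, e1⟩ := eventually_derivatives_le hf.contDiff b
  have e3 : ∀ᶠ c in 𝓝 b, 1 / 2 ≤ fderiv ℝ f c v₀ :=
    (((hf.contDiff.continuous_fderiv (by norm_num)).clm_apply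
      continuous_const).tendsto b).eventually_const_le (by rw [hv₀]; norm_num)
  set A := 4 * N * ‖v₀‖ ^ 2 with hA
  have hA0 : 0 ≤ A := by positivity
  refine ⟨N, A, hN1, hA0, ?_⟩
  filter_upwards [e1, e3] with c h1 h3
  have hc : fderiv ℝ f c ≠ 0 := by
    intro h0
    rw [h0] at h3
    norm_num at h3
  obtain ⟨hdet, α, hα, hq⟩ := (isFrameMatrix_iff hf.contDiff c _).1 (frameMatrix_spec hf hc)
  have hfr : ∀ p, fderiv ℝ f c (p - c) = frameCoord f c p 1 ∧
      fderiv ℝ (fderiv ℝ f) c (p - c) (p - c)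
        = frameCoord f c p 0 ^ 2 + α * frameCoord f c p 1 ^ 2 := by
    intro p
    have h4 : (frameMatrix f c).mulVec (frameCoord f c p) = p - c := by
      rw [frameCoord, Matrix.mulVec_mulVec, Matrix.mul_nonsing_inv _ hdet.ne'.isUnit,
        Matrix.one_mulVec]
    rw [← h4]
    exact hq _
  refine ⟨h1, hdet, α, hα, ?_, hfr⟩
  obtain ⟨h5, h6⟩ := hfr (v₀ + c)
  rw [add_sub_cancel_right] at h5 h6
  have h7 : fderiv ℝ (fderiv ℝ f) c v₀ v₀ ≤ N * ‖v₀‖ ^ 2 := (le_abs_self _).trans (h1 v₀).2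
  rw [← h5] at h6
  have h8 : α * (1 / 2) ^ 2 ≤ α * (fderiv ℝ f c v₀) ^ 2 := by gcongr
  nlinarith [sq_nonneg (frameCoord f c (v₀ + c) 0)]

/-- The function in a local frame, with bounds that are uniform for base points `c` near a
noncritical point `b`: the `α`-term of the frame is absorbed in `C * y ^ 2`. -/
theorem frame_expansion (hf : ClassF f) {b : Plane} (hb : fderiv ℝ f b ≠ 0) :
    ∃ C > 0,
      (∀ᶠ c in 𝓝 b, 0 < (frameMatrix f c).det ∧ ∀ p, ∀ i, |frameCoord f c p i| ≤ C * ‖p - c‖) ∧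
      ∀ ε > 0, ∃ δ > 0, ∀ᶠ c in 𝓝 b, ∀ p, ‖p - c‖ < δ →
        |f p - f c - (frameCoord f c p 1 + frameCoord f c p 0 ^ 2 / 2)|
          ≤ ε * frameCoord f c p 0 ^ 2 + C * frameCoord f c p 1 ^ 2 := by
  obtain ⟨m, hm, hmin⟩ := exists_hessian_lower_bound hf (isCompact_closedBall b 1)
  obtain ⟨N, A, hN1, hA0, key⟩ := exists_frame_bounds hf hb
  refine ⟨N + 2 * A + 1, by positivity, ?_, ?_⟩
  · filter_upwards [key] with c ⟨h1, hdet, α, hα, _, h3⟩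
    refine ⟨hdet, fun p i => ?_⟩
    obtain ⟨h4, h5⟩ := h3 p
    have h6 : 0 ≤ ‖p - c‖ := norm_nonneg _
    have h7 : |frameCoord f c p i| ≤ N * ‖p - c‖ := by
      fin_cases i
      · apply abs_le_of_sq_le_sq _ (by positivity)
        have h7 : fderiv ℝ (fderiv ℝ f) c (p - c) (p - c) ≤ N * ‖p - c‖ ^ 2 :=
          (le_abs_self _).trans (h1 _).2
        have h8 : 0 ≤ α * frameCoord f c p 1 ^ 2 := by positivity
        have h9 : N * ‖p - c‖ ^ 2 ≤ N * N * ‖p - c‖ ^ 2 := by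
          gcongr; nlinarith
        show frameCoord f c p 0 ^ 2 ≤ _
        nlinarith
      · show |frameCoord f c p 1| ≤ _
        rw [← h4]
        exact (h1 _).1
    exact h7.trans (by gcongr; linarith)
  · intro ε hε
    set η := min ε 1 * m with hη
    have hη0 : 0 < η := by positivity
    obtain ⟨δ, hδ, hT⟩ := taylor_two_uniform hf.contDiff b hη0
    refine ⟨δ, hδ, ?_⟩
    filter_upwards [hT, key, Metric.closedBall_mem_nhds b one_pos] with
      c hT ⟨_, _, α, hα, hαA, h3⟩ hcb p hp
    have h4 := hT (p - c) hp
    rw [sub_add_cancel, (h3 p).1, (h3 p).2] at h4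
    have h5 := hmin c hcb (p - c)
    rw [(h3 p).2] at h5
    set x := frameCoord f c p 0
    set y := frameCoord f c p 1
    have h6 : η * ‖p - c‖ ^ 2 ≤ min ε 1 * (x ^ 2 + α * y ^ 2) := by
      rw [hη, mul_assoc]; gcongr
    have h7 : min ε 1 * x ^ 2 ≤ ε * x ^ 2 := by gcongr; exact min_le_left _ _
    have h8 : min ε 1 * (α * y ^ 2) ≤ 1 * (α * y ^ 2) := by gcongr; exact min_le_right _ _
    have h9 : α * y ^ 2 ≤ A * y ^ 2 := by gcongr
    have h10 : 0 ≤ (N + 1) * y ^ 2 := by positivity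
    have h11 : 0 ≤ α * y ^ 2 := by positivity
    rw [abs_le] at h4 ⊢
    constructor <;> nlinarith

/-! ### Strict convexity -/

theorem hasDerivAt_line {E F : Type*} [NormedAddCommGroup E] [NormedSpace ℝ E]
    [NormedAddCommGroup F] [NormedSpace ℝ F] {g : E → F} (hg : Differentiable ℝ g) (a d : E)
    (t : ℝ) : HasDerivAt (fun t : ℝ => g (a + t • d)) (fderiv ℝ g (a + t • d) d) t := by
  have hl : HasDerivAt (fun t : ℝ => a + t • d) d t := by
    simpa using ((hasDerivAt_id t).smul_const d).const_add a
  exact (hg (a + t • d)).hasFDerivAt.comp_hasDerivAt t hl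

theorem hasDerivAt_fderiv_line {E : Type*} [NormedAddCommGroup E] [NormedSpace ℝ E] {f : E → ℝ}
    (hf : ContDiff ℝ 2 f) (a d : E) (t : ℝ) :
    HasDerivAt (fun t : ℝ => fderiv ℝ f (a + t • d) d)
      (fderiv ℝ (fderiv ℝ f) (a + t • d) d d) t := by
  have h := (hasDerivAt_line (differentiable_fderiv hf) a d t).clm_apply (hasDerivAt_const t d)
  simpa using h

variable {f : Plane → ℝ}

/-- Along a segment on which the second directional derivative is at least `μ`, the function minus
a parabola is convex. -/
theorem convexOn_segment (hf : ClassF f) (a d : Plane) {μ : ℝ}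
    (hμ : ∀ t ∈ Set.Icc (0 : ℝ) 1, μ ≤ fderiv ℝ (fderiv ℝ f) (a + t • d) d d) :
    ConvexOn ℝ (Set.Icc (0 : ℝ) 1) (fun t => f (a + t • d) - μ / 2 * t ^ 2) := by
  have h1 : ∀ t : ℝ, HasDerivAt (fun t : ℝ => f (a + t • d) - μ / 2 * t ^ 2)
      (fderiv ℝ f (a + t • d) d - μ * t) t := by
    intro t
    refine ((hasDerivAt_line (hf.contDiff.differentiable (by norm_num)) a d t).sub
      (((hasDerivAt_id t).pow 2).const_mul (μ / 2))).congr_deriv ?_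
    simp; ring
  have h2 : ∀ t : ℝ, HasDerivAt (fun t : ℝ => fderiv ℝ f (a + t • d) d - μ * t)
      (fderiv ℝ (fderiv ℝ f) (a + t • d) d d - μ) t := by
    intro t
    exact ((hasDerivAt_fderiv_line hf.contDiff a d t).sub
      ((hasDerivAt_id t).const_mul μ)).congr_deriv (by simp)
  refine convexOn_of_hasDerivWithinAt2_nonneg (convex_Icc 0 1)
    (fun t _ => (h1 t).continuousAt.continuousWithinAt) (fun t _ => (h1 t).hasDerivWithinAt)
    (fun t _ => (h2 t).hasDerivWithinAt) fun t ht => ?_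
  linarith [hμ t (interior_subset ht)]

theorem ClassF.hessian_nonneg (hf : ClassF f) (q v : Plane) :
    0 ≤ fderiv ℝ (fderiv ℝ f) q v v := by
  rcases eq_or_ne v 0 with rfl | hv
  · simp
  · exact (hf.hessian_pos q v hv).le

theorem ClassF.le_max (hf : ClassF f) (a b : Plane) {t : ℝ} (ht : t ∈ Set.Icc (0 : ℝ) 1) :
    f (a + t • (b - a)) ≤ max (f a) (f b) := by
  have hc := convexOn_segment hf a (b - a) (μ := 0) fun _ _ => hf.hessian_nonneg _ _
  have h := hc.le_max_of_mem_Icc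
    (x := 0) (y := 1) (z := t) (by simp) (by simp) ht
  simpa using h

/-- Midpoint convexity with a quadratic gain. -/
theorem midpoint_le_of_hessian (hf : ClassF f) {R m : ℝ}
    (hm : ∀ q ∈ Metric.closedBall (0 : Plane) R, ∀ v : Plane,
      m * ‖v‖ ^ 2 ≤ fderiv ℝ (fderiv ℝ f) q v v)
    {a b : Plane} (ha : ‖a‖ ≤ R) (hb : ‖b‖ ≤ R) :
    f ((1 / 2 : ℝ) • (a + b)) ≤ (f a + f b) / 2 - m / 8 * ‖b - a‖ ^ 2 := by
  have hseg : ∀ t ∈ Set.Icc (0 : ℝ) 1,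
      m * ‖b - a‖ ^ 2 ≤ fderiv ℝ (fderiv ℝ f) (a + t • (b - a)) (b - a) (b - a) := fun t ht =>
    hm _ ((convex_closedBall (0 : Plane) R).add_smul_sub_mem (by simpa using ha)
      (by simpa using hb) ht) _
  have h := (convexOn_segment hf a (b - a) hseg).2 (Set.left_mem_Icc.2 zero_le_one)
    (Set.right_mem_Icc.2 zero_le_one) one_half_pos.le one_half_pos.le (add_halves 1)
  have e : a + (1 / 2 : ℝ) • (b - a) = (1 / 2 : ℝ) • (a + b) := by module
  simp only [smul_eq_mul, mul_zero, mul_one, zero_add, zero_smul, add_zero, one_smul,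
    add_sub_cancel, e] at h
  linarith

theorem midpoint_lt (hf : ClassF f) {a b : Plane} (hab : a ≠ b) :
    f ((1 / 2 : ℝ) • (a + b)) < (f a + f b) / 2 := by
  obtain ⟨m, hm, h⟩ := exists_hessian_lower_bound hf
    (isCompact_closedBall (0 : Plane) (max ‖a‖ ‖b‖))
  have h1 := midpoint_le_of_hessian hf h (le_max_left _ _) (le_max_right _ _)
  have h2 : 0 < ‖b - a‖ := norm_pos_iff.2 (sub_ne_zero.2 hab.symm)
  have h3 : 0 < m / 8 * ‖b - a‖ ^ 2 := by positivity
  linarith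

theorem midpoint_le (hf : ClassF f) (a b : Plane) :
    f ((1 / 2 : ℝ) • (a + b)) ≤ (f a + f b) / 2 := by
  rcases eq_or_ne a b with rfl | h
  · have : (1 / 2 : ℝ) • (a + a) = a := by module
    rw [this]; linarith
  · exact (midpoint_lt hf h).le

/-- Sublevel sets are bounded. By strict convexity, one of two far away points symmetric about `a`
lies above the level of `a`, hence so does the sphere through it, which is connected and misses the
level set; and by convexity no point outside this sphere is below the level of `a`. -/
theorem isBounded_sublevel (hf : ClassF f) (a : Plane) :
    Bornology.IsBounded {q : Plane | f q ≤ f a} := by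
  obtain ⟨R, hR⟩ := (hf.bounded_level (f a)).subset_closedBall 0
  have ha : ‖a‖ ≤ R := by simpa using hR (show f a = f a from rfl)
  have hrank : 1 < Module.rank ℝ Plane := by simp
  obtain ⟨v, hv⟩ : ∃ v : Plane, ‖v‖ = 2 * R + 1 := by
    have : 0 ≤ R := (norm_nonneg a).trans ha
    exact ⟨fun _ => 2 * R + 1, by rw [pi_norm_const, Real.norm_of_nonneg (by linarith)]⟩
  obtain ⟨q, hq, hfq⟩ : ∃ q : Plane, R < ‖q‖ ∧ f a < f q := by
    have hv0 : a + v ≠ a - v := by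
      intro h
      have h0 : (2 : ℝ) • v = 0 := by
        rw [← sub_eq_zero.2 h]; module
      have : v = 0 := by simpa using h0
      rw [this, norm_zero] at hv
      linarith [norm_nonneg a]
    have h1 := midpoint_lt hf hv0
    have e : (1 / 2 : ℝ) • (a + v + (a - v)) = a := by module
    rw [e] at h1
    have h2 : ‖v‖ ≤ ‖a + v‖ + ‖a‖ := by simpa using norm_sub_le (a + v) a
    have h3 : ‖v‖ ≤ ‖a - v‖ + ‖a‖ := by
      have := norm_sub_le (a - v) a
      rwa [sub_sub_cancel_left, norm_neg] at this
    by_cases h4 : f a < f (a + v)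
    · exact ⟨_, by linarith, h4⟩
    · exact ⟨a - v, by linarith, by linarith⟩
  have hsphere : ∀ z ∈ Metric.sphere (0 : Plane) ‖q‖, f a < f z := by
    intro z hz
    by_contra! hle
    obtain ⟨y, hy, hfy⟩ := (isPreconnected_sphere hrank (0 : Plane) ‖q‖).intermediate_value
      hz (show q ∈ Metric.sphere (0 : Plane) ‖q‖ by simp)
      hf.contDiff.continuous.continuousOn ⟨hle, hfq.le⟩
    have h5 := hR hfy
    simp only [mem_closedBall_iff_norm, sub_zero, mem_sphere_iff_norm] at h5 hy
    linarith
  refine (Metric.isBounded_closedBall (x := (0 : Plane)) (r := ‖q‖)).subset fun z hz => ?_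
  by_contra hzq
  have hzq' : ‖q‖ ≤ ‖z‖ := by simpa using (not_le.1 (by simpa using hzq)).le
  have hc : ContinuousOn (fun t : ℝ => ‖a + t • (z - a)‖) (Set.Icc 0 1) := by fun_prop
  obtain ⟨t, ht, htq⟩ := intermediate_value_Icc zero_le_one hc
    (show ‖q‖ ∈ _ by simpa using ⟨by linarith, hzq'⟩)
  have h6 := hsphere (a + t • (z - a)) (by simpa using htq)
  have h7 := hf.le_max a z ht
  rw [max_eq_left hz] at h7
  linarith

theorem isCompact_sublevel (hf : ClassF f) (a : Plane) : IsCompact {q : Plane | f q ≤ f a} :=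
  Metric.isCompact_of_isClosed_isBounded
    (isClosed_le hf.contDiff.continuous continuous_const) (isBounded_sublevel hf a)

theorem exists_minimizer (hf : ClassF f) : ∃ z, ∀ q, f z ≤ f q := by
  obtain ⟨z, hz, h⟩ := (isCompact_sublevel hf 0).exists_isMinOn ⟨0, le_refl (f 0)⟩
    hf.contDiff.continuous.continuousOn
  refine ⟨z, fun q => ?_⟩
  rcases le_total (f q) (f 0) with hq | hq
  · exact h hq
  · exact le_trans hz hq

theorem lt_of_minimizer (hf : ClassF f) {z q : Plane} (hz : ∀ q, f z ≤ f q) (hq : q ≠ z) :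
    f z < f q := by
  have h := midpoint_lt hf hq
  linarith [hz ((1 / 2 : ℝ) • (q + z))]

theorem fderiv_ne_zero (hf : ClassF f) {z b : Plane} (hzb : f z < f b) : fderiv ℝ f b ≠ 0 := by
  intro h0
  have hc := convexOn_segment hf b (z - b) (μ := 0) fun _ _ => hf.hessian_nonneg _ _
  have hd : HasDerivAt (fun t : ℝ => f (b + t • (z - b)) - 0 / 2 * t ^ 2) 0 0 := by
    have h1 := hasDerivAt_line (hf.contDiff.differentiable (by norm_num)) b (z - b) 0
    rw [zero_smul, add_zero, h0] at h1
    simpa using h1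
  have h3 := hc.le_slope_of_hasDerivAt (x := 0) (y := 1) (by simp) (by simp) one_pos hd
  simp [slope_def_field] at h3
  linarith

/-- Values tending to the minimum force convergence to the minimizer. -/
theorem tendsto_minimizer (hf : ClassF f) {z : Plane} (hz : ∀ q, f z ≤ f q) {P : ℕ → Plane}
    (hP : Tendsto (fun k => f (P k)) atTop (𝓝 (f z))) : Tendsto P atTop (𝓝 z) := by
  rw [tendsto_nhds]
  intro V hV hzV
  have hK : IsCompact ({q : Plane | f q ≤ f (z + fun _ => 1)} \ V) :=
    (isCompact_sublevel hf _).diff hV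
  have hne : z + (fun _ => 1) ≠ z := by
    intro h
    have := congrFun h 0
    simp at this
  have h1 := lt_of_minimizer hf hz hne
  rcases (({q : Plane | f q ≤ f (z + fun _ => 1)} \ V)).eq_empty_or_nonempty with he | hn
  · filter_upwards [hP.eventually_le_const h1] with k hk
    by_contra hkV
    exact (he ▸ (⟨hk, hkV⟩ : P k ∈ {q : Plane | f q ≤ f (z + fun _ => 1)} \ V) : P k ∈ (∅ : Set _))
  · obtain ⟨y, hy, hmin⟩ := hK.exists_isMinOn hn hf.contDiff.continuous.continuousOn
    have h2 : f z < f y := lt_of_minimizer hf hz (by rintro rfl; exact hy.2 hzV)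
    filter_upwards [hP.eventually_le_const h1, hP.eventually_lt_const h2] with k hk hk'
    by_contra hkV
    exact absurd (hmin ⟨hk, hkV⟩) (not_le.2 hk')

/-! ### Area and width -/

theorem perm_three (σ : Equiv.Perm (Fin 3)) :
    (σ 0 = 0 ∧ σ 1 = 1 ∧ σ 2 = 2) ∨ (σ 0 = 1 ∧ σ 1 = 0 ∧ σ 2 = 2) ∨
    (σ 0 = 0 ∧ σ 1 = 2 ∧ σ 2 = 1) ∨ (σ 0 = 2 ∧ σ 1 = 0 ∧ σ 2 = 1) ∨
    (σ 0 = 1 ∧ σ 1 = 2 ∧ σ 2 = 0) ∨ (σ 0 = 2 ∧ σ 1 = 1 ∧ σ 2 = 0) := by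
  revert σ; decide

theorem area_eq_mul {S T : Triangle} (k : ℝ)
    (h : (S 1 0 - S 0 0) * (S 2 1 - S 0 1) - (S 2 0 - S 0 0) * (S 1 1 - S 0 1)
      = k * ((T 1 0 - T 0 0) * (T 2 1 - T 0 1) - (T 2 0 - T 0 0) * (T 1 1 - T 0 1))) :
    area S = |k| * area T := by
  rw [area, area, h, abs_mul, mul_div_assoc]

theorem area_comp_perm (T : Triangle) (σ : Equiv.Perm (Fin 3)) : area (T ∘ σ) = area T := by
  unfold area
  rw [div_left_inj' two_ne_zero, abs_eq_abs]
  rcases perm_three σ with h | h | h | h | h | h <;>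
    simp only [Function.comp, h.1, h.2.1, h.2.2] <;>
    first | exact Or.inl trivial | (left; ring1) | (right; ring1)

theorem width_comp_perm (T : Triangle) (σ : Equiv.Perm (Fin 3)) : width (T ∘ σ) = width T := by
  unfold width
  have h01 := abs_sub_comm (T 0 0) (T 1 0)
  have h12 := abs_sub_comm (T 1 0) (T 2 0)
  have h20 := abs_sub_comm (T 2 0) (T 0 0)
  rcases perm_three σ with h | h | h | h | h | h <;>
    simp only [Function.comp, h.1, h.2.1, h.2.2, h01, h12, h20] <;> ac_rfl

theorem flatness_comp_perm (f : Plane → ℝ) (c : Plane) (T : Triangle) (σ : Equiv.Perm (Fin 3)) :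
    flatness f c (T ∘ σ) = flatness f c T := by
  have h : inFrame f c (T ∘ σ) = inFrame f c T ∘ σ := rfl
  rw [flatness, flatness, h, area_comp_perm, width_comp_perm]

theorem area_reflect (T : Triangle) : area ![T 0, T 1, reflectPt T] = area T := by
  rw [area_eq_mul (T := T) (-1) (by simp [reflectPt, centroidBest]; ring)]
  norm_num

theorem area_inside (T : Triangle) : area ![T 0, T 1, insidePt T] = area T / 2 := by
  rw [area_eq_mul (T := T) (1 / 2) (by simp [insidePt, centroidBest]; ring)]
  norm_num
  ring

theorem area_outside (T : Triangle) : area ![T 0, T 1, outsidePt T] = area T / 2 := by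
  have h := area_inside ![T 0, T 1, reflectPt T]
  rw [area_reflect] at h
  rw [← h]
  rfl

theorem area_shrink (T : Triangle) : area (applyMove T Move.shrink) = area T / 4 := by
  rw [area_eq_mul (T := T) (1 / 4) (by simp [applyMove]; ring)]
  norm_num
  ring

theorem area_applyMove_pos {T : Triangle} (h : 0 < area T) (m : Move) :
    0 < area (applyMove T m) := by
  cases m
  · exact (area_reflect T).symm ▸ h
  · exact (area_outside T).symm ▸ half_pos h
  · exact (area_inside T).symm ▸ half_pos h
  · rw [area_shrink]; linarith

theorem area_pos_of_affineIndependent {T : Triangle} (h : AffineIndependent ℝ T) : 0 < area T := by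
  rw [affineIndependent_iff] at h
  have hw : ∀ a b : ℝ, a * (T 1 0 - T 0 0) + b * (T 2 0 - T 0 0) = 0 →
      a * (T 1 1 - T 0 1) + b * (T 2 1 - T 0 1) = 0 → a = 0 ∧ b = 0 := by
    intro a b h0 h1
    have h2 := h Finset.univ ![-(a + b), a, b] (by simp [Fin.sum_univ_three])
      (by
        ext i
        fin_cases i <;> simp [Fin.sum_univ_three] <;> linarith)
    exact ⟨h2 1 (Finset.mem_univ _), h2 2 (Finset.mem_univ _)⟩
  unfold area
  refine div_pos (abs_pos.2 fun h0 => ?_) two_pos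
  obtain ⟨h1, h2⟩ := hw (T 2 1 - T 0 1) (-(T 1 1 - T 0 1)) (by linarith) (by ring)
  obtain ⟨h3, h4⟩ := hw (T 2 0 - T 0 0) (-(T 1 0 - T 0 0)) (by ring) (by linarith)
  have h5 := hw 1 0 (by linarith) (by linarith)
  exact one_ne_zero h5.1

theorem IsRun.area_pos {f : Plane → ℝ} {p : ℕ → Triangle} (hp : IsRun f p) (k : ℕ) :
    0 < area (p k) := by
  induction k with
  | zero => exact area_pos_of_affineIndependent hp.nondegenerate
  | succ k ih =>
    obtain ⟨σ, hσ⟩ := hp.step k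
    rw [hσ, area_comp_perm]
    exact area_applyMove_pos ih _

/-! ### Decrease of the function values -/

variable {f : Plane → ℝ} {p : ℕ → Triangle}

/-- The sum of the function values at the vertices. -/
def valueSum (f : Plane → ℝ) (T : Triangle) : ℝ := f (T 0) + f (T 1) + f (T 2)

theorem valueSum_comp_perm (f : Plane → ℝ) (T : Triangle) (σ : Equiv.Perm (Fin 3)) :
    valueSum f (T ∘ σ) = valueSum f T := by
  rcases perm_three σ with h | h | h | h | h | h <;>
    simp only [valueSum, Function.comp, h.1, h.2.1, h.2.2] <;> ring

theorem centroidBest_ne {T : Triangle} (h : 0 < area T) : centroidBest T ≠ T 2 := by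
  intro h0
  have h1 := congrFun h0 0
  have h2 := congrFun h0 1
  simp [centroidBest] at h1 h2
  refine h.ne' ?_
  simp only [area, ← h1, ← h2]
  rw [div_eq_zero_iff, abs_eq_zero]
  left; ring

theorem value_outside_le (hf : ClassF f) {T : Triangle} (h01 : f (T 0) ≤ f (T 1))
    (hr : f (T 1) ≤ f (reflectPt T)) : f (outsidePt T) ≤ f (reflectPt T) := by
  have h1 := midpoint_le hf (T 0) (T 1)
  have h2 := midpoint_le hf (centroidBest T) (reflectPt T)
  have h3 : f (centroidBest T) ≤ (f (T 0) + f (T 1)) / 2 := h1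
  have h4 : f (outsidePt T) ≤ (f (centroidBest T) + f (reflectPt T)) / 2 := h2
  linarith

theorem value_inside_lt (hf : ClassF f) {T : Triangle} (h01 : f (T 0) ≤ f (T 1))
    (h12 : f (T 1) ≤ f (T 2)) (ha : 0 < area T) : f (insidePt T) < f (T 2) := by
  have h1 : f (centroidBest T) ≤ (f (T 0) + f (T 1)) / 2 := midpoint_le hf (T 0) (T 1)
  have h2 : f (insidePt T) < (f (centroidBest T) + f (T 2)) / 2 :=
    midpoint_lt hf (centroidBest_ne ha)
  linarith

/-- The three moves that occur, with the comparisons that lead to them. -/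
theorem chooseMove_cases (hf : ClassF f) {T : Triangle} (h01 : f (T 0) ≤ f (T 1))
    (h12 : f (T 1) ≤ f (T 2)) (ha : 0 < area T) :
    (chooseMove f T = Move.reflect ∧ f (reflectPt T) < f (T 1)) ∨
    (chooseMove f T = Move.outside ∧ f (T 1) ≤ f (reflectPt T) ∧ f (reflectPt T) < f (T 2) ∧
      f (outsidePt T) ≤ f (reflectPt T)) ∨
    (chooseMove f T = Move.inside ∧ f (T 1) ≤ f (reflectPt T) ∧ f (T 2) ≤ f (reflectPt T) ∧
      f (insidePt T) < f (T 2)) := by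
  unfold chooseMove
  by_cases h1 : f (reflectPt T) < f (T 1)
  · simp [h1]
  have h1' := not_lt.1 h1
  by_cases h2 : f (reflectPt T) < f (T 2)
  · simp [h1, h2, h1', value_outside_le hf h01 h1']
  · simp [h1, h2, h1', not_lt.1 h2, value_inside_lt hf h01 h12 ha]

/-- A contraction decreases the sum of the values by an amount that controls the range of the
values and the diameter. -/
theorem valueSum_contraction_le (hf : ClassF f) {R m : ℝ} (hm0 : 0 ≤ m)
    (hm : ∀ q ∈ Metric.closedBall (0 : Plane) R, ∀ v : Plane,
      m * ‖v‖ ^ 2 ≤ fderiv ℝ (fderiv ℝ f) q v v)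
    {T : Triangle} (hR : ∀ q, f q ≤ f (T 2) → ‖q‖ ≤ R)
    (h01 : f (T 0) ≤ f (T 1)) (h12 : f (T 1) ≤ f (T 2)) (ha : 0 < area T)
    (hT : IsContraction f T) :
    valueSum f (applyMove T (chooseMove f T)) ≤ valueSum f T - (f (T 2) - f (T 0)) / 4
      - m / 16 * ‖T 1 - T 0‖ ^ 2 - m / 8 * ‖T 2 - centroidBest T‖ ^ 2 := by
  have h1 : f (centroidBest T) ≤ (f (T 0) + f (T 1)) / 2 - m / 8 * ‖T 1 - T 0‖ ^ 2 :=
    midpoint_le_of_hessian hf hm (hR _ (by linarith)) (hR _ h12)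
  have h2 : 0 ≤ m / 8 * ‖T 1 - T 0‖ ^ 2 := by positivity
  have hc : ‖centroidBest T‖ ≤ R := hR _ (by linarith)
  rcases chooseMove_cases hf h01 h12 ha with ⟨h, -⟩ | ⟨h, -, h3, -⟩ | ⟨h, -⟩
  · exact absurd h hT
  · have h4 : f (outsidePt T) ≤ (f (centroidBest T) + f (reflectPt T)) / 2
        - m / 8 * ‖reflectPt T - centroidBest T‖ ^ 2 :=
      midpoint_le_of_hessian hf hm hc (hR _ h3.le)
    have h5 : reflectPt T - centroidBest T = -(T 2 - centroidBest T) := by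
      unfold reflectPt; module
    rw [h5, norm_neg] at h4
    rw [h]
    simp only [valueSum, applyMove, Matrix.cons_val_zero, Matrix.cons_val_one, Matrix.cons_val]
    linarith
  · have h4 : f (insidePt T) ≤ (f (centroidBest T) + f (T 2)) / 2
        - m / 8 * ‖T 2 - centroidBest T‖ ^ 2 :=
      midpoint_le_of_hessian hf hm hc (hR _ le_rfl)
    rw [h]
    simp only [valueSum, applyMove, Matrix.cons_val_zero, Matrix.cons_val_one, Matrix.cons_val]
    linarith

theorem value_applyMove_le (hf : ClassF f) {T : Triangle} (h01 : f (T 0) ≤ f (T 1))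
    (h12 : f (T 1) ≤ f (T 2)) (ha : 0 < area T) :
    ∃ N, applyMove T (chooseMove f T) = ![T 0, T 1, N] ∧ f N ≤ f (T 2) := by
  rcases chooseMove_cases hf h01 h12 ha with ⟨h, h3⟩ | ⟨h, -, h3, h4⟩ | ⟨h, -, -, h4⟩
  · exact ⟨_, by rw [h]; rfl, by linarith⟩
  · exact ⟨_, by rw [h]; rfl, by linarith⟩
  · exact ⟨_, by rw [h]; rfl, h4.le⟩

theorem IsRun.value_le_worst (hp : IsRun f p) (k : ℕ) (i : Fin 3) : f (p k i) ≤ f (p k 2) := by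
  have := hp.ordered k
  fin_cases i
  · exact this.1.trans this.2
  · exact this.2
  · exact le_rfl

theorem IsRun.value_le (hf : ClassF f) (hp : IsRun f p) (k : ℕ) (i : Fin 3) :
    f (p k i) ≤ f (p 0 2) := by
  refine (hp.value_le_worst k i).trans ?_
  induction k with
  | zero => exact le_rfl
  | succ k ih =>
    refine le_trans ?_ ih
    obtain ⟨σ, hσ⟩ := hp.step k
    obtain ⟨N, hN, hfN⟩ := value_applyMove_le hf (hp.ordered k).1 (hp.ordered k).2 (hp.area_pos k)
    rw [hσ, hN, Function.comp]
    generalize σ 2 = i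
    fin_cases i
    · exact hp.value_le_worst k 0
    · exact hp.value_le_worst k 1
    · exact hfN

theorem IsRun.antitone_valueSum (hf : ClassF f) (hp : IsRun f p) :
    Antitone fun k => valueSum f (p k) := by
  refine antitone_nat_of_succ_le fun k => ?_
  obtain ⟨σ, hσ⟩ := hp.step k
  obtain ⟨N, hN, hfN⟩ := value_applyMove_le hf (hp.ordered k).1 (hp.ordered k).2 (hp.area_pos k)
  rw [hσ, hN, valueSum_comp_perm]
  simp only [valueSum, Matrix.cons_val_zero, Matrix.cons_val_one, Matrix.cons_val]
  linarith

theorem IsRun.exists_tendsto_valueSum (hf : ClassF f) (hp : IsRun f p) :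
    ∃ s, Tendsto (fun k => valueSum f (p k)) atTop (𝓝 s) := by
  obtain ⟨z, hz⟩ := exists_minimizer hf
  refine ⟨_, tendsto_atTop_ciInf (hp.antitone_valueSum hf) ⟨3 * f z, ?_⟩⟩
  rintro _ ⟨k, rfl⟩
  simp only [valueSum]
  linarith [hz (p k 0), hz (p k 1), hz (p k 2)]

/-- Contractions happen at small triangles with almost equal values: the total decrease of
`valueSum` is finite. -/
theorem IsRun.eventually_contraction_small (hf : ClassF f) (hp : IsRun f p) {ε : ℝ} (hε : 0 < ε) :
    ∀ᶠ k in atTop, IsContraction f (p k) →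
      f (p k 2) - f (p k 0) < ε ∧ ∀ i j, ‖p k i - p k j‖ < ε := by
  obtain ⟨R, hR⟩ := (isBounded_sublevel hf (p 0 2)).subset_closedBall 0
  obtain ⟨m, hm0, hm⟩ := exists_hessian_lower_bound hf (isCompact_closedBall (0 : Plane) R)
  obtain ⟨s, hs⟩ := hp.exists_tendsto_valueSum hf
  have hd : Tendsto (fun k => valueSum f (p k) - valueSum f (p (k + 1))) atTop (𝓝 0) := by
    simpa using hs.sub (hs.comp (tendsto_add_atTop_nat 1))
  have hη : 0 < min (ε / 4) (m / 16 * (ε / 4) ^ 2) := by positivity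
  filter_upwards [hd.eventually_lt_const hη] with k hk hcon
  obtain ⟨hk1, hk2⟩ := lt_min_iff.1 hk
  obtain ⟨σ, hσ⟩ := hp.step k
  have h1 := valueSum_contraction_le hf hm0.le hm (T := p k)
    (fun q hq => by simpa using hR (le_trans hq (hp.value_le hf k 2)))
    (hp.ordered k).1 (hp.ordered k).2 (hp.area_pos k) hcon
  rw [hσ, valueSum_comp_perm] at hk1 hk2
  have h2 : 0 ≤ m / 16 * ‖p k 1 - p k 0‖ ^ 2 := by positivity
  have h3 : 0 ≤ m / 8 * ‖p k 2 - centroidBest (p k)‖ ^ 2 := by positivity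
  have h4 : 0 ≤ f (p k 2) - f (p k 0) := sub_nonneg.2 (hp.value_le_worst k 0)
  have h5 : 0 ≤ m / 16 * ‖p k 2 - centroidBest (p k)‖ ^ 2 := by positivity
  have h6 : ‖p k 1 - p k 0‖ < ε / 4 := by
    refine lt_of_pow_lt_pow_left₀ 2 (by positivity) ?_
    exact lt_of_mul_lt_mul_left (a := m / 16) (by linarith) (by positivity)
  have h7 : ‖p k 2 - centroidBest (p k)‖ < ε / 4 := by
    refine lt_of_pow_lt_pow_left₀ 2 (by positivity) ?_
    exact lt_of_mul_lt_mul_left (a := m / 16) (by linarith) (by positivity)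
  have h8 : ∀ i, ‖p k i - centroidBest (p k)‖ < ε / 2 := by
    have e0 : p k 0 - centroidBest (p k) = (-(1 / 2) : ℝ) • (p k 1 - p k 0) := by
      unfold centroidBest; module
    have e1 : p k 1 - centroidBest (p k) = (1 / 2 : ℝ) • (p k 1 - p k 0) := by
      unfold centroidBest; module
    intro i
    fin_cases i
    · show ‖p k 0 - _‖ < _
      rw [e0, norm_smul]; norm_num; linarith
    · show ‖p k 1 - _‖ < _
      rw [e1, norm_smul]; norm_num; linarith
    · show ‖p k 2 - _‖ < _
      linarith
  refine ⟨by linarith, fun i j => ?_⟩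
  rw [← sub_sub_sub_cancel_right _ _ (centroidBest (p k))]
  exact (norm_sub_le _ _).trans_lt (by linarith [h8 i, h8 j])

/-- If the run does not converge to the minimizer, then the values stay away from the minimum. -/
theorem IsRun.lt_limit (hf : ClassF f) {z : Plane} (hz : ∀ q, f z ≤ f q)
    (hnc : ¬ ConvergesTo p z) {s : ℝ} (hs : Tendsto (fun k => valueSum f (p k)) atTop (𝓝 s)) :
    3 * f z < s := by
  have h1 : 3 * f z ≤ s := by
    refine ge_of_tendsto' hs fun k => ?_
    simp only [valueSum]
    linarith [hz (p k 0), hz (p k 1), hz (p k 2)]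
  refine lt_of_le_of_ne h1 fun h => hnc fun i => tendsto_minimizer hf hz ?_
  have h2 : Tendsto (fun k => valueSum f (p k) - 2 * f z) atTop (𝓝 (f z)) := by
    have := hs.sub_const (2 * f z)
    rwa [← h, show 3 * f z - 2 * f z = f z by ring] at this
  refine tendsto_of_tendsto_of_tendsto_of_le_of_le tendsto_const_nhds h2 (fun k => hz _)
    fun k => ?_
  have h3 := hz (p k 0)
  have h4 := hz (p k 1)
  have h5 := hz (p k 2)
  fin_cases i <;> simp only [valueSum, Fin.zero_eta, Fin.mk_one, Fin.reduceFinMk] <;> linarith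

/-! ### Blow-up of a run along an ultrafilter -/

/-- A sequence of base points `c k` and widths `w k`, along which the run, watched from time `k` on
in the local frame at `c k`, is rescaled. It is assumed that the flatness does not exceed `1.01`
times its value at time `k` within fourteen moves. -/
structure BlowUp (f : Plane → ℝ) (p : ℕ → Triangle) (U : Ultrafilter ℕ) (c : ℕ → Plane)
    (w : ℕ → ℝ) : Prop where
  classF : ClassF f
  isRun : IsRun f p
  pos : ∀ᶠ k in U, 0 < w k
  tendsto_zero : Tendsto w U (𝓝 0)
  expansion : ∃ C : ℝ, ∀ ε > 0, ∃ δ > 0, ∀ᶠ k in U, ∀ q, ‖q - c k‖ < δ →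
    |f q - f (c k) - (frameCoord f (c k) q 1 + frameCoord f (c k) q 0 ^ 2 / 2)|
      ≤ ε * frameCoord f (c k) q 0 ^ 2 + C * frameCoord f (c k) q 1 ^ 2
  area_pos : ∀ᶠ k in U, 0 < area (inFrame f (c k) (p k))
  width_eq : ∀ k, w k = width (inFrame f (c k) (p k))
  fails : ∀ ℓ, 1 ≤ ℓ → ℓ ≤ 14 →
    ∀ᶠ k in U, flatness f (c k) (p (k + ℓ)) ≤ 1.01 * flatness f (c k) (p k)

/-- The points `P k` tend to the vertex `V`, when first coordinates are rescaled by `w k` and second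
coordinates by `w k ^ 2`. The second coordinate of the limit point is `V.2 - V.1 ^ 2 / 2`, as `V.2`
is the value of `y + x ^ 2 / 2` there. -/
structure LimitAt (f : Plane → ℝ) (U : Ultrafilter ℕ) (c : ℕ → Plane) (w : ℕ → ℝ)
    (P : ℕ → Plane) (V : Vertex) : Prop where
  sub : Tendsto (fun k => P k - c k) U (𝓝 0)
  fst : Tendsto (fun k => frameCoord f (c k) (P k) 0 / w k) U (𝓝 V.1)
  snd : Tendsto (fun k => frameCoord f (c k) (P k) 1 / w k ^ 2) U (𝓝 (V.2 - V.1 ^ 2 / 2))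

variable {f : Plane → ℝ} {p : ℕ → Triangle} {U : Ultrafilter ℕ} {c : ℕ → Plane} {w : ℕ → ℝ}

theorem frameCoord_comb (f : Plane → ℝ) (c : Plane) {α β γ : ℝ} (h : α + β + γ = 1)
    (A B C : Plane) : frameCoord f c (α • A + β • B + γ • C)
      = α • frameCoord f c A + β • frameCoord f c B + γ • frameCoord f c C := by
  have e : α • A + β • B + γ • C - c = α • (A - c) + β • (B - c) + γ • (C - c) := by
    have : c = (α + β + γ) • c := by rw [h, one_smul]
    conv_lhs => rw [this]
    module
  simp only [frameCoord, e, Matrix.mulVec_add, Matrix.mulVec_smul]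

theorem LimitAt.comb {A B C : ℕ → Plane} {a b d V : Vertex} {α β γ : ℝ} (h : α + β + γ = 1)
    (hA : LimitAt f U c w A a) (hB : LimitAt f U c w B b) (hC : LimitAt f U c w C d)
    (h1 : V.1 = α * a.1 + β * b.1 + γ * d.1)
    (h2 : V.2 - V.1 ^ 2 / 2
      = α * (a.2 - a.1 ^ 2 / 2) + β * (b.2 - b.1 ^ 2 / 2) + γ * (d.2 - d.1 ^ 2 / 2)) :
    LimitAt f U c w (fun k => α • A k + β • B k + γ • C k) V := by
  refine ⟨?_, ?_, ?_⟩
  · have h3 := ((hA.sub.const_smul α).add (hB.sub.const_smul β)).add (hC.sub.const_smul γ)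
    simp only [smul_zero, add_zero] at h3
    refine h3.congr fun k => ?_
    have : c k = (α + β + γ) • c k := by rw [h, one_smul]
    conv_rhs => rw [this]
    module
  · rw [h1]
    refine (((hA.fst.const_mul α).add (hB.fst.const_mul β)).add (hC.fst.const_mul γ)).congr
      fun k => ?_
    rw [frameCoord_comb f (c k) h]
    simp only [Pi.add_apply, Pi.smul_apply, smul_eq_mul]
    ring
  · rw [h2]
    refine (((hA.snd.const_mul α).add (hB.snd.const_mul β)).add (hC.snd.const_mul γ)).congr
      fun k => ?_
    rw [frameCoord_comb f (c k) h]
    simp only [Pi.add_apply, Pi.smul_apply, smul_eq_mul]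
    ring

theorem reflectPt_eq (T : Triangle) :
    reflectPt T = (1 : ℝ) • T 0 + (1 : ℝ) • T 1 + (-1 : ℝ) • T 2 := by
  unfold reflectPt centroidBest; module

theorem insidePt_eq (T : Triangle) :
    insidePt T = (1 / 4 : ℝ) • T 0 + (1 / 4 : ℝ) • T 1 + (1 / 2 : ℝ) • T 2 := by
  unfold insidePt centroidBest; module

theorem LimitAt.reflect {T : ℕ → Triangle} {A B C : Vertex}
    (hA : LimitAt f U c w (fun k => T k 0) A) (hB : LimitAt f U c w (fun k => T k 1) B)
    (hC : LimitAt f U c w (fun k => T k 2) C) :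
    LimitAt f U c w (fun k => reflectPt (T k)) (A.reflect B C) := by
  simp only [reflectPt_eq]
  refine hA.comb (by norm_num) hB hC ?_ ?_ <;> simp only [Vertex.reflect] <;> ring

theorem LimitAt.inside {T : ℕ → Triangle} {A B C : Vertex}
    (hA : LimitAt f U c w (fun k => T k 0) A) (hB : LimitAt f U c w (fun k => T k 1) B)
    (hC : LimitAt f U c w (fun k => T k 2) C) :
    LimitAt f U c w (fun k => insidePt (T k)) (A.inside B C) := by
  simp only [insidePt_eq]
  refine hA.comb (by norm_num) hB hC ?_ ?_ <;> simp only [Vertex.inside] <;> ring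

theorem LimitAt.outside {T : ℕ → Triangle} {A B C : Vertex}
    (hA : LimitAt f U c w (fun k => T k 0) A) (hB : LimitAt f U c w (fun k => T k 1) B)
    (hC : LimitAt f U c w (fun k => T k 2) C) :
    LimitAt f U c w (fun k => outsidePt (T k)) (A.outside B C) :=
  LimitAt.inside (T := fun k => ![T k 0, T k 1, reflectPt (T k)]) hA hB (hA.reflect hB hC)

/-- Function values, rescaled by `w ^ 2`, converge to those of `y + x ^ 2 / 2`. -/
theorem LimitAt.value (hb : BlowUp f p U c w) {P : ℕ → Plane} {V : Vertex}
    (h : LimitAt f U c w P V) : Tendsto (fun k => (f (P k) - f (c k)) / w k ^ 2) U (𝓝 V.2) := by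
  obtain ⟨C, hC⟩ := hb.expansion
  have hmain : Tendsto (fun k => frameCoord f (c k) (P k) 1 / w k ^ 2
      + (frameCoord f (c k) (P k) 0 / w k) ^ 2 / 2) U (𝓝 V.2) := by
    have := h.snd.add ((h.fst.pow 2).div_const 2)
    rwa [sub_add_cancel] at this
  suffices herr : Tendsto (fun k => (f (P k) - f (c k)) / w k ^ 2
      - (frameCoord f (c k) (P k) 1 / w k ^ 2
        + (frameCoord f (c k) (P k) 0 / w k) ^ 2 / 2)) U (𝓝 0) by
    simpa using herr.add hmain
  rw [Metric.tendsto_nhds]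
  intro η hη
  have hV : 0 < V.1 ^ 2 + 1 := by positivity
  obtain ⟨δ, hδ, hexp⟩ := hC (η / 2 / (V.1 ^ 2 + 1)) (by positivity)
  have h1 : ∀ᶠ k in U, ‖P k - c k‖ < δ := by
    have := h.sub.norm
    rw [norm_zero] at this
    exact this.eventually_lt_const hδ
  have h2 : ∀ᶠ k in U, (frameCoord f (c k) (P k) 0 / w k) ^ 2 < V.1 ^ 2 + 1 :=
    (h.fst.pow 2).eventually_lt_const (by linarith)
  have h3 : ∀ᶠ k in U, C * (frameCoord f (c k) (P k) 1 / w k ^ 2) ^ 2 * w k ^ 2 < η / 2 := by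
    have := ((h.snd.pow 2).const_mul C).mul (hb.tendsto_zero.pow 2)
    refine this.eventually_lt_const ?_
    simpa using half_pos hη
  filter_upwards [h1, h2, h3, hexp, hb.pos] with k h1 h2 h3 hexp hw
  have h4 := hexp (P k) h1
  set x := frameCoord f (c k) (P k) 0
  set y := frameCoord f (c k) (P k) 1
  have hw2 : 0 < w k ^ 2 := by positivity
  rw [Real.dist_eq, sub_zero]
  have e : (f (P k) - f (c k)) / w k ^ 2 - (y / w k ^ 2 + (x / w k) ^ 2 / 2)
      = (f (P k) - f (c k) - (y + x ^ 2 / 2)) / w k ^ 2 := by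
    field_simp
  rw [e, abs_div, abs_of_pos hw2]
  calc _ ≤ (η / 2 / (V.1 ^ 2 + 1) * x ^ 2 + C * y ^ 2) / w k ^ 2 := by gcongr
    _ = η / 2 / (V.1 ^ 2 + 1) * (x / w k) ^ 2 + C * (y / w k ^ 2) ^ 2 * w k ^ 2 := by
      field_simp
    _ < η / 2 / (V.1 ^ 2 + 1) * (V.1 ^ 2 + 1) + η / 2 := by
      refine add_lt_add_of_le_of_lt ?_ h3
      gcongr
    _ = η := by field_simp; ring

theorem LimitAt.le (hb : BlowUp f p U c w) {P Q : ℕ → Plane} {V W : Vertex}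
    (hP : LimitAt f U c w P V) (hQ : LimitAt f U c w Q W)
    (h : ∀ᶠ k in U, f (P k) ≤ f (Q k)) : V.2 ≤ W.2 := by
  refine le_of_tendsto_of_tendsto (hP.value hb) (hQ.value hb) ?_
  filter_upwards [h, hb.pos] with k hk hw
  gcongr

theorem LimitAt.tendsto_width (hb : BlowUp f p U c w) {T : ℕ → Triangle} {A B C : Vertex}
    (hA : LimitAt f U c w (fun k => T k 0) A) (hB : LimitAt f U c w (fun k => T k 1) B)
    (hC : LimitAt f U c w (fun k => T k 2) C) :
    Tendsto (fun k => width (inFrame f (c k) (T k)) / w k) U (𝓝 (spread A B C)) := by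
  have h := ((hA.fst.sub hB.fst).abs.max (hB.fst.sub hC.fst).abs).max (hC.fst.sub hA.fst).abs
  refine h.congr' ?_
  filter_upwards [hb.pos] with k hw
  have e : ∀ x y : ℝ, |x / w k - y / w k| = |x - y| / w k := fun x y => by
    rw [← sub_div, abs_div, abs_of_pos hw]
  simp only [e, width, inFrame, frameCoord, max_div_div_right hw.le]

/-- The triangles `T k` are relabellings of the triangles of the run `ℓ` moves after time `k`. They
are reached by `cnt` contractions, the last move is a reflection to `T k 2` if `r` holds, and the
limit is the triangle `A B C`. -/
structure Follows (f : Plane → ℝ) (p : ℕ → Triangle) (U : Ultrafilter ℕ) (c : ℕ → Plane)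
    (w : ℕ → ℝ) (ℓ cnt : ℕ) (r : Bool) (T : ℕ → Triangle) (A B C : Vertex) : Prop where
  perm : ∀ᶠ k in U, ∃ σ : Equiv.Perm (Fin 3), T k = p (k + ℓ) ∘ σ
  lim0 : LimitAt f U c w (fun k => T k 0) A
  lim1 : LimitAt f U c w (fun k => T k 1) B
  lim2 : LimitAt f U c w (fun k => T k 2) C
  spread_ne : spread A B C ≠ 0
  area_eq : ∀ᶠ k in U, area (inFrame f (c k) (T k)) * 2 ^ cnt = area (inFrame f (c k) (p k))
  last : r = true → ∀ᶠ k in U, f (T k 2) < max (f (T k 0)) (f (T k 1))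

/-- The limiting width is not too small: otherwise the flatness has increased. -/
theorem Follows.one_le (hb : BlowUp f p U c w) {ℓ cnt : ℕ} {r : Bool} {T : ℕ → Triangle}
    {A B C : Vertex} (h : Follows f p U c w ℓ cnt r T A B C) (h1 : 1 ≤ ℓ) (h14 : ℓ ≤ 14) :
    1 ≤ 1.01 * 2 ^ cnt * spread A B C ^ 3 := by
  have hlim := LimitAt.tendsto_width hb h.lim0 h.lim1 h.lim2
  have hs : 0 < spread A B C :=
    lt_of_le_of_ne (le_max_of_le_right (abs_nonneg _)) h.spread_ne.symm
  refine ge_of_tendsto ((hlim.pow 3).const_mul (1.01 * 2 ^ cnt)) ?_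
  filter_upwards [hlim.eventually_const_lt hs, h.perm, h.area_eq, hb.pos, hb.area_pos,
    hb.fails ℓ h1 h14] with k hW ⟨σ, hσ⟩ ha hw ha0 hfl
  rw [← flatness_comp_perm f (c k) (p (k + ℓ)) σ, ← hσ, flatness, flatness, ← hb.width_eq k,
    ← ha] at hfl
  rw [← ha] at ha0
  have hW' : 0 < width (inFrame f (c k) (T k)) := by
    have := mul_pos hW hw
    rwa [div_mul_cancel₀ _ hw.ne'] at this
  have ha' : 0 < area (inFrame f (c k) (T k)) := pos_of_mul_pos_left ha0 (by positivity)
  set a := area (inFrame f (c k) (T k))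
  set W := width (inFrame f (c k) (T k))
  rw [div_le_iff₀ (by positivity)] at hfl
  have e : 1.01 * (a * 2 ^ cnt / w k ^ 3) * W ^ 3 = a * (1.01 * 2 ^ cnt * (W / w k) ^ 3) := by
    field_simp
  rw [e] at hfl
  exact le_of_mul_le_mul_left (by linarith) ha'

theorem spread_eq_zero_iff {A B C : Vertex} : spread A B C = 0 ↔ A.1 = B.1 ∧ B.1 = C.1 := by
  constructor
  · intro h
    have h1 : |A.1 - B.1| ≤ 0 := h ▸ (le_max_of_le_left (le_max_left _ _))
    have h2 : |B.1 - C.1| ≤ 0 := h ▸ (le_max_of_le_left (le_max_right _ _))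
    exact ⟨sub_eq_zero.1 (abs_nonpos_iff.1 h1), sub_eq_zero.1 (abs_nonpos_iff.1 h2)⟩
  · rintro ⟨h1, h2⟩
    simp [spread, h1, h2]

theorem spread_inside_ne {A B C : Vertex} (h : spread A B C ≠ 0) :
    spread A B (A.inside B C) ≠ 0 := by
  rw [Ne, spread_eq_zero_iff] at h ⊢
  rintro ⟨h1, h2⟩
  simp only [Vertex.inside] at h2
  exact h ⟨h1, by linarith⟩

theorem area_inFrame_reflect (f : Plane → ℝ) (c : Plane) (T : Triangle) :
    area (inFrame f c ![T 0, T 1, reflectPt T]) = area (inFrame f c T) := by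
  rw [← area_reflect (inFrame f c T)]
  congr 1
  funext i
  fin_cases i
  · rfl
  · rfl
  · show frameCoord f c (reflectPt T) = reflectPt (inFrame f c T)
    rw [reflectPt_eq, reflectPt_eq, frameCoord_comb _ _ (by norm_num)]
    rfl

theorem area_inFrame_inside (f : Plane → ℝ) (c : Plane) (T : Triangle) :
    area (inFrame f c ![T 0, T 1, insidePt T]) = area (inFrame f c T) / 2 := by
  rw [← area_inside (inFrame f c T)]
  congr 1
  funext i
  fin_cases i
  · rfl
  · rfl
  · show frameCoord f c (insidePt T) = insidePt (inFrame f c T)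
    rw [insidePt_eq, insidePt_eq, frameCoord_comb _ _ (by norm_num)]
    rfl

theorem area_inFrame_outside (f : Plane → ℝ) (c : Plane) (T : Triangle) :
    area (inFrame f c ![T 0, T 1, outsidePt T]) = area (inFrame f c T) / 2 := by
  rw [← area_inFrame_reflect f c T]
  exact area_inFrame_inside f c ![T 0, T 1, reflectPt T]

/-- A relabelling that keeps the worst vertex in the last place. -/
theorem perm_fix_two {σ : Equiv.Perm (Fin 3)} (h : σ 2 = 2) :
    (σ 0 = 0 ∧ σ 1 = 1) ∨ (σ 0 = 1 ∧ σ 1 = 0) := by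
  revert σ; decide

theorem replace_comp {σ : Equiv.Perm (Fin 3)} (h : σ 2 = 2) (q : Triangle) (N : Plane) :
    ![(q ∘ σ) 0, (q ∘ σ) 1, N] = ![q 0, q 1, N] ∘ σ := by
  funext i
  rcases perm_fix_two h with h' | h' <;> fin_cases i <;> simp [h, h'.1, h'.2]

theorem centroidBest_comp {σ : Equiv.Perm (Fin 3)} (h : σ 2 = 2) (q : Triangle) :
    centroidBest (q ∘ σ) = centroidBest q := by
  unfold centroidBest
  rcases perm_fix_two h with h' | h' <;> simp only [Function.comp, h'.1, h'.2]
  rw [add_comm]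

theorem reflectPt_comp {σ : Equiv.Perm (Fin 3)} (h : σ 2 = 2) (q : Triangle) :
    reflectPt (q ∘ σ) = reflectPt q := by
  simp only [reflectPt, centroidBest_comp h, Function.comp, h]

theorem insidePt_comp {σ : Equiv.Perm (Fin 3)} (h : σ 2 = 2) (q : Triangle) :
    insidePt (q ∘ σ) = insidePt q := by
  simp only [insidePt, centroidBest_comp h, Function.comp, h]

theorem outsidePt_comp {σ : Equiv.Perm (Fin 3)} (h : σ 2 = 2) (q : Triangle) :
    outsidePt (q ∘ σ) = outsidePt q := by
  simp only [outsidePt, centroidBest_comp h, reflectPt_comp h]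

theorem max_value_comp {σ : Equiv.Perm (Fin 3)} (h : σ 2 = 2) (q : Triangle)
    (hq : f (q 0) ≤ f (q 1)) : max (f ((q ∘ σ) 0)) (f ((q ∘ σ) 1)) = f (q 1) := by
  rcases perm_fix_two h with h' | h' <;> simp only [Function.comp, h'.1, h'.2]
  · exact max_eq_right hq
  · exact max_eq_left hq

theorem IsRun.exists_perm_succ (hp : IsRun f p) {k : ℕ} {σ : Equiv.Perm (Fin 3)} (h : σ 2 = 2)
    {N : Plane} (hN : applyMove (p k) (chooseMove f (p k)) = ![p k 0, p k 1, N]) :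
    ∃ σ' : Equiv.Perm (Fin 3), ![(p k ∘ σ) 0, (p k ∘ σ) 1, N] = p (k + 1) ∘ σ' := by
  obtain ⟨τ, hτ⟩ := hp.step k
  refine ⟨σ.trans τ.symm, ?_⟩
  rw [replace_comp h, hτ, hN]
  funext i
  simp

/-- The last vertex is the worst one. -/
def LastIsWorst (p : ℕ → Triangle) (U : Ultrafilter ℕ) (ℓ : ℕ) (T : ℕ → Triangle) : Prop :=
  ∀ᶠ k in U, ∃ σ : Equiv.Perm (Fin 3), σ 2 = 2 ∧ T k = p (k + ℓ) ∘ σ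

section Moves

variable {ℓ cnt : ℕ} {r : Bool} {T : ℕ → Triangle} {A B C : Vertex}

theorem Follows.reflect (hb : BlowUp f p U c w) (h : Follows f p U c w ℓ cnt r T A B C)
    (hT : LastIsWorst p U ℓ T)
    (hm : ∀ᶠ k in U, chooseMove f (p (k + ℓ)) = Move.reflect ∧
      f (reflectPt (p (k + ℓ))) < f (p (k + ℓ) 1)) :
    Follows f p U c w (ℓ + 1) cnt true (fun k => ![T k 0, T k 1, reflectPt (T k)])
      A B (A.reflect B C) where
  perm := by
    filter_upwards [hT, hm] with k ⟨σ, hσ, hk⟩ hm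
    rw [hk, reflectPt_comp hσ]
    exact hb.isRun.exists_perm_succ hσ (by rw [hm.1]; rfl)
  lim0 := h.lim0
  lim1 := h.lim1
  lim2 := h.lim0.reflect h.lim1 h.lim2
  spread_ne := by rw [spread_reflect]; exact h.spread_ne
  area_eq := by
    filter_upwards [h.area_eq] with k hk
    rw [area_inFrame_reflect, hk]
  last := fun _ => by
    filter_upwards [hT, hm] with k ⟨σ, hσ, hk⟩ hm
    show f (reflectPt (T k)) < max (f (T k 0)) (f (T k 1))
    rw [hk, reflectPt_comp hσ, max_value_comp hσ _ (hb.isRun.ordered _).1]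
    exact hm.2

theorem Follows.inside (hb : BlowUp f p U c w) (h : Follows f p U c w ℓ cnt r T A B C)
    (hT : LastIsWorst p U ℓ T) (hm : ∀ᶠ k in U, chooseMove f (p (k + ℓ)) = Move.inside) :
    Follows f p U c w (ℓ + 1) (cnt + 1) false (fun k => ![T k 0, T k 1, insidePt (T k)])
      A B (A.inside B C) where
  perm := by
    filter_upwards [hT, hm] with k ⟨σ, hσ, hk⟩ hm
    rw [hk, insidePt_comp hσ]
    exact hb.isRun.exists_perm_succ hσ (by rw [hm]; rfl)
  lim0 := h.lim0
  lim1 := h.lim1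
  lim2 := h.lim0.inside h.lim1 h.lim2
  spread_ne := spread_inside_ne h.spread_ne
  area_eq := by
    filter_upwards [h.area_eq] with k hk
    rw [area_inFrame_inside, ← hk]
    ring
  last := nofun

theorem Follows.outside (hb : BlowUp f p U c w) (h : Follows f p U c w ℓ cnt r T A B C)
    (hT : LastIsWorst p U ℓ T) (hm : ∀ᶠ k in U, chooseMove f (p (k + ℓ)) = Move.outside) :
    Follows f p U c w (ℓ + 1) (cnt + 1) false (fun k => ![T k 0, T k 1, outsidePt (T k)])
      A B (A.outside B C) where
  perm := by
    filter_upwards [hT, hm] with k ⟨σ, hσ, hk⟩ hm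
    rw [hk, outsidePt_comp hσ]
    exact hb.isRun.exists_perm_succ hσ (by rw [hm]; rfl)
  lim0 := h.lim0
  lim1 := h.lim1
  lim2 := h.lim0.outside h.lim1 h.lim2
  spread_ne := spread_inside_ne (by rw [spread_reflect]; exact h.spread_ne)
  area_eq := by
    filter_upwards [h.area_eq] with k hk
    rw [area_inFrame_outside, ← hk]
    ring
  last := nofun

theorem Follows.rotate (h : Follows f p U c w ℓ cnt r T A B C) :
    Follows f p U c w ℓ cnt false (fun k => T k ∘ finRotate 3) B C A where
  perm := by
    filter_upwards [h.perm] with k ⟨σ, hk⟩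
    exact ⟨(finRotate 3).trans σ, by rw [hk]; rfl⟩
  lim0 := h.lim1
  lim1 := h.lim2
  lim2 := h.lim0
  spread_ne := by
    have := h.spread_ne
    rw [Ne, spread_eq_zero_iff] at this ⊢
    rintro ⟨h1, h2⟩
    exact this ⟨by rw [h1, h2], h1⟩
  area_eq := by
    filter_upwards [h.area_eq] with k hk
    have e : inFrame f (c k) (T k ∘ finRotate 3) = inFrame f (c k) (T k) ∘ finRotate 3 := rfl
    rw [e, area_comp_perm, hk]
  last := nofun

theorem Follows.le_worst (hb : BlowUp f p U c w) (h : Follows f p U c w ℓ cnt r T A B C)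
    (hT : LastIsWorst p U ℓ T) : A.2 ≤ C.2 ∧ B.2 ≤ C.2 := by
  have hle : ∀ i, ∀ᶠ k in U, f (T k i) ≤ f (T k 2) := fun i => by
    filter_upwards [hT] with k ⟨σ, hσ, hk⟩
    rw [hk, Function.comp, Function.comp, hσ]
    exact hb.isRun.value_le_worst _ _
  exact ⟨h.lim0.le hb h.lim2 (hle 0), h.lim1.le hb h.lim2 (hle 1)⟩

/-- A contraction in the limit. -/
theorem Follows.contraction (hb : BlowUp f p U c w) (h : Follows f p U c w ℓ cnt r T A B C)
    (hT : LastIsWorst p U ℓ T) (hm : ∀ᶠ k in U, IsContraction f (p (k + ℓ))) :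
    max A.2 B.2 ≤ (A.reflect B C).2 ∧
    (((A.reflect B C).2 ≤ C.2 ∧ Follows f p U c w (ℓ + 1) (cnt + 1) false
        (fun k => ![T k 0, T k 1, outsidePt (T k)]) A B (A.outside B C)) ∨
      (C.2 ≤ (A.reflect B C).2 ∧ Follows f p U c w (ℓ + 1) (cnt + 1) false
        (fun k => ![T k 0, T k 1, insidePt (T k)]) A B (A.inside B C))) := by
  have hR := h.lim0.reflect h.lim1 h.lim2
  have hcases : ∀ᶠ k in U, f (p (k + ℓ) 1) ≤ f (reflectPt (p (k + ℓ))) ∧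
      ((chooseMove f (p (k + ℓ)) = Move.outside ∧ f (reflectPt (p (k + ℓ))) ≤ f (p (k + ℓ) 2)) ∨
      (chooseMove f (p (k + ℓ)) = Move.inside ∧ f (p (k + ℓ) 2) ≤ f (reflectPt (p (k + ℓ))))) := by
    filter_upwards [hm] with k hk
    have ho := hb.isRun.ordered (k + ℓ)
    rcases chooseMove_cases hb.classF ho.1 ho.2 (hb.isRun.area_pos _) with
      ⟨h1, -⟩ | ⟨h1, h2, h3, -⟩ | ⟨h1, h2, h3, -⟩
    · exact absurd h1 hk
    · exact ⟨h2, Or.inl ⟨h1, h3.le⟩⟩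
    · exact ⟨h2, Or.inr ⟨h1, h3⟩⟩
  obtain ⟨h1, h2⟩ := eventually_and.1 hcases
  have hmax : ∀ᶠ k in U, max (f (T k 0)) (f (T k 1)) ≤ f (reflectPt (T k)) := by
    filter_upwards [h1, hT] with k h1 ⟨σ, hσ, hk⟩
    rw [hk, reflectPt_comp hσ, max_value_comp hσ _ (hb.isRun.ordered _).1]
    exact h1
  refine ⟨max_le (h.lim0.le hb hR (hmax.mono fun k hk => (le_max_left _ _).trans hk))
    (h.lim1.le hb hR (hmax.mono fun k hk => (le_max_right _ _).trans hk)), ?_⟩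
  rcases Ultrafilter.eventually_or.1 h2 with h2 | h2
  · obtain ⟨h3, h4⟩ := eventually_and.1 h2
    refine Or.inl ⟨hR.le hb h.lim2 ?_, h.outside hb hT h3⟩
    filter_upwards [h4, hT] with k h4 ⟨σ, hσ, hk⟩
    rw [hk, reflectPt_comp hσ, Function.comp, hσ]
    exact h4
  · obtain ⟨h3, h4⟩ := eventually_and.1 h2
    refine Or.inr ⟨h.lim2.le hb hR ?_, h.inside hb hT h3⟩
    filter_upwards [h4, hT] with k h4 ⟨σ, hσ, hk⟩
    rw [hk, reflectPt_comp hσ, Function.comp, hσ]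
    exact h4

/-- A move in the limit. -/
theorem Follows.step (hb : BlowUp f p U c w) {n : ℕ}
    (ih : ∀ {cnt : ℕ} {r : Bool} {T : ℕ → Triangle} {A B C : Vertex},
      Follows f p U c w (ℓ + 1) cnt r T A B C → Persists n cnt r A B C)
    (h : Follows f p U c w ℓ cnt r T A B C) (hT : LastIsWorst p U ℓ T) :
    Step (Persists n) cnt A B C := by
  obtain ⟨h1, h2⟩ := h.le_worst hb hT
  refine ⟨h1, h2, ?_⟩
  rcases Ultrafilter.em U (fun k => IsContraction f (p (k + ℓ))) with hm | hm
  · obtain ⟨h3, ⟨h4, h5⟩ | ⟨h4, h5⟩⟩ := h.contraction hb hT hm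
    · exact Or.inr (Or.inl ⟨h3, h4, ih h5⟩)
    · exact Or.inr (Or.inr ⟨h3, h4, ih h5⟩)
  · have hm' : ∀ᶠ k in U, chooseMove f (p (k + ℓ)) = Move.reflect ∧
        f (reflectPt (p (k + ℓ))) < f (p (k + ℓ) 1) := by
      filter_upwards [hm] with k hk
      have ho := hb.isRun.ordered (k + ℓ)
      have hk' := not_not.1 hk
      rcases chooseMove_cases hb.classF ho.1 ho.2 (hb.isRun.area_pos _) with
        h1 | ⟨h1, -⟩ | ⟨h1, -⟩
      · exact h1
      · rw [h1] at hk'; cases hk'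
      · rw [h1] at hk'; cases hk'
    have h3 := h.reflect hb hT hm'
    refine Or.inl ⟨?_, ih h3⟩
    have h4 : ∀ᶠ k in U, f (reflectPt (T k)) ≤ f (T k 0) ∨ f (reflectPt (T k)) ≤ f (T k 1) := by
      filter_upwards [h3.last rfl] with k hk
      exact le_max_iff.1 hk.le
    rw [le_max_iff]
    exact (Ultrafilter.eventually_or.1 h4).imp (h3.lim2.le hb h.lim0) (h3.lim2.le hb h.lim1)

/-- Limits of runs along which the flatness fails to increase persist in the limiting dynamics. -/
theorem Follows.persists (hb : BlowUp f p U c w) {n : ℕ} (hℓ : 1 ≤ ℓ) (hn : ℓ + n ≤ 14)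
    (h : Follows f p U c w ℓ cnt r T A B C) : Persists n cnt r A B C := by
  induction n generalizing ℓ cnt r T A B C with
  | zero => exact h.one_le hb hℓ (by omega)
  | succ n ih =>
    refine ⟨h.one_le hb hℓ (by omega), ?_⟩
    have hstep : ∀ {cnt : ℕ} {r : Bool} {T : ℕ → Triangle} {A B C : Vertex},
        Follows f p U c w (ℓ + 1) cnt r T A B C → Persists n cnt r A B C :=
      fun h => ih (by omega) (by omega) h
    have hworst : ∀ᶠ k in U, (∃ σ : Equiv.Perm (Fin 3), σ 2 = 2 ∧ T k = p (k + ℓ) ∘ σ) ∨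
        (∃ σ : Equiv.Perm (Fin 3), σ 2 = 2 ∧ T k ∘ finRotate 3 = p (k + ℓ) ∘ σ) ∨
        (∃ σ : Equiv.Perm (Fin 3), σ 2 = 2 ∧
          (T k ∘ finRotate 3) ∘ finRotate 3 = p (k + ℓ) ∘ σ) := by
      filter_upwards [h.perm] with k ⟨σ, hk⟩
      have h3 : σ 2 = 2 ∨ (finRotate 3).trans σ 2 = 2 ∨
          (finRotate 3).trans ((finRotate 3).trans σ) 2 = 2 := by
        clear hk
        revert σ; decide
      rcases h3 with h3 | h3 | h3
      · exact Or.inl ⟨σ, h3, hk⟩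
      · exact Or.inr (Or.inl ⟨_, h3, by rw [hk]; rfl⟩)
      · exact Or.inr (Or.inr ⟨_, h3, by rw [hk]; rfl⟩)
    rcases Ultrafilter.eventually_or.1 hworst with hw | hw
    · refine Or.inl ⟨?_, h.step hb hstep hw⟩
      -- The result of a reflection is strictly better than another vertex.
      by_contra hr
      have hr' : r = true := by simpa using hr
      obtain ⟨k, ⟨σ, hσ, hk⟩, hlt⟩ := (hw.and (h.last hr')).exists
      rw [hk, max_value_comp hσ _ (hb.isRun.ordered _).1, Function.comp, hσ] at hlt
      exact absurd hlt (not_lt.2 (hb.isRun.ordered _).2)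
    rcases Ultrafilter.eventually_or.1 hw with hw | hw
    · exact Or.inr (Or.inl (h.rotate.step hb hstep hw))
    · exact Or.inr (Or.inr (h.rotate.rotate.step hb hstep hw))

/-- A run that contracts at time `k` cannot fail to increase the flatness. -/
theorem BlowUp.false_of_contraction (hb : BlowUp f p U c w)
    (hcon : ∀ᶠ k in U, IsContraction f (p k))
    (hA : LimitAt f U c w (fun k => p k 0) A) (hB : LimitAt f U c w (fun k => p k 1) B)
    (hC : LimitAt f U c w (fun k => p k 2) C) : False := by
  have hs : spread A B C = 1 := by
    refine tendsto_nhds_unique (LimitAt.tendsto_width hb hA hB hC) ?_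
    refine tendsto_const_nhds.congr' ?_
    filter_upwards [hb.pos] with k hk
    rw [← hb.width_eq k, div_self hk.ne']
  have hT : LastIsWorst p U 0 p := Eventually.of_forall fun k => ⟨1, rfl, rfl⟩
  have h : Follows f p U c w 0 0 false p A B C :=
    { perm := Eventually.of_forall fun k => ⟨1, rfl⟩
      lim0 := hA
      lim1 := hB
      lim2 := hC
      spread_ne := by rw [hs]; exact one_ne_zero
      area_eq := Eventually.of_forall fun k => by rw [pow_zero, mul_one]
      last := nofun }
  obtain ⟨h1, h2⟩ := h.le_worst hb hT
  obtain ⟨h3, h4⟩ := h.contraction hb hT hcon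
  refine not_persists_contraction hs h1 h2 h3 (h4.imp ?_ ?_) <;>
    exact fun h => ⟨h.1, h.2.persists hb le_rfl (by norm_num)⟩

end Moves

/-! ### Existence of the blow-up -/

/-- At a contraction, heights in the frame based at the midpoint of two vertices are bounded by the
square of the width. The hypotheses `h01`, `h12`, `hr` say that the values are ordered and that the
reflection point is not accepted; they make the heights differ by no more than the curvature
terms. -/
theorem height_le {C H w xr yr vr : ℝ} {x y v : Fin 3 → ℝ} (hC : 0 ≤ C) (hCH : 72 * C * H ≤ 1)
    (hH : ∀ i, |y i| ≤ H) (hx : ∀ i, |x i| ≤ w) {l r : Fin 3} (hlr : y l + y r = 0)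
    (hv : ∀ i, |v i - (y i + x i ^ 2 / 2)| ≤ 1 * x i ^ 2 + C * y i ^ 2)
    (hvr : |vr - (yr + xr ^ 2 / 2)| ≤ 1 * xr ^ 2 + C * yr ^ 2)
    (hxr : xr = x 0 + x 1 - x 2) (hyr : yr = y 0 + y 1 - y 2)
    (h01 : v 0 ≤ v 1) (h12 : v 1 ≤ v 2) (hr : v 1 ≤ vr) (i : Fin 3) : |y i| ≤ 108 * w ^ 2 := by
  obtain ⟨j, hj⟩ := Finite.exists_max fun i => |y i|
  refine (hj i).trans ?_
  have hw : 0 ≤ w := (abs_nonneg _).trans (hx 0)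
  have hx2 : ∀ i, x i ^ 2 ≤ w ^ 2 := fun i => sq_le_sq.2 ((hx i).trans (le_abs_self _))
  have hy2 : ∀ i, C * y i ^ 2 ≤ C * |y j| ^ 2 := fun i =>
    mul_le_mul_of_nonneg_left (by rw [sq_abs]; exact sq_le_sq.2 (hj i)) hC
  have hxr2 : xr ^ 2 ≤ (3 * w) ^ 2 := by
    refine sq_le_sq.2 (le_trans ?_ (le_abs_self _))
    have h0 := abs_le.1 (hx 0)
    have h1 := abs_le.1 (hx 1)
    have h2 := abs_le.1 (hx 2)
    rw [hxr, abs_le]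
    constructor <;> linarith
  have hyr2 : C * yr ^ 2 ≤ C * (3 * |y j|) ^ 2 := by
    refine mul_le_mul_of_nonneg_left (sq_le_sq.2 (le_trans ?_ (le_abs_self _))) hC
    have h0 := abs_le.1 (hj 0)
    have h1 := abs_le.1 (hj 1)
    have h2 := abs_le.1 (hj 2)
    rw [hyr, abs_le]
    constructor <;> linarith
  have hy0 := hy2 j
  have hCj : 0 ≤ C * |y j| ^ 2 := by positivity
  obtain ⟨E, hE⟩ : ∃ E, E = 27 / 2 * w ^ 2 + 9 * (C * |y j| ^ 2) := ⟨_, rfl⟩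
  have e : ∀ i, v i ≤ y i + E ∧ y i ≤ v i + E := fun i => by
    have h1 := abs_le.1 (hv i)
    have h2 := hx2 i
    have h3 := hy2 i
    have h4 := sq_nonneg (x i)
    constructor <;> linarith
  have er : vr ≤ yr + E := by
    have h1 := abs_le.1 hvr
    linarith
  have h4 : ∀ i k, y i - y k ≤ 4 * E := by
    have h0 := e 0
    have h1 := e 1
    have h2 := e 2
    have h3 := sq_nonneg w
    intro i k
    fin_cases i <;> fin_cases k <;> simp only [Fin.zero_eta, Fin.mk_one, Fin.reduceFinMk] <;>
      linarith
  have h5 : |y j| ≤ 4 * E := by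
    rw [abs_le]
    constructor <;> linarith [h4 j l, h4 j r, h4 l j, h4 r j]
  have h6 : C * |y j| ^ 2 ≤ |y j| / 72 := by
    have : C * |y j| ≤ C * H := mul_le_mul_of_nonneg_left (hH j) hC
    nlinarith [abs_nonneg (y j)]
  linarith

theorem area_inFrame_pos {f : Plane → ℝ} {c : Plane} {T : Triangle}
    (hc : 0 < (frameMatrix f c).det) (hT : 0 < area T) : 0 < area (inFrame f c T) := by
  have e : area (inFrame f c T) = |((frameMatrix f c)⁻¹).det| * area T := by
    rw [area, area, ← mul_div_assoc, ← abs_mul]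
    simp only [inFrame, Matrix.mulVec, dotProduct, Fin.sum_univ_two, Matrix.det_fin_two,
      Pi.sub_apply]
    congr 2
    ring
  rw [e]
  refine mul_pos (abs_pos.2 ?_) hT
  rw [Matrix.det_nonsing_inv, Ring.inverse_eq_inv']
  exact inv_ne_zero hc.ne'

theorem abs_sub_le_width (T : Triangle) (i j : Fin 3) : |T i 0 - T j 0| ≤ width T := by
  have h1 : |T 0 0 - T 1 0| ≤ width T := le_max_of_le_left (le_max_left _ _)
  have h2 : |T 1 0 - T 2 0| ≤ width T := le_max_of_le_left (le_max_right _ _)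
  have h3 : |T 2 0 - T 0 0| ≤ width T := le_max_right _ _
  have h0 : 0 ≤ width T := (abs_nonneg _).trans h1
  have h1' := abs_sub_comm (T 0 0) (T 1 0) ▸ h1
  have h2' := abs_sub_comm (T 1 0) (T 2 0) ▸ h2
  have h3' := abs_sub_comm (T 2 0) (T 0 0) ▸ h3
  fin_cases i <;> fin_cases j <;> simp [*]

theorem frameCoord_add_eq_zero (f : Plane → ℝ) {c P Q : Plane} (h : c = midpoint ℝ P Q) :
    frameCoord f c P + frameCoord f c Q = 0 := by
  have e : (P - c) + (Q - c) = 0 := by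
    rw [h, midpoint_eq_smul_add, invOf_eq_inv]
    module
  rw [frameCoord, frameCoord, ← Matrix.mulVec_add, e, Matrix.mulVec_zero]

/-- In a frame based at the midpoint of two vertices, first coordinates are bounded by the width. -/
theorem abs_frameCoord_le_width (f : Plane → ℝ) {c : Plane} {T : Triangle} {l r : Fin 3}
    (h : c = midpoint ℝ (T l) (T r)) (i : Fin 3) :
    |frameCoord f c (T i) 0| ≤ width (inFrame f c T) := by
  have h1 := abs_le.1 (abs_sub_le_width (inFrame f c T) i l)
  have h2 := abs_le.1 (abs_sub_le_width (inFrame f c T) i r)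
  have h3 := congrFun (frameCoord_add_eq_zero f h) 0
  simp only [Pi.add_apply, Pi.zero_apply] at h3
  change -_ ≤ frameCoord f c (T i) 0 - frameCoord f c (T l) 0 ∧ _ at h1
  change -_ ≤ frameCoord f c (T i) 0 - frameCoord f c (T r) 0 ∧ _ at h2
  have h1' : frameCoord f c (T i) 0 - frameCoord f c (T l) 0 ≤ _ := h1.2
  have h2' : frameCoord f c (T i) 0 - frameCoord f c (T r) 0 ≤ _ := h2.2
  rw [abs_le]
  constructor <;> linarith [h1.1, h2.1]

theorem exists_tendsto_of_bounded {U : Ultrafilter ℕ} {g : ℕ → ℝ} {M : ℝ}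
    (h : ∀ᶠ k in U, |g k| ≤ M) : ∃ a, Tendsto g U (𝓝 a) := by
  obtain ⟨a, -, ha⟩ := (isCompact_Icc (a := -M) (b := M)).ultrafilter_le_nhds (U.map g)
    (le_principal_iff.2 (Ultrafilter.mem_map.2 (h.mono fun k hk => abs_le.1 hk)))
  exact ⟨a, ha⟩

variable {f : Plane → ℝ} {p : ℕ → Triangle} {U : Ultrafilter ℕ} {c : ℕ → Plane}

/-- Along an ultrafilter of contractions, the triangles of a run that does not converge to the
minimizer shrink to a noncritical point. -/
theorem exists_limit_point (hf : ClassF f) (hp : IsRun f p)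
    (hnc : ¬ ∃ z, (∀ q, f z ≤ f q) ∧ ConvergesTo p z) (hU : (U : Filter ℕ) ≤ atTop)
    (hcon : ∀ᶠ k in U, IsContraction f (p k)) :
    ∃ b, fderiv ℝ f b ≠ 0 ∧ ∀ i, Tendsto (fun k => p k i) U (𝓝 b) := by
  obtain ⟨s, hs⟩ := hp.exists_tendsto_valueSum hf
  obtain ⟨z, hz⟩ := exists_minimizer hf
  have hzs : 3 * f z < s := IsRun.lt_limit hf hz (fun h => hnc ⟨z, hz, h⟩) hs
  have hsmall : ∀ ε > 0, ∀ᶠ k in U, ∀ i j, ‖p k i - p k j‖ < ε := fun ε hε => by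
    filter_upwards [hU (hp.eventually_contraction_small hf hε), hcon] with k h1 h2
    exact (h1 h2).2
  obtain ⟨b, -, hb⟩ := (isCompact_sublevel hf (p 0 2)).ultrafilter_le_nhds
    (U.map fun k => p k 0) (le_principal_iff.2
      (Ultrafilter.mem_map.2 (Eventually.of_forall fun k => IsRun.value_le hf hp k 0)))
  have hb0 : Tendsto (fun k => p k 0) U (𝓝 b) := hb
  have hbi : ∀ i, Tendsto (fun k => p k i) U (𝓝 b) := fun i => by
    have h1 : Tendsto (fun k => p k i - p k 0) U (𝓝 0) := by
      rw [Metric.tendsto_nhds]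
      intro ε hε
      filter_upwards [hsmall ε hε] with k hk
      simpa using hk i 0
    simpa using h1.add hb0
  refine ⟨b, fderiv_ne_zero (z := z) hf ?_, hbi⟩
  have hval : ∀ i, Tendsto (fun k => f (p k i)) U (𝓝 (f b)) := fun i =>
    (hf.contDiff.continuous.tendsto b).comp (hbi i)
  have hsum : Tendsto (fun k => valueSum f (p k)) U (𝓝 (f b + f b + f b)) :=
    ((hval 0).add (hval 1)).add (hval 2)
  have := tendsto_nhds_unique hsum (hs.mono_left hU)
  linarith

/-- Along an ultrafilter of contractions, the flatness increases within fourteen moves. -/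
theorem not_fails_along_contractions (hf : ClassF f) (hp : IsRun f p)
    (hnc : ¬ ∃ z, (∀ q, f z ≤ f q) ∧ ConvergesTo p z) (hU : (U : Filter ℕ) ≤ atTop)
    (hcon : ∀ᶠ k in U, IsContraction f (p k))
    (hc : ∀ᶠ k in U, ∃ l r, c k = midpoint ℝ (p k l) (p k r))
    (hfail : ∀ ℓ, 1 ≤ ℓ → ℓ ≤ 14 →
      ∀ᶠ k in U, flatness f (c k) (p (k + ℓ)) ≤ 1.01 * flatness f (c k) (p k)) : False := by
  obtain ⟨b, hb, hpb⟩ := exists_limit_point hf hp hnc hU hcon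
  have hcb : Tendsto c U (𝓝 b) := by
    -- Along the ultrafilter, the pair of vertices with midpoint `c k` does not depend on `k`.
    have h1 : ∀ᶠ k in U, ∃ l, ∃ r, c k = midpoint ℝ (p k l) (p k r) := hc
    obtain ⟨l, hl⟩ := (Ultrafilter.eventually_exists_iff).1 h1
    obtain ⟨r, hr⟩ := (Ultrafilter.eventually_exists_iff).1 hl
    have h2 := ((hpb l).add (hpb r)).const_smul (⅟2 : ℝ)
    rw [← midpoint_eq_smul_add, midpoint_self] at h2
    refine h2.congr' ?_
    filter_upwards [hr] with k hk
    rw [hk, midpoint_eq_smul_add]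
  have hsub : ∀ i, Tendsto (fun k => p k i - c k) U (𝓝 0) := fun i => by
    simpa using (hpb i).sub hcb
  obtain ⟨C, hC, hfr, hexp⟩ := frame_expansion hf hb
  have hfr' := hcb.eventually hfr
  have hexp' : ∀ ε > 0, ∃ δ > 0, ∀ᶠ k in U, ∀ q, ‖q - c k‖ < δ →
      |f q - f (c k) - (frameCoord f (c k) q 1 + frameCoord f (c k) q 0 ^ 2 / 2)|
        ≤ ε * frameCoord f (c k) q 0 ^ 2 + C * frameCoord f (c k) q 1 ^ 2 := fun ε hε => by
    obtain ⟨δ, hδ, h⟩ := hexp ε hε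
    exact ⟨δ, hδ, hcb.eventually h⟩
  have hcoord : ∀ i j, Tendsto (fun k => frameCoord f (c k) (p k i) j) U (𝓝 0) := fun i j => by
    have h1 := (hsub i).norm.const_mul C
    rw [norm_zero, mul_zero] at h1
    refine squeeze_zero_norm' ?_ h1
    filter_upwards [hfr'] with k hk
    exact hk.2 _ _
  set w : ℕ → ℝ := fun k => width (inFrame f (c k) (p k)) with hw
  have hw0 : Tendsto w U (𝓝 0) := by
    have h := ((((hcoord 0 0).sub (hcoord 1 0)).abs.max ((hcoord 1 0).sub (hcoord 2 0)).abs)).max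
      ((hcoord 2 0).sub (hcoord 0 0)).abs
    simp only [sub_self, abs_zero, max_self] at h
    exact h
  have hX : ∀ᶠ k in U, ∀ i, |frameCoord f (c k) (p k i) 0| ≤ w k := by
    filter_upwards [hc] with k ⟨l, r, hk⟩ i
    exact abs_frameCoord_le_width f hk i
  have hY : ∀ᶠ k in U, ∀ i, |frameCoord f (c k) (p k i) 1| ≤ 108 * w k ^ 2 := by
    obtain ⟨δ, hδ, hδ'⟩ := hexp' 1 one_pos
    have hr : Tendsto (fun k => reflectPt (p k) - c k) U (𝓝 0) := by
      have := ((hpb 0).add (hpb 1)).sub (hpb 2)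
      have := this.sub hcb
      simp only [add_sub_cancel_right, sub_self] at this
      refine this.congr fun k => ?_
      rw [reflectPt_eq]
      module
    have hnear : ∀ {g : ℕ → Plane}, Tendsto g U (𝓝 0) → ∀ᶠ k in U, ‖g k‖ < δ := fun hg => by
      have := hg.norm
      rw [norm_zero] at this
      exact this.eventually_lt_const hδ
    have hH : ∀ᶠ k in U, ∀ i, |frameCoord f (c k) (p k i) 1| ≤ 1 / (72 * C) :=
      eventually_all.2 fun i => by
        have := (hcoord i 1).abs
        rw [abs_zero] at this
        exact this.eventually_le_const (by positivity)
    filter_upwards [hc, hcon, hX, hH, hδ', eventually_all.2 fun i => hnear (hsub i), hnear hr]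
      with k ⟨l, r, hk⟩ hcon hX hH hδ' hi hr
    have ho := hp.ordered k
    have hnot : f (p k 1) ≤ f (reflectPt (p k)) := by
      by_contra h
      exact hcon (if_pos (not_le.1 h))
    have hrc : ∀ j, frameCoord f (c k) (reflectPt (p k)) j = frameCoord f (c k) (p k 0) j
        + frameCoord f (c k) (p k 1) j - frameCoord f (c k) (p k 2) j := fun j => by
      rw [reflectPt_eq, frameCoord_comb _ _ (by norm_num)]
      simp only [Pi.add_apply, Pi.smul_apply, smul_eq_mul]
      ring
    exact height_le (v := fun i => f (p k i) - f (c k)) hC.le (by field_simp; norm_num) hH hX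
      (congrFun (frameCoord_add_eq_zero f hk) 1) (fun i => hδ' _ (hi i)) (hδ' _ hr) (hrc 0) (hrc 1)
      (by linarith [ho.1]) (by linarith [ho.2]) (by linarith)
  have harea : ∀ᶠ k in U, 0 < area (inFrame f (c k) (p k)) := by
    filter_upwards [hfr'] with k hk
    exact area_inFrame_pos hk.1 (hp.area_pos k)
  have hwpos : ∀ᶠ k in U, 0 < w k := by
    filter_upwards [hX, harea] with k hX ha
    -- If the width vanishes, then so do all first coordinates, and the triangle is degenerate.
    refine lt_of_le_of_ne ((abs_nonneg _).trans (hX 0)) fun h0 => ha.ne' ?_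
    have hX0 : ∀ i, inFrame f (c k) (p k) i 0 = 0 := fun i =>
      abs_nonpos_iff.1 (h0 ▸ hX i)
    simp [area, hX0]
  have hblow : BlowUp f p U c w :=
    { classF := hf
      isRun := hp
      pos := hwpos
      tendsto_zero := hw0
      expansion := ⟨C, hexp'⟩
      area_pos := harea
      width_eq := fun _ => rfl
      fails := hfail }
  have hlim : ∀ i, ∃ V, LimitAt f U c w (fun k => p k i) V := fun i => by
    obtain ⟨x, hx⟩ : ∃ x, Tendsto (fun k => frameCoord f (c k) (p k i) 0 / w k) U (𝓝 x) := by
      refine exists_tendsto_of_bounded (M := 1) ?_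
      filter_upwards [hX, hwpos] with k hX hw
      rw [abs_div, abs_of_pos hw, div_le_one hw]
      exact hX i
    obtain ⟨y, hy⟩ : ∃ y, Tendsto (fun k => frameCoord f (c k) (p k i) 1 / w k ^ 2) U (𝓝 y) := by
      refine exists_tendsto_of_bounded (M := 108) ?_
      filter_upwards [hY, hwpos] with k hY hw
      rw [abs_div, abs_of_pos (pow_pos hw 2), div_le_iff₀ (pow_pos hw 2)]
      exact hY i
    exact ⟨(x, y + x ^ 2 / 2), hsub i, hx, by simpa using hy⟩
  obtain ⟨A, hA⟩ := hlim 0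
  obtain ⟨B, hB⟩ := hlim 1
  obtain ⟨D, hD⟩ := hlim 2
  exact hblow.false_of_contraction hcon hA hB hD

end RNM

theorem mainTheorem2 (f : RNM.Plane → ℝ) (hf : RNM.ClassF f)
    (p : ℕ → RNM.Triangle) (hp : RNM.IsRun f p)
    (hyp1 : ¬ ∃ z : RNM.Plane, (∀ q : RNM.Plane, f z ≤ f q) ∧ RNM.ConvergesTo p z) :
    ∃ K : ℕ, ∀ k₀ : ℕ, K ≤ k₀ → RNM.IsContraction f (p k₀) →
      ∀ c : RNM.Plane, RNM.IsSecondBase f (p k₀) c →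
        ∃ ℓ : ℕ, 1 ≤ ℓ ∧ ℓ ≤ 14 ∧
          RNM.flatness f c (p (k₀ + ℓ)) > 1.01 * RNM.flatness f c (p k₀) := by
  by_contra! hcon
  let Q : ℕ → RNM.Plane → Prop := fun k c => RNM.IsContraction f (p k) ∧
    RNM.IsSecondBase f (p k) c ∧ ∀ ℓ : ℕ, 1 ≤ ℓ → ℓ ≤ 14 →
      RNM.flatness f c (p (k + ℓ)) ≤ 1.01 * RNM.flatness f c (p k)
  have hfreq : ∃ᶠ k in atTop, ∃ c, Q k c := frequently_atTop.2 fun K => by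
    obtain ⟨k, hk, hcontr, c, hc, hfail⟩ := hcon K
    exact ⟨k, hk, c, hcontr, hc, hfail⟩
  obtain ⟨c, hc⟩ : ∃ c : ℕ → RNM.Plane, ∀ k, (∃ c, Q k c) → Q k (c k) := by
    refine ⟨fun k => Classical.epsilon (Q k), fun k hk => Classical.epsilon_spec hk⟩
  have : (atTop ⊓ 𝓟 {k | ∃ c, Q k c}).NeBot := frequently_mem_iff_neBot.1 hfreq
  have hU := Ultrafilter.of_le (atTop ⊓ 𝓟 {k | ∃ c, Q k c})
  have hQ : ∀ᶠ k in (Ultrafilter.of (atTop ⊓ 𝓟 {k | ∃ c, Q k c}) : Filter ℕ), Q k (c k) :=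
    mem_of_superset (hU (mem_inf_of_right (mem_principal_self _))) hc
  exact RNM.not_fails_along_contractions hf hp hyp1 (hU.trans inf_le_left)
    (hQ.mono fun k hk => hk.1)
    (hQ.mono fun k hk => hk.2.1.imp fun l hl => hl.imp fun r hr => hr.2.2)
    fun ℓ h1 h2 => hQ.mono fun k hk => hk.2.2 ℓ h1 h2
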